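/- **Setting.** Let $\mathcal X,\mathcal Y$ be Euclidean spaces, $X\subseteq\mathcal X$ and $Y\subseteq\mathcal Y$ closed convex sets with non-empty interior, $Y$ contained in a Euclidean ball of radius $R_y>0$. Let $F:X\times Y\to\mathbb R$ have partial gradients $\nabla_xF,\nabla_yF$ on $X\times Y$, let $F(x,\cdot)$ be concave on $Y$ for every $x\in X$, and let, for constants $L_{xx},L_{yy},L_{xy}>0$ and all $x,x'\in X$, $y,y'\in Y$, $$\|\nabla_xF(x',y)-\nabla_xF(x,y)\|\le L_{xx}\|x'-x\|,\qquad \|\nabla_yF(x,y')-\nabla_yF(x,y)\|\le L_{yy}\|y'-y\|,$$ $$\|\nabla_xF(x,y')-\nabla_xF(x,y)\|\le L_{xy}\|y'-y\|,\qquad \|\nabla_yF(x',y)-\nabla_yF(x,y)\|\le L_{xy}\|x'-x\|.$$ Put $\varphi(x)=\max_{y\in Y}F(x,y)$. Let $x_0\in X$, $\bar y\in Y$, let $\varphi$ be bounded below on $X$, and let $\Delta>0$ satisfy $\varphi(x_0)-\inf_X\varphi\le\Delta$ (for instance, $\Delta$ is the primal gap $\varphi(x_0)-\inf_X\varphi$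 itself if that is positive). Let $\varepsilon_x,\varepsilon_y>0$. For a convex set $Z$, $z\in Z$, a vector $\zeta$ and $L>0$, let $\mathsf S_Z(z,\zeta,L)\ge0$ be given by $$\mathsf S_Z^2(z,\zeta,L)=2L\max_{z'\in Z}\Big[-\langle\zeta,z'-z\rangle-\tfrac L2\|z'-z\|^2\Big].$$ A point $(\hat x,\hat y)\in X\times Y$ is an $(\varepsilon,\varepsilon')$-first-order Nash equilibrium (FNE) if $\mathsf S_X(\hat x,\nabla_xF(\hat x,\hat y),L_{xx})\le\varepsilon$ and $\mathsf S_Y(\hat y,-\nabla_yF(\hat x,\hat y),L_{yy})\le\varepsilon'$. **Algorithm.** Let $\mathrm{prox}_{z,Z}(\zeta)=\operatorname{argmin}_{z'\in Z}\langle\zeta,z'\rangle+\frac12\|z'-z\|^2$ (the projection of $z-\zeta$ onto $Z$). * $\mathsf{FGM}(z_0,Z,\gamma,T,g)$: set $G_0=0$; for $t=0,\dots,T-1$ set $u_t=\mathrm{prox}_{z_0,Z}(\gamma G_t)$, $\tau_t=\frac{2(t+2)}{(t+1)(t+4)}$, $v_{t+1}=\tau_tu_t+(1-\tau_t)z_t$,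 $g_t=\frac{t+2}2\,g(v_{t+1})$, $w_{t+1}=\mathrm{prox}_{u_t,Z}(\gamma g_t)$, $z_{t+1}=\tau_tw_{t+1}+(1-\tau_t)z_t$, $G_{t+1}=G_t+g_t$; return $z_T$. * $\mathsf{RestartFGM}(z^0,Z,\gamma,T,S,g)$: for $s=1,\dots,S$ set $z^s=\mathsf{FGM}(z^{s-1},Z,\gamma,T,g)$; return $z^S$. * $\mathsf{SolveRegDual}(y,x_{t-1})$: compute $\tilde x_t(y)=\mathsf{RestartFGM}\big(x_{t-1},X,\frac23\gamma_x,T^o,S^o,\ \nabla_xF(\cdot,y)+\frac1{\gamma_x}(\cdot-x_{t-1})\big)$ and $\tilde\nabla\psi_t(y)=\nabla_yF(\tilde x_t(y),y)-\lambda_y(y-\bar y)$; return both. * $\mathsf{FSP}$: for $t=1,\dots,\bar T_x$ set $y_t=\mathsf{RestartFGM}(\bar y,Y,\gamma_y,\bar T_y,S_y,-\tilde\nabla\psi_t(\cdot))$, with $\tilde\nabla\psi_t(y)$ returned by $\mathsf{SolveRegDual}(y,x_{t-1})$, and $x_t=\tilde x_t(y_t)$ returned by $\mathsf{SolveRegDual}(y_t,x_{t-1})$.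 Output $(x_\tau,y_\tau)$ for any $\tau\in\operatorname{Argmin}_{1\le t\le\bar T_x}\|x_t-x_{t-1}\|$. **Parameters.** Put $L_{yy}^+=L_{yy}+L_{xy}^2/L_{xx}$, $\lambda_y=\varepsilon_y/R_y$, $\Theta=L_{yy}R_y^2$, $\Theta^+=L_{yy}^+R_y^2$, $T_x=L_{xx}\Delta/\varepsilon_x^2$, $T_y=\sqrt{L_{yy}^+R_y/\varepsilon_y}$ and $$\delta=\min\Big[8\varepsilon_yR_y,\ \frac{\Theta}{2\bar T_y^3},\ \sqrt{\frac{\Delta(\Theta^+-\Theta)}{\bar T_x\bar T_y^2}}\Big].$$ The parameters are *prescribed* if $\gamma_x=\frac1{2L_{xx}}$, $\gamma_y=\frac1{L_{yy}^++\lambda_y}$, $T^o=11$, and the natural numbers $\bar T_x,\bar T_y,S_y,S^o$ satisfy $$\bar T_x\ge\frac{10L_{xx}(\Delta+2\varepsilon_yR_y)}{\varepsilon_x^2},\qquad \bar T_y\ge\sqrt{\frac{40(L_{yy}^++\lambda_y)}{\lambda_y}},\qquad S_y\ge2\log_2\max\Big[\bar T_y,\frac{\Theta^+}\delta\Big],$$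 $$S^o\ge\frac12\log_2\Big(72(3\Delta+2\Theta+6\varepsilon_yR_y)\Big[\frac{L_{xx}}{\varepsilon_x^2}+\frac{2\Theta^+}{\delta^2}+\frac1{12\delta}\Big]\Big).$$ **Theorem.** (a) With any prescribed parameters, $\mathsf{FSP}$ has an output, and every output is a $(2\varepsilon_x,5\varepsilon_y)$-FNE. If $X=\mathcal X$, the same holds with the selection rule $\tau\in\operatorname{Argmin}_{1\le t\le\bar T_x}\|\nabla_xF(x_t,y_t)\|$. (b) With any prescribed parameters, the number $N$ of evaluations of $\nabla F$ is exactly $$N=\bar T_x(S_y\bar T_y+1)(T^oS^o+1)\le1.02\,T^oS^oS_y\bar T_x\bar T_y,$$ and at most $2N$ projections onto $X$ and $Y$ are made. (c) Let $\bar T_x,\bar T_y$ and then $S_y,S^o$ be the least prescribed natural numbers. Then $N=\widetilde O(T_xT_y)$: there is an absolute constant $C$ such that, whenever $T_x\ge1$, $T_y\ge1$ and $\varepsilon_yR_y\le\Delta$, $$N\le C\,T_xT_y\log^2\Big(2+T_x+T_y+\frac{\Theta^+}{\Theta}+\frac{\Theta^+}{\Theta^+-\Theta}+\frac{\Theta^+}{\Delta}+\frac{\Delta}{\Theta^+}\Big).$$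 Moreover $N=\widetilde O(\varepsilon_x^{-2}\varepsilon_y^{-1/2})$: there is a constant $C'$ that depends only on $(L_{xx},L_{yy},L_{xy},R_y,\Delta)$ such that, for all $\varepsilon_x,\varepsilon_y\in(0,1]$, $$N\le C'\,\varepsilon_x^{-2}\varepsilon_y^{-1/2}\Big(1+\log\frac1{\varepsilon_x}+\log\frac1{\varepsilon_y}\Big)^2 .$$ -/

import Mathlib

open Set

universe u v

noncomputable section

/-- A value together with the number of gradient evaluations and of projections that were
spent on computing it. -/
structure Counted (α : Type*) where
  val : α
  grads : ℕ
  projs : ℕ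

namespace Counted

/-- A value that needs neither gradient evaluations nor projections. -/
def ret {α : Type*} (a : α) : Counted α := ⟨a, 0, 0⟩

/-- Sequential composition adds the costs. -/
def bind {α β : Type*} (m : Counted α) (f : α → Counted β) : Counted β :=
  ⟨(f m.val).val, m.grads + (f m.val).grads, m.projs + (f m.val).projs⟩

end Counted

section Measure

variable {E : Type*} [NormedAddCommGroup E] [InnerProductSpace ℝ E]

/-- The inaccuracy measure `S_Z(z, ζ, L)`, where
`S_Z² = 2 L max_{z' ∈ Z} [ - ⟨ζ, z' - z⟩ - (L / 2) ‖z' - z‖² ]`. For `L > 0` and `z ∈ Z` the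
supremum is finite and nonnegative, and it is attained if `Z` is closed. -/
def stationarity (Z : Set E) (z ζ : E) (L : ℝ) : ℝ :=
  Real.sqrt (2 * L *
    sSup ((fun z' : E => -(inner ℝ ζ (z' - z)) - L / 2 * ‖z' - z‖ ^ 2) '' Z))

/-- The prox-mapping `argmin_{z' ∈ Z} ⟨ζ, z'⟩ + ‖z' - z‖² / 2`; the minimizer exists and is unique
for closed convex nonempty `Z`, and it is the projection of `z - ζ` onto `Z`. -/
def prox (Z : Set E) (z ζ : E) : E :=
  Classical.epsilon fun p : E =>
    p ∈ Z ∧ IsMinOn (fun z' : E => inner ℝ ζ z' + 1 / 2 * ‖z' - z‖ ^ 2) Z p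

/-- One evaluation of the prox-mapping costs one projection. -/
def proxCall (Z : Set E) (z ζ : E) : Counted E := ⟨prox Z z ζ, 0, 1⟩

/-- Iteration `t` of the fast gradient method, started at `z₀`, with stepsize `γ` and gradient
oracle `oracle`. The state is the pair `(z_t, G_t)`. -/
def fgmStep (Z : Set E) (γ : ℝ) (oracle : E → Counted E) (z₀ : E) (t : ℕ) (s : E × E) :
    Counted (E × E) :=
  let τ : ℝ := 2 * ((t : ℝ) + 2) / (((t : ℝ) + 1) * ((t : ℝ) + 4))
  (proxCall Z z₀ (γ • s.2)).bind fun u =>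
  (oracle (τ • u + (1 - τ) • s.1)).bind fun d =>
  let g : E := (((t : ℝ) + 2) / 2) • d
  (proxCall Z u (γ • g)).bind fun w =>
  .ret (τ • w + (1 - τ) • s.1, s.2 + g)

/-- The first `T` iterations of the fast gradient method, with the final state `(z_T, G_T)`. -/
def fgmLoop (Z : Set E) (γ : ℝ) (oracle : E → Counted E) (z₀ : E) : ℕ → Counted (E × E)
  | 0 => .ret (z₀, 0)
  | T + 1 => (fgmLoop Z γ oracle z₀ T).bind fun s => fgmStep Z γ oracle z₀ T s

/-- The fast gradient method with `T` iterations. -/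
def fgm (Z : Set E) (γ : ℝ) (T : ℕ) (oracle : E → Counted E) (z₀ : E) : Counted E :=
  (fgmLoop Z γ oracle z₀ T).bind fun s => .ret s.1

/-- The fast gradient method with `T` iterations per epoch, run for `S` epochs, each started at
the output of the previous one. -/
def restartFGM (Z : Set E) (γ : ℝ) (T : ℕ) (oracle : E → Counted E) (z₀ : E) :
    ℕ → Counted E
  | 0 => .ret z₀
  | S + 1 => (restartFGM Z γ T oracle z₀ S).bind fun z => fgm Z γ T oracle z

end Measure

/-- The constants of a problem: the Lipschitz constants of the partial gradients, the radius of a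
ball that contains `Y`, and a bound on the primal gap at the initial point. -/
structure ProblemConstants where
  Lxx : ℝ
  Lyy : ℝ
  Lxy : ℝ
  Ry : ℝ
  Δ : ℝ

/-- The input parameters of the algorithm. -/
structure FSPParams where
  γx : ℝ
  γy : ℝ
  lamY : ℝ
  Tx : ℕ
  Ty : ℕ
  Sy : ℕ
  To : ℕ
  So : ℕ

namespace ProblemConstants

variable (c : ProblemConstants)

/-- All the constants are positive. -/
def Pos : Prop := 0 < c.Lxx ∧ 0 < c.Lyy ∧ 0 < c.Lxy ∧ 0 < c.Ry ∧ 0 < c.Δ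

/-- The coupling-adjusted constant `L_yy⁺ = L_yy + L_xy² / L_xx`. -/
def LyyPlus : ℝ := c.Lyy + c.Lxy ^ 2 / c.Lxx

/-- `Θ = L_yy R_y²`. -/
def Θ : ℝ := c.Lyy * c.Ry ^ 2

/-- `Θ⁺ = L_yy⁺ R_y²`. -/
def ΘPlus : ℝ := c.LyyPlus * c.Ry ^ 2

/-- `λ_y = ε_y / R_y`. -/
def lam (εy : ℝ) : ℝ := εy / c.Ry

/-- The primal complexity factor `T_x = L_xx Δ / ε_x²`. -/
def factorX (εx : ℝ) : ℝ := c.Lxx * c.Δ / εx ^ 2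

/-- The dual complexity factor `T_y = √(L_yy⁺ R_y / ε_y)`. -/
def factorY (εy : ℝ) : ℝ := Real.sqrt (c.LyyPlus * c.Ry / εy)

/-- The oracle accuracy `δ`, for `Tx` outer iterations and `Ty` iterations per dual epoch. -/
def δ (εy : ℝ) (Tx Ty : ℕ) : ℝ :=
  min (8 * εy * c.Ry) (min (c.Θ / (2 * (Ty : ℝ) ^ 3))
    (Real.sqrt (c.Δ * (c.ΘPlus - c.Θ) / ((Tx : ℝ) * (Ty : ℝ) ^ 2))))

/-- The lower bound for the number of outer iterations. -/
def boundTx (εx εy : ℝ) : ℝ := 10 * c.Lxx * (c.Δ + 2 * εy * c.Ry) / εx ^ 2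

/-- The lower bound for the number of iterations per dual epoch. -/
def boundTy (εy : ℝ) : ℝ := Real.sqrt (40 * (c.LyyPlus + c.lam εy) / c.lam εy)

/-- The lower bound for the number of dual epochs. -/
def boundSy (εy : ℝ) (Tx Ty : ℕ) : ℝ :=
  2 * Real.logb 2 (max (Ty : ℝ) (c.ΘPlus / c.δ εy Tx Ty))

/-- The lower bound for the number of primal epochs. -/
def boundSo (εx εy : ℝ) (Tx Ty : ℕ) : ℝ :=
  1 / 2 * Real.logb 2 (72 * (3 * c.Δ + 2 * c.Θ + 6 * εy * c.Ry) *
    (c.Lxx / εx ^ 2 + 2 * c.ΘPlus / c.δ εy Tx Ty ^ 2 + 1 / (12 * c.δ εy Tx Ty)))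

/-- The parameters are chosen as prescribed for the accuracies `εx`, `εy`. -/
structure Prescribed (εx εy : ℝ) (p : FSPParams) : Prop where
  γx_eq : p.γx = 1 / (2 * c.Lxx)
  γy_eq : p.γy = 1 / (c.LyyPlus + c.lam εy)
  lamY_eq : p.lamY = c.lam εy
  le_Tx : c.boundTx εx εy ≤ p.Tx
  le_Ty : c.boundTy εy ≤ p.Ty
  le_Sy : c.boundSy εy p.Tx p.Ty ≤ p.Sy
  To_eq : p.To = 11
  le_So : c.boundSo εx εy p.Tx p.Ty ≤ p.So

/-- The prescribed parameters with the least admissible integers, chosen in the order in which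
the prescriptions depend on each other. -/
def leastParams (εx εy : ℝ) : FSPParams :=
  let Tx := ⌈c.boundTx εx εy⌉₊
  let Ty := ⌈c.boundTy εy⌉₊
  { γx := 1 / (2 * c.Lxx)
    γy := 1 / (c.LyyPlus + c.lam εy)
    lamY := c.lam εy
    Tx := Tx
    Ty := Ty
    Sy := ⌈c.boundSy εy Tx Ty⌉₊
    To := 11
    So := ⌈c.boundSo εx εy Tx Ty⌉₊ }

theorem leastParams_prescribed (εx εy : ℝ) : c.Prescribed εx εy (c.leastParams εx εy) :=
  ⟨rfl, rfl, rfl, Nat.le_ceil _, Nat.le_ceil _, Nat.le_ceil _, rfl, Nat.le_ceil _⟩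

/-- The quantity whose logarithm bounds the numbers of epochs: it consists of the complexity
factors and of the ratios between `Θ`, `Θ⁺`, `Θ⁺ - Θ` and `Δ`. -/
def logArg (εx εy : ℝ) : ℝ :=
  2 + c.factorX εx + c.factorY εy + c.ΘPlus / c.Θ + c.ΘPlus / (c.ΘPlus - c.Θ)
    + c.ΘPlus / c.Δ + c.Δ / c.ΘPlus

end ProblemConstants

section MinMax

variable {E G : Type*} [NormedAddCommGroup E] [InnerProductSpace ℝ E] [CompleteSpace E]
  [NormedAddCommGroup G] [InnerProductSpace ℝ G] [CompleteSpace G]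

/-- The partial gradient `∇_x F(x, y)` of `F : X × Y → ℝ`. -/
def gradX (F : E → G → ℝ) (X : Set E) (x : E) (y : G) : E :=
  gradientWithin (fun x' => F x' y) X x

/-- The partial gradient `∇_y F(x, y)` of `F : X × Y → ℝ`. -/
def gradY (F : E → G → ℝ) (Y : Set G) (x : E) (y : G) : G :=
  gradientWithin (fun y' => F x y') Y y

/-- The standing assumptions on the min-max problem `min_{x ∈ X} max_{y ∈ Y} F(x, y)`. Only the
values of `F` on `X × Y` matter. -/
structure SmoothConcaveProblem (F : E → G → ℝ) (X : Set E) (Y : Set G)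
    (c : ProblemConstants) : Prop where
  convex_X : Convex ℝ X
  closed_X : IsClosed X
  interior_X : (interior X).Nonempty
  convex_Y : Convex ℝ Y
  closed_Y : IsClosed Y
  interior_Y : (interior Y).Nonempty
  ball_Y : ∃ y₁ : G, Y ⊆ Metric.closedBall y₁ c.Ry
  diff_x : ∀ y ∈ Y, DifferentiableOn ℝ (fun x => F x y) X
  diff_y : ∀ x ∈ X, DifferentiableOn ℝ (fun y => F x y) Y
  concave : ∀ x ∈ X, ConcaveOn ℝ Y (fun y => F x y)
  lip_xx : ∀ x ∈ X, ∀ x' ∈ X, ∀ y ∈ Y,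
    ‖gradX F X x' y - gradX F X x y‖ ≤ c.Lxx * ‖x' - x‖
  lip_yy : ∀ x ∈ X, ∀ y ∈ Y, ∀ y' ∈ Y,
    ‖gradY F Y x y' - gradY F Y x y‖ ≤ c.Lyy * ‖y' - y‖
  lip_xy : ∀ x ∈ X, ∀ y ∈ Y, ∀ y' ∈ Y,
    ‖gradX F X x y' - gradX F X x y‖ ≤ c.Lxy * ‖y' - y‖
  lip_yx : ∀ x ∈ X, ∀ x' ∈ X, ∀ y ∈ Y,
    ‖gradY F Y x' y - gradY F Y x y‖ ≤ c.Lxy * ‖x' - x‖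

/-- The primal function `φ(x) = max_{y ∈ Y} F(x, y)`. -/
def primal (F : E → G → ℝ) (Y : Set G) (x : E) : ℝ := sSup ((fun y => F x y) '' Y)

/-- The primal gap `φ(x₀) - inf_{x ∈ X} φ(x)`. -/
def primalGap (F : E → G → ℝ) (X : Set E) (Y : Set G) (x₀ : E) : ℝ :=
  primal F Y x₀ - sInf (primal F Y '' X)

/-- `(x, y)` is an `(εx, εy)`-approximate first-order Nash equilibrium. -/
def IsFNE (F : E → G → ℝ) (X : Set E) (Y : Set G) (c : ProblemConstants) (εx εy : ℝ)
    (x : E) (y : G) : Prop :=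
  x ∈ X ∧ y ∈ Y ∧
    stationarity X x (gradX F X x y) c.Lxx ≤ εx ∧
    stationarity Y y (-gradY F Y x y) c.Lyy ≤ εy

/-- One evaluation of the full gradient `∇F(x, y)`. -/
def gradCall (F : E → G → ℝ) (X : Set E) (Y : Set G) (x : E) (y : G) : Counted (E × G) :=
  ⟨(gradX F X x y, gradY F Y x y), 1, 0⟩

/-- The subroutine that solves the regularized dual problem approximately at `y`, for the previous
primal iterate `xprev`: it returns the approximate minimizer `x̃(y)` of
`F(·, y) + ‖· - xprev‖² / (2 γx)` over `X` and the approximate dual gradient at `y`. -/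
def solveRegDual (F : E → G → ℝ) (X : Set E) (Y : Set G) (p : FSPParams) (xprev : E) (ybar : G)
    (y : G) : Counted (E × G) :=
  (restartFGM X (2 / 3 * p.γx) p.To
    (fun x => (gradCall F X Y x y).bind fun g => .ret (g.1 + (1 / p.γx) • (x - xprev)))
    xprev p.So).bind fun xt =>
  (gradCall F X Y xt y).bind fun g =>
  .ret (xt, g.2 - p.lamY • (y - ybar))

/-- One outer iteration: from `x_{t-1}` to `(x_t, y_t)`. -/
def fspStep (F : E → G → ℝ) (X : Set E) (Y : Set G) (p : FSPParams) (ybar : G) (xprev : E) :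
    Counted (E × G) :=
  (restartFGM Y p.γy p.Ty
    (fun y' => (solveRegDual F X Y p xprev ybar y').bind fun r => .ret (-r.2))
    ybar p.Sy).bind fun y =>
  (solveRegDual F X Y p xprev ybar y).bind fun r =>
  .ret (r.1, y)

/-- The first `t` outer iterations of the algorithm: the value is `(x_t, y_t)`, and the counters
hold all the evaluations and projections made so far. -/
def fspIter (F : E → G → ℝ) (X : Set E) (Y : Set G) (p : FSPParams) (x₀ : E) (ybar : G) :
    ℕ → Counted (E × G)
  | 0 => .ret (x₀, ybar)
  | t + 1 => (fspIter F X Y p x₀ ybar t).bind fun s => fspStep F X Y p ybar s.1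

/-- The whole run of the algorithm (for the costs): `Tx` outer iterations. -/
def fspRun (F : E → G → ℝ) (X : Set E) (Y : Set G) (p : FSPParams) (x₀ : E) (ybar : G) :
    Counted (E × G) :=
  fspIter F X Y p x₀ ybar p.Tx

/-- `q` is an output `(x_τ, y_τ)` of the algorithm, where `τ ∈ {1, …, Tx}` minimizes
`score (t - 1)`; here `score t` belongs to the iteration that leads from `t` to `t + 1`. -/
def IsOutputBy (F : E → G → ℝ) (X : Set E) (Y : Set G) (p : FSPParams) (x₀ : E) (ybar : G)
    (score : ℕ → ℝ) (q : E × G) : Prop :=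
  ∃ τ < p.Tx, (∀ t < p.Tx, score τ ≤ score t) ∧ q = (fspIter F X Y p x₀ ybar (τ + 1)).val

/-- `q` is an output of the algorithm: `q = (x_τ, y_τ)` with
`τ ∈ Argmin_{1 ≤ t ≤ Tx} ‖x_t - x_{t-1}‖`. -/
def IsFSPOutput (F : E → G → ℝ) (X : Set E) (Y : Set G) (p : FSPParams) (x₀ : E) (ybar : G)
    (q : E × G) : Prop :=
  IsOutputBy F X Y p x₀ ybar
    (fun t => ‖(fspIter F X Y p x₀ ybar (t + 1)).val.1 - (fspIter F X Y p x₀ ybar t).val.1‖) q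

/-- `q` is an output of the algorithm with the alternative selection rule
`τ ∈ Argmin_{1 ≤ t ≤ Tx} ‖∇_x F(x_t, y_t)‖`. -/
def IsFSPGradOutput (F : E → G → ℝ) (X : Set E) (Y : Set G) (p : FSPParams) (x₀ : E) (ybar : G)
    (q : E × G) : Prop :=
  IsOutputBy F X Y p x₀ ybar
    (fun t => ‖gradX F X (fspIter F X Y p x₀ ybar (t + 1)).val.1
      (fspIter F X Y p x₀ ybar (t + 1)).val.2‖) q

end MinMax

end

/-! `FSP` is an inexact proximal point method for the primal function. The term `Lxx ‖x - x_{t-1}‖²`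
makes the inner problem strongly convex in `x`, with modulus `Lxx` and smoothness `3 Lxx`; the term
`-lam/2 ‖y - ybar‖²` adds strong concavity in `y`. Minimizing over `x` leaves a dual function that
is `lam`-strongly concave and `(LyyPlus + lam)`-smooth, but whose gradient is only available through
an inner solve of accuracy `σ`.

Three ingredients carry the proof. (1) Such an inner solve is an inexact first-order oracle, a
two-sided quadratic model with error `σ` (`negDual_hasModel`), and the fast gradient method
tolerates it, losing `O(T² σ)` (`fgm_gap_le`). Under quadratic growth, restarts contract the gap
geometrically (`restartFGM_gap_le`). (2) A small gap in a model of smoothness `L` gives a small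
stationarity measure with a constant of order `L`. The measure is monotone in its constant and
satisfies a triangle inequality in the gradient, so the regularizers can be removed at a cost `2 Lxx
‖x_t - x_{t-1}‖` in `x` and `2 lam Ry = 2 εy` in `y`. (3) Near-stationarity in `y`, with constant
`lam`, shows that `max_y [F(x, y) - lam/2 ‖y - ybar‖²]` drops by `Lxx ‖x_t - x_{t-1}‖²` at each
step, up to an error `σ + W / (2 lam)` (`fspStep_spec`). Summing the drops bounds the shortest of
`Tx` steps, which is the primal guarantee.

The inner solver needs an initial gap bound that is uniform in `t`. It follows from the same
potential, together with a bound on mixed differences of `F`, provided the total error stays below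
`D = Δ + 2 εy Ry`; hence the induction in `fspIter_spec`. The prescribed numbers of epochs make `σ`
and `W` small enough (`Prescribed.accuracy`). The evaluation count is exact bookkeeping. With least
parameters, every logarithm's argument is at most a fixed power of one quantity `P`, so the two
epoch counts contribute `log² P`. -/

noncomputable section

/-! ### Inexact quadratic models, strong minimizers and the prox-mapping. -/

section Oracle

variable {E : Type*} [NormedAddCommGroup E] [InnerProductSpace ℝ E]

/-- A two-sided quadratic model of `f` on `Z`, with values `fv`, gradients `g`, smoothness `L`,
strong convexity modulus `μ` and inaccuracy `σ`. -/
def HasModel (Z : Set E) (f fv : E → ℝ) (g : E → E) (L μ σ : ℝ) : Prop :=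
  ∀ v ∈ Z, ∀ u ∈ Z,
    fv v + inner ℝ (g v) (u - v) + μ / 2 * ‖u - v‖ ^ 2 ≤ f u ∧
    f u ≤ fv v + inner ℝ (g v) (u - v) + L / 2 * ‖u - v‖ ^ 2
      + Real.sqrt (2 * (L - μ) * σ) * ‖u - v‖ + σ

/-- `z` minimizes `f` over `Z`, with quadratic growth of modulus `μ`. -/
def IsStrongMin (Z : Set E) (f : E → ℝ) (μ : ℝ) (z : E) : Prop :=
  z ∈ Z ∧ ∀ u ∈ Z, f z + μ / 2 * ‖u - z‖ ^ 2 ≤ f u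

/-- The lower model at `w = z + s (u - z)` is evaluated at `z` and at `u`; with weights `1 - s` and
`s` the linear terms cancel. Using `f z ≤ f w`, dividing by `s` and letting `s → 0` gives the
growth, without any optimality condition on `g z`. -/
theorem IsStrongMin.of_isMinOn {Z : Set E} (hZ : Convex ℝ Z) {f : E → ℝ} {g : E → E}
    {L μ : ℝ} (h : HasModel Z f f g L μ 0) {z : E} (hz : z ∈ Z) (hmin : IsMinOn f Z z) :
    IsStrongMin Z f μ z := by
  refine ⟨hz, fun u hu => ?_⟩
  have key : ∀ s : ℝ, 0 < s → s < 1 → f z + μ / 2 * ((1 - s) * ‖u - z‖ ^ 2) ≤ f u := by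
    intro s hs hs1
    set w := z + s • (u - z) with hw
    have hwZ : w ∈ Z := hZ.add_smul_sub_mem hz hu ⟨hs.le, hs1.le⟩
    have h1 := (h w hwZ z hz).1
    have h2 := (h w hwZ u hu).1
    have h3 : f z ≤ f w := hmin hwZ
    have e1 : z - w = (-s) • (u - z) := by rw [hw]; module
    have e2 : u - w = (1 - s) • (u - z) := by rw [hw]; module
    rw [e1, inner_smul_right, norm_smul, mul_pow, Real.norm_eq_abs, sq_abs] at h1
    rw [e2, inner_smul_right, norm_smul, mul_pow, Real.norm_eq_abs, sq_abs] at h2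
    have h4 := mul_le_mul_of_nonneg_left h1 (sub_nonneg.2 hs1.le)
    have h5 := mul_le_mul_of_nonneg_left h2 hs.le
    have h6 : s * (f z + μ / 2 * ((1 - s) * ‖u - z‖ ^ 2)) ≤ s * f u := by
      nlinarith
    exact le_of_mul_le_mul_left h6 hs
  have hlim : Filter.Tendsto (fun s : ℝ => f z + μ / 2 * ((1 - s) * ‖u - z‖ ^ 2))
      (nhdsWithin 0 (Ioi 0)) (nhds (f z + μ / 2 * ((1 - 0) * ‖u - z‖ ^ 2))) := by
    apply Filter.Tendsto.mono_left _ nhdsWithin_le_nhds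
    exact Continuous.tendsto (by fun_prop) 0
  have := le_of_tendsto hlim (by
    filter_upwards [Ioo_mem_nhdsGT (show (0 : ℝ) < 1 by norm_num)] with s hs
    exact key s hs.1 hs.2)
  simpa using this

theorem HasModel.continuousOn {Z : Set E} {f : E → ℝ} {g : E → E} {L μ : ℝ}
    (h : HasModel Z f f g L μ 0) : ContinuousOn f Z := by
  intro v hv
  have hlo : Filter.Tendsto (fun u => f v + inner ℝ (g v) (u - v) + μ / 2 * ‖u - v‖ ^ 2)
      (nhdsWithin v Z) (nhds (f v)) := by
    apply Filter.Tendsto.mono_left _ nhdsWithin_le_nhds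
    have : Continuous (fun u => f v + inner ℝ (g v) (u - v) + μ / 2 * ‖u - v‖ ^ 2) := by fun_prop
    simpa using this.tendsto v
  have hhi : Filter.Tendsto (fun u => f v + inner ℝ (g v) (u - v) + L / 2 * ‖u - v‖ ^ 2)
      (nhdsWithin v Z) (nhds (f v)) := by
    apply Filter.Tendsto.mono_left _ nhdsWithin_le_nhds
    have : Continuous (fun u => f v + inner ℝ (g v) (u - v) + L / 2 * ‖u - v‖ ^ 2) := by fun_prop
    simpa using this.tendsto v
  refine tendsto_of_tendsto_of_tendsto_of_le_of_le' hlo hhi ?_ ?_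
  · filter_upwards [self_mem_nhdsWithin] with u hu using (h v hv u hu).1
  · filter_upwards [self_mem_nhdsWithin] with u hu
    simpa using (h v hv u hu).2

theorem HasModel.exists_isStrongMin [FiniteDimensional ℝ E] {Z : Set E} (hZ : Convex ℝ Z)
    (hcl : IsClosed Z) (hne : Z.Nonempty) {f : E → ℝ} {g : E → E} {L μ : ℝ} (hμ : 0 < μ)
    (h : HasModel Z f f g L μ 0) : ∃ z, IsStrongMin Z f μ z := by
  obtain ⟨v, hv⟩ := hne
  have hex : ∃ z ∈ Z, IsMinOn f Z z := by
    -- Beyond this radius the quadratic term of the lower model at `v` dominates the linear one, so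
    -- `f` is at least `f v` there.
    set r := 2 * ‖g v‖ / μ with hr
    have hr0 : 0 ≤ r := by positivity
    have hK : IsCompact (Z ∩ Metric.closedBall v r) :=
      (isCompact_closedBall v r).inter_left hcl
    obtain ⟨z, hz, hzmin⟩ := hK.exists_isMinOn ⟨v, hv, Metric.mem_closedBall_self hr0⟩
      (h.continuousOn.mono inter_subset_left)
    refine ⟨z, hz.1, fun u hu => ?_⟩
    by_cases hur : u ∈ Metric.closedBall v r
    · exact hzmin ⟨hu, hur⟩
    · have h1 : f z ≤ f v := hzmin ⟨hv, Metric.mem_closedBall_self hr0⟩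
      have h2 := (h v hv u hu).1
      have h3 := abs_le.1 (abs_real_inner_le_norm (g v) (u - v))
      rw [Metric.mem_closedBall, dist_eq_norm, not_le, hr, div_lt_iff₀ hμ] at hur
      have h4 : 0 ≤ ‖u - v‖ := norm_nonneg _
      have : f v ≤ f u := by nlinarith [h3.1, mul_le_mul_of_nonneg_left hur.le h4]
      exact h1.trans this
  obtain ⟨z, hz, hmin⟩ := hex
  exact ⟨z, IsStrongMin.of_isMinOn hZ h hz hmin⟩

theorem prox_spec [FiniteDimensional ℝ E] {Z : Set E} (hZ : Convex ℝ Z) (hcl : IsClosed Z)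
    (hne : Z.Nonempty) (z ζ : E) :
    prox Z z ζ ∈ Z ∧ ∀ w ∈ Z,
      inner ℝ ζ (prox Z z ζ) + 1 / 2 * ‖prox Z z ζ - z‖ ^ 2 + 1 / 2 * ‖w - prox Z z ζ‖ ^ 2
        ≤ inner ℝ ζ w + 1 / 2 * ‖w - z‖ ^ 2 := by
  set f : E → ℝ := fun z' : E => inner ℝ ζ z' + 1 / 2 * ‖z' - z‖ ^ 2 with hf
  have hmod : HasModel Z f f (fun v => ζ + (v - z)) 1 1 0 := by
    intro v _ u _
    have e : u - z = (u - v) + (v - z) := by abel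
    have : f u = f v + inner ℝ (ζ + (v - z)) (u - v) + 1 / 2 * ‖u - v‖ ^ 2 := by
      simp only [hf]
      rw [e, norm_add_sq_real, inner_add_left, real_inner_comm (u - v) (v - z),
        inner_sub_right ζ]
      ring
    constructor
    · exact this.ge
    · simpa using this.le
  have hex : ∃ p : E, p ∈ Z ∧ IsMinOn f Z p := by
    obtain ⟨p, hp⟩ := hmod.exists_isStrongMin hZ hcl hne one_pos
    exact ⟨p, hp.1, fun u hu => by
      have := hp.2 u hu
      have h2 : (0 : ℝ) ≤ 1 / 2 * ‖u - p‖ ^ 2 := by positivity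
      show f p ≤ f u
      linarith⟩
  have hp : prox Z z ζ ∈ Z ∧ IsMinOn f Z (prox Z z ζ) := Classical.epsilon_spec hex
  exact ⟨hp.1, (IsStrongMin.of_isMinOn hZ hmod hp.1 hp.2).2⟩

end Oracle

/-! ### Calculus of the stationarity measure. -/

section Stationarity

variable {E : Type*} [NormedAddCommGroup E] [InnerProductSpace ℝ E]

theorem stationarity_nonneg (Z : Set E) (z ζ : E) (L : ℝ) : 0 ≤ stationarity Z z ζ L :=
  Real.sqrt_nonneg _

theorem neg_inner_sub_le (ζ d : E) (L : ℝ) :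
    2 * L * (-(inner ℝ ζ d) - L / 2 * ‖d‖ ^ 2) ≤ ‖ζ‖ ^ 2 := by
  have := sq_nonneg ‖ζ + L • d‖
  rw [norm_add_sq_real, inner_smul_right, norm_smul, Real.norm_eq_abs, mul_pow, sq_abs] at this
  nlinarith

theorem le_stationarity_sq {Z : Set E} {z ζ : E} {L : ℝ} (hL : 0 < L) {z' : E} (hz' : z' ∈ Z) :
    2 * L * (-(inner ℝ ζ (z' - z)) - L / 2 * ‖z' - z‖ ^ 2) ≤ stationarity Z z ζ L ^ 2 := by
  have hb : BddAbove ((fun z' : E => -(inner ℝ ζ (z' - z)) - L / 2 * ‖z' - z‖ ^ 2) '' Z) := by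
    refine ⟨‖ζ‖ ^ 2 / (2 * L), ?_⟩
    rintro _ ⟨w, _, rfl⟩
    rw [le_div_iff₀ (by positivity), mul_comm]
    exact neg_inner_sub_le ζ (w - z) L
  have h1 := le_csSup hb (mem_image_of_mem _ hz')
  have h2 := mul_le_mul_of_nonneg_left h1 (show (0 : ℝ) ≤ 2 * L by positivity)
  refine h2.trans ?_
  by_cases h0 : 0 ≤ 2 * L *
    sSup ((fun z' : E => -(inner ℝ ζ (z' - z)) - L / 2 * ‖z' - z‖ ^ 2) '' Z)
  · rw [stationarity, Real.sq_sqrt h0]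
  · exact (not_le.1 h0).le.trans (sq_nonneg _)

theorem stationarity_le {Z : Set E} (hne : Z.Nonempty) {z ζ : E} {L b : ℝ} (hL : 0 < L)
    (hb : 0 ≤ b)
    (h : ∀ z' ∈ Z, 2 * L * (-(inner ℝ ζ (z' - z)) - L / 2 * ‖z' - z‖ ^ 2) ≤ b ^ 2) :
    stationarity Z z ζ L ≤ b := by
  refine Real.sqrt_le_iff.2 ⟨hb, ?_⟩
  rw [mul_comm, ← le_div_iff₀ (by positivity)]
  refine csSup_le (hne.image _) ?_
  rintro _ ⟨w, hw, rfl⟩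
  rw [le_div_iff₀ (by positivity), mul_comm]
  exact h w hw

/-- Shrinking the displacement `w - z` by the factor `L / L'` gives exactly the same value in the
supremum for `L'`; convexity keeps the shrunken point in `Z`. -/
theorem stationarity_mono {Z : Set E} (hZ : Convex ℝ Z) {z ζ : E} (hz : z ∈ Z) {L L' : ℝ}
    (hL : 0 < L) (hLL' : L ≤ L') : stationarity Z z ζ L ≤ stationarity Z z ζ L' := by
  refine stationarity_le ⟨z, hz⟩ hL (stationarity_nonneg _ _ _ _) fun w hw => ?_
  have hL' : 0 < L' := hL.trans_le hLL'
  have hmem : z + (L / L') • (w - z) ∈ Z :=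
    hZ.add_smul_sub_mem hz hw ⟨by positivity, (div_le_one hL').2 hLL'⟩
  refine le_trans (le_of_eq ?_) (le_stationarity_sq hL' hmem)
  rw [add_sub_cancel_left, inner_smul_right, norm_smul, mul_pow, Real.norm_eq_abs, sq_abs]
  field_simp

/-- With `r = L ‖w - z‖` and `a = -⟨ζ, w - z⟩`, the claim is `2La + 2‖η‖r - r² ≤ (S + ‖η‖)²`. If `0
< La ≤ r²`, the best point on the segment towards `w` gives `La ≤ S r`, and a square is completed.
If `La > r²`, the point `w` itself gives `r ≤ S`. If `a ≤ 0`, the term in `η` alone suffices. -/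
theorem stationarity_add_le {Z : Set E} (hZ : Convex ℝ Z) {z ζ η : E} (hz : z ∈ Z) {L : ℝ}
    (hL : 0 < L) : stationarity Z z (ζ + η) L ≤ stationarity Z z ζ L + ‖η‖ := by
  set S := stationarity Z z ζ L with hS
  have hS0 : 0 ≤ S := stationarity_nonneg _ _ _ _
  refine stationarity_le ⟨z, hz⟩ hL (by positivity) fun w hw => ?_
  set r := L * ‖w - z‖ with hr
  set a := -(inner ℝ ζ (w - z)) with ha
  have hη := abs_le.1 (abs_real_inner_le_norm η (w - z))
  have h1 : 2 * L * (a - L / 2 * ‖w - z‖ ^ 2) ≤ S ^ 2 := le_stationarity_sq hL hw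
  have hr0 : 0 ≤ r := by positivity
  have hη0 := norm_nonneg η
  have hgoal : 2 * L * (-(inner ℝ (ζ + η) (w - z)) - L / 2 * ‖w - z‖ ^ 2)
      ≤ 2 * L * a + 2 * ‖η‖ * r - r ^ 2 := by
    rw [inner_add_left, hr]
    nlinarith [hη.1]
  refine hgoal.trans ?_
  have h1' : 2 * L * a - r ^ 2 ≤ S ^ 2 := by rw [hr]; nlinarith
  rcases le_or_gt a 0 with ha0 | ha0
  · nlinarith [sq_nonneg (‖η‖ - r), mul_nonneg hS0 hη0, mul_nonneg hL.le (neg_nonneg.2 ha0),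
      sq_nonneg S]
  · have hr1 : 0 < r := by
      rcases hr0.eq_or_lt with h | h
      · have h0 : ‖w - z‖ = 0 := by
          rcases mul_eq_zero.1 h.symm with h | h
          · exact absurd h hL.ne'
          · exact h
        rw [norm_eq_zero] at h0
        rw [ha, h0, inner_zero_right] at ha0
        simp at ha0
      · exact h
    rcases le_or_gt (L * a) (r ^ 2) with har | har
    · have hs : z + (L * a / r ^ 2) • (w - z) ∈ Z :=
        hZ.add_smul_sub_mem hz hw ⟨by positivity, (div_le_one (by positivity)).2 har⟩
      have h2 := le_stationarity_sq (ζ := ζ) (z := z) hL hs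
      rw [add_sub_cancel_left, inner_smul_right, norm_smul, Real.norm_eq_abs,
        mul_pow |L * a / r ^ 2|, sq_abs] at h2
      have h3 : (L * a / r) ^ 2 ≤ S ^ 2 := by
        refine le_trans (le_of_eq ?_) h2
        have e1 : (inner ℝ ζ (w - z) : ℝ) = -a := by rw [ha]; ring
        have e2 : ‖w - z‖ = r / L := by rw [hr]; field_simp
        rw [e1, e2]
        field_simp
        ring
      have h4 : L * a / r ≤ S := by
        refine (sq_le_sq₀ (by positivity) hS0).1 h3
      have h5 : L * a ≤ S * r := by rwa [div_le_iff₀ hr1] at h4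
      nlinarith [sq_nonneg (S + ‖η‖ - r)]
    · have h2 : r ^ 2 ≤ S ^ 2 := by nlinarith
      have h3 : r ≤ S := (sq_le_sq₀ hr0 hS0).1 h2
      nlinarith [mul_le_mul_of_nonneg_left h3 hη0, sq_nonneg ‖η‖]

theorem stationarity_univ (z ζ : E) {L : ℝ} (hL : 0 < L) :
    stationarity (univ : Set E) z ζ L = ‖ζ‖ := by
  refine le_antisymm ?_ ?_
  · exact stationarity_le univ_nonempty hL (norm_nonneg _) fun w _ => neg_inner_sub_le _ _ L
  · have := le_stationarity_sq (ζ := ζ) (z := z) hL (mem_univ (z - L⁻¹ • ζ))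
    rw [sub_sub_cancel_left, inner_neg_right, norm_neg, inner_smul_right,
      real_inner_self_eq_norm_sq, norm_smul, mul_pow, Real.norm_eq_abs, sq_abs] at this
    refine (sq_le_sq₀ (norm_nonneg _) (stationarity_nonneg _ _ _ _)).1 (le_trans (le_of_eq ?_) this)
    field_simp
    ring

end Stationarity

/-! ### The fast gradient method and its restarts with an inexact oracle. -/

section FGM

variable {E : Type*} [NormedAddCommGroup E] [InnerProductSpace ℝ E]

/-- The estimate sequence of the fast gradient method: a model with weight `A` and linear part `G`
that, with a quadratic term of curvature `μ`, minorizes `A f` on `Z` and, regularized at `z₀`,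
majorizes `A f(z)` up to `e`. -/
def EstimateSeq (Z : Set E) (f : E → ℝ) (L μ : ℝ) (z₀ : E) (A e : ℝ) (z G : E) : Prop :=
  z ∈ Z ∧ ∃ c : ℝ, (∀ x ∈ Z, c + inner ℝ G x + μ / 2 * ‖x - z₀‖ ^ 2 ≤ A * f x) ∧
    ∀ x ∈ Z, A * f z ≤ c + inner ℝ G x + L / 2 * ‖x - z₀‖ ^ 2 + e

theorem EstimateSeq.mono {Z : Set E} {f : E → ℝ} {L μ : ℝ} {z₀ : E} {A e e' : ℝ} {z G : E}
    (h : EstimateSeq Z f L μ z₀ A e z G) (he : e ≤ e') : EstimateSeq Z f L μ z₀ A e' z G := by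
  obtain ⟨hz, c, h1, h2⟩ := h
  exact ⟨hz, c, h1, fun x hx => (h2 x hx).trans (by linarith)⟩

theorem EstimateSeq.gap_le {Z : Set E} {f : E → ℝ} {L μ : ℝ} {z₀ : E} {A e : ℝ} {z G : E}
    (h : EstimateSeq Z f L μ z₀ A e z G) {x : E} (hx : x ∈ Z) :
    A * (f z - f x) ≤ (L - μ) / 2 * ‖x - z₀‖ ^ 2 + e := by
  obtain ⟨_, c, h1, h2⟩ := h
  have := h1 x hx
  have := h2 x hx
  linarith

/-- The state after one iteration. -/
theorem fgmLoop_succ_val (Z : Set E) (γ : ℝ) (oracle : E → Counted E) (z₀ : E) (T : ℕ) :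
    (fgmLoop Z γ oracle z₀ (T + 1)).val =
      (fgmStep Z γ oracle z₀ T (fgmLoop Z γ oracle z₀ T).val).val := rfl

variable [FiniteDimensional ℝ E]

theorem prox_spec_scaled {Z : Set E} (hZ : Convex ℝ Z) (hcl : IsClosed Z) (hne : Z.Nonempty)
    {L : ℝ} (hL : 0 < L) (z ζ : E) :
    prox Z z ((1 / L) • ζ) ∈ Z ∧ ∀ x ∈ Z,
      inner ℝ ζ (prox Z z ((1 / L) • ζ)) + L / 2 * ‖prox Z z ((1 / L) • ζ) - z‖ ^ 2
        + L / 2 * ‖x - prox Z z ((1 / L) • ζ)‖ ^ 2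
        ≤ inner ℝ ζ x + L / 2 * ‖x - z‖ ^ 2 := by
  obtain ⟨h1, h2⟩ := prox_spec hZ hcl hne z ((1 / L) • ζ)
  refine ⟨h1, fun x hx => ?_⟩
  have h3 := mul_le_mul_of_nonneg_left (h2 x hx) hL.le
  rw [inner_smul_left, inner_smul_left] at h3
  simp only [conj_trivial, mul_add, ← mul_assoc] at h3
  rw [mul_one_div_cancel hL.ne', one_mul, one_mul] at h3
  linarith

/-- The invariant is passed on by the strong convexity of the two prox problems, defining `u` and
`w`, and by `A (z - v) = a (v - u)`, which cancels the linear terms in `d`. The curvature `μ₁` is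
centred at `z₀`, not at `v`: it can be the full `μ` in the first iteration, where `v = z₀`, and is
zero afterwards. -/
theorem EstimateSeq.step {Z : Set E} (hZ : Convex ℝ Z) (hcl : IsClosed Z)
    {f : E → ℝ} {L μ μ₁ μ' : ℝ} (hL : 0 < L) (hμ₁ : 0 ≤ μ₁)
    {z₀ : E} {A e : ℝ} {z G : E} (hA : 0 ≤ A)
    (h : EstimateSeq Z f L μ z₀ A e z G) {a A' τ fv e' : ℝ} (ha : 0 < a) (hA' : A' = A + a)
    (hτ : τ = a / A') (hμ' : μ' = μ + a * μ₁) {u v w z' d : E} (hu : u = prox Z z₀ ((1 / L) • G))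
    (hv : v = τ • u + (1 - τ) • z) (hw : w = prox Z u ((1 / L) • a • d))
    (hz' : z' = τ • w + (1 - τ) • z)
    (hlow : ∀ x ∈ Z, fv + inner ℝ d (x - v) + μ₁ / 2 * ‖x - z₀‖ ^ 2 ≤ f x)
    (hup : f z' ≤ fv + inner ℝ d (z' - v) + L / 2 * (A' / a ^ 2) * ‖z' - v‖ ^ 2 + e') :
    EstimateSeq Z f L μ' z₀ A' (e + A' * e') z' (G + a • d) := by
  obtain ⟨hz, c, h1, h2⟩ := h
  have hA'0 : 0 < A' := by linarith
  obtain ⟨huZ, hu2⟩ := prox_spec_scaled hZ hcl ⟨z, hz⟩ hL z₀ G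
  rw [← hu] at huZ hu2
  obtain ⟨hwZ, hw2⟩ := prox_spec_scaled hZ hcl ⟨z, hz⟩ hL u (a • d)
  rw [← hw] at hwZ hw2
  have hτ0 : 0 ≤ τ := by rw [hτ]; positivity
  have hτ1 : τ ≤ 1 := by rw [hτ, div_le_one hA'0]; linarith
  have hz'Z : z' ∈ Z := by rw [hz']; exact hZ hwZ hz hτ0 (by linarith) (by ring)
  refine ⟨hz'Z, c + a * (fv - inner ℝ d v), fun x hx => ?_, fun x hx => ?_⟩
  · have := h1 x hx
    have := mul_le_mul_of_nonneg_left (hlow x hx) ha.le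
    rw [inner_sub_right] at this
    rw [inner_add_left, inner_smul_left, conj_trivial, hA', hμ']
    linarith
  · have e1 : z' - v = τ • (w - u) := by rw [hz', hv]; module
    have hAτ : A' * τ = a := by rw [hτ]; field_simp
    have e2 : A • (z - v) = a • (v - u) := by
      have hAA : A = A' * (1 - τ) := by rw [mul_sub, hAτ, hA']; ring
      rw [hAA, ← hAτ, hv]; module
    rw [e1, inner_smul_right, norm_smul, mul_pow, Real.norm_eq_abs, sq_abs] at hup
    have h3 := mul_le_mul_of_nonneg_left hup hA'0.le
    have e3 : A' * (fv + τ * inner ℝ d (w - u) + L / 2 * (A' / a ^ 2) * (τ ^ 2 * ‖w - u‖ ^ 2) + e')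
        = A' * fv + a * inner ℝ d (w - u) + L / 2 * ‖w - u‖ ^ 2 + A' * e' := by
      have : A' * (A' / a ^ 2) * τ ^ 2 = 1 := by
        rw [hτ]; field_simp
      calc _ = A' * fv + (A' * τ) * inner ℝ d (w - u)
            + L / 2 * (A' * (A' / a ^ 2) * τ ^ 2) * ‖w - u‖ ^ 2 + A' * e' := by ring
        _ = _ := by rw [this, hAτ]; ring
    rw [e3] at h3
    have h4 := hw2 x hx
    have h5 := hu2 x hx
    have h6 := h2 u huZ
    have h7 : A * (fv + inner ℝ d (z - v)) ≤ A * f z := by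
      have h8 : 0 ≤ μ₁ / 2 * ‖z - z₀‖ ^ 2 := by positivity
      exact mul_le_mul_of_nonneg_left (by linarith [hlow z hz]) hA
    rw [mul_add, ← inner_smul_right, e2, inner_smul_right] at h7
    rw [inner_smul_left, inner_smul_left, conj_trivial] at h4
    rw [inner_add_left, inner_smul_left, conj_trivial]
    simp only [inner_sub_right] at h3 h7
    have h8 : 0 ≤ L / 2 * ‖x - w‖ ^ 2 := by positivity
    have e4 : A' * fv = A * fv + a * fv := by rw [hA']; ring
    linarith

theorem prox_zero {Z : Set E} (hZ : Convex ℝ Z) (hcl : IsClosed Z) {z : E} (hz : z ∈ Z) :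
    prox Z z 0 = z := by
  obtain ⟨_, h⟩ := prox_spec hZ hcl ⟨z, hz⟩ z 0
  have := h z hz
  simp only [inner_zero_left, sub_self, norm_zero] at this
  have h1 : ‖prox Z z 0 - z‖ = 0 := by
    have := norm_nonneg (prox Z z 0 - z)
    nlinarith [sq_nonneg ‖z - prox Z z 0‖]
  exact sub_eq_zero.1 (norm_eq_zero.1 h1)

theorem sqrt_mul_le_young {L σ s x : ℝ} (hL : 0 < L) (hσ : 0 ≤ σ) (hs : 0 < s) :
    Real.sqrt (2 * L * σ) * x ≤ L / 2 * s * x ^ 2 + σ / s := by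
  set η := Real.sqrt (2 * L * σ) with hη
  have h1 : η ^ 2 = 2 * L * σ := Real.sq_sqrt (by positivity)
  have h2 : 0 ≤ (L * s * x - η) ^ 2 := sq_nonneg _
  have h3 : σ / s = η ^ 2 / (2 * L * s) := by rw [h1]; field_simp
  rw [h3, ← sub_nonneg]
  have : L / 2 * s * x ^ 2 + η ^ 2 / (2 * L * s) - η * x = (L * s * x - η) ^ 2 / (2 * L * s) := by
    field_simp; ring
  rw [this]; positivity

/-- The error of the very first step is controlled by the distance to the minimizer. -/
theorem first_step_error_le {L σ d D q : ℝ} (hL : 0 < L) (hσ : 0 ≤ σ)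
    (hd : d ≤ q + D) (hd0 : 0 ≤ d)
    (hq : L / 2 * q ^ 2 ≤ L / 2 * D ^ 2 + Real.sqrt (2 * L * σ) * d + σ) :
    Real.sqrt (2 * L * σ) * d ≤ L / 4 * D ^ 2 + 18 * σ := by
  -- The weight `1/4` is used in `hq` to obtain `L d² ≤ 8 L D² + 40 σ`; the weight `1/16` then turns
  -- this into the claim.
  have h1 := sqrt_mul_le_young (x := d) hL hσ (show (0 : ℝ) < 1 / 16 by norm_num)
  have h2 := sqrt_mul_le_young (x := d) hL hσ (show (0 : ℝ) < 1 / 4 by norm_num)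
  have h3 : d ^ 2 ≤ 2 * q ^ 2 + 2 * D ^ 2 := by nlinarith [sq_nonneg (q - D)]
  have h4 : L * d ^ 2 ≤ 2 * (L * q ^ 2) + 2 * (L * D ^ 2) := by nlinarith
  have e1 : σ / (1 / 16) = 16 * σ := by ring
  have e2 : σ / (1 / 4) = 4 * σ := by ring
  rw [e1] at h1
  rw [e2] at h2
  linarith

/-- The first iteration has `A' / a² = 1`, so no spare quadratic term can absorb the error `√(2(L -
μ)σ) ‖w - z₀‖`. It is charged instead to the distance from `z₀` to the minimizer. Here `v = z₀`, so
the curvature `μ` enters the minorant. -/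
theorem fgmLoop_one {Z : Set E} (hZ : Convex ℝ Z) (hcl : IsClosed Z) {f fv : E → ℝ} {L μ σ : ℝ}
    (hμ : 0 ≤ μ) (hL : μ < L) (hσ : 0 ≤ σ) {oracle : E → Counted E}
    (h : HasModel Z f fv (fun x => (oracle x).val) L μ σ) {z₀ zs : E} (hz₀ : z₀ ∈ Z)
    (hzs : zs ∈ Z) (hmin : ∀ x ∈ Z, f zs ≤ f x) :
    EstimateSeq Z f L μ z₀ 1 ((L - μ) / 4 * ‖zs - z₀‖ ^ 2 + 19 * σ)
      (fgmLoop Z (1 / L) oracle z₀ 1).val.1 (fgmLoop Z (1 / L) oracle z₀ 1).val.2 := by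
  have hL0 : 0 < L := hμ.trans_lt hL
  set d := (oracle z₀).val with hd
  set w := prox Z z₀ ((1 / L) • (1 : ℝ) • d) with hw
  have hstate : (fgmLoop Z (1 / L) oracle z₀ 1).val = (w, (0 : E) + (1 : ℝ) • d) := by
    rw [fgmLoop_succ_val]
    simp only [fgmLoop, fgmStep, Counted.ret, Counted.bind, proxCall, smul_zero,
      prox_zero hZ hcl hz₀]
    norm_num [← hd, hw]
  rw [hstate]
  have hwZ : w ∈ Z := (prox_spec hZ hcl ⟨z₀, hz₀⟩ _ _).1
  have hm := h z₀ hz₀ w hwZ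
  have hbase : EstimateSeq Z f L 0 z₀ 0 0 z₀ 0 :=
    ⟨hz₀, 0, fun x _ => by simp, fun x _ => by simp; positivity⟩
  have hlow : ∀ x ∈ Z, fv z₀ + inner ℝ d (x - z₀) + μ / 2 * ‖x - z₀‖ ^ 2 ≤ f x :=
    fun x hx => (h z₀ hz₀ x hx).1
  have hstep := hbase.step hZ hcl hL0 hμ le_rfl (a := 1) (A' := 1) (τ := 1) (μ' := μ) (u := z₀) (v := z₀)
    (w := w) (z' := w) (d := d) (fv := fv z₀)
    (e' := Real.sqrt (2 * (L - μ) * σ) * ‖w - z₀‖ + σ) one_pos (by norm_num) (by norm_num) (by ring)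
    (by rw [smul_zero, prox_zero hZ hcl hz₀]) (by simp) hw (by simp) hlow
    (by have := hm.2; simp only [one_pow, div_one, mul_one]; linarith)
  refine hstep.mono ?_
  have hprox := (prox_spec_scaled hZ hcl ⟨z₀, hz₀⟩ hL0 z₀ ((1 : ℝ) • d)).2 zs hzs
  rw [← hw, one_smul] at hprox
  have h1 := hlow zs hzs
  have h2 := hmin w hwZ
  have h3 := hm.2
  rw [inner_sub_right] at h1 h3
  have := first_step_error_le (L := L - μ) (σ := σ) (d := ‖w - z₀‖) (D := ‖zs - z₀‖)
    (q := ‖zs - w‖) (sub_pos.2 hL) hσ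
    (by rw [norm_sub_rev zs w]; simpa using norm_add_le (w - zs) (zs - z₀)) (norm_nonneg _)
    (by have : 0 ≤ μ / 2 * ‖zs - w‖ ^ 2 := by positivity
        linarith)
  linarith

/-- The weights `(t + 2) / 2` add up to `(T + 1)(T + 4) / 4` over `T + 1` iterations. From the
second iteration on, Young's inequality hides the linear error in the spare quadratic term, at a
cost `9 t σ`; the weighted sum of these costs is at most of order `A T² σ`. -/
theorem fgmLoop_estimate {Z : Set E} (hZ : Convex ℝ Z) (hcl : IsClosed Z) {f fv : E → ℝ}
    {L μ σ : ℝ} (hμ : 0 ≤ μ) (hL : μ < L) (hσ : 0 ≤ σ) {oracle : E → Counted E}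
    (h : HasModel Z f fv (fun x => (oracle x).val) L μ σ) {z₀ zs : E} (hz₀ : z₀ ∈ Z)
    (hzs : zs ∈ Z) (hmin : ∀ x ∈ Z, f zs ≤ f x) (T : ℕ) :
    EstimateSeq Z f L μ z₀ (((T : ℝ) + 1) * ((T : ℝ) + 4) / 4)
      ((L - μ) / 4 * ‖zs - z₀‖ ^ 2 +
        σ * (18 + ((T : ℝ) + 1) * ((T : ℝ) + 4) / 4 * (9 / 2 * ((T : ℝ) + 1) ^ 2)))
      (fgmLoop Z (1 / L) oracle z₀ (T + 1)).val.1 (fgmLoop Z (1 / L) oracle z₀ (T + 1)).val.2 := by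
  have hL0 : 0 < L := hμ.trans_lt hL
  induction T with
  | zero =>
    have := fgmLoop_one hZ hcl hμ hL hσ h hz₀ hzs hmin
    have h1 : (((0 : ℕ) : ℝ) + 1) * (((0 : ℕ) : ℝ) + 4) / 4 = 1 := by norm_num
    rw [h1]
    refine this.mono ?_
    push_cast
    linarith
  | succ n ih =>
    set s := (fgmLoop Z (1 / L) oracle z₀ (n + 1)).val with hs
    rw [fgmLoop_succ_val, ← hs]
    set t : ℝ := (n : ℝ) + 1 with ht
    have ht1 : 1 ≤ t := by rw [ht]; linarith [Nat.cast_nonneg (α := ℝ) n]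
    have htc : ((n + 1 : ℕ) : ℝ) = t := by rw [ht]; push_cast; ring
    set A' := (t + 1) * (t + 4) / 4 with hA'
    set τ : ℝ := 2 * (t + 2) / ((t + 1) * (t + 4)) with hτ
    set u := prox Z z₀ ((1 / L) • s.2) with hu
    set v := τ • u + (1 - τ) • s.1 with hv
    set d := (oracle v).val with hd
    set w := prox Z u ((1 / L) • ((t + 2) / 2) • d) with hw
    set z' := τ • w + (1 - τ) • s.1 with hz'
    have hstate : (fgmStep Z (1 / L) oracle z₀ (n + 1) s).val =
        (z', s.2 + ((t + 2) / 2) • d) := by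
      simp only [fgmStep, Counted.ret, Counted.bind, proxCall, htc, hz', hw, hd, hv, hu, hτ]
    rw [hstate, htc]
    have huZ : u ∈ Z := (prox_spec hZ hcl ⟨z₀, hz₀⟩ _ _).1
    have hwZ : w ∈ Z := (prox_spec hZ hcl ⟨z₀, hz₀⟩ _ _).1
    have hτ0 : 0 ≤ τ := by rw [hτ]; positivity
    have hτ1 : τ ≤ 1 := by
      rw [hτ, div_le_one (by positivity)]; nlinarith
    have hvZ : v ∈ Z := hZ huZ ih.1 hτ0 (by linarith) (by ring)
    have hz'Z : z' ∈ Z := hZ hwZ ih.1 hτ0 (by linarith) (by ring)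
    have hm := h v hvZ z' hz'Z
    have hlow : ∀ x ∈ Z, fv v + inner ℝ d (x - v) + 0 / 2 * ‖x - z₀‖ ^ 2 ≤ f x := fun x hx => by
      have := (h v hvZ x hx).1
      have h2 : 0 ≤ μ / 2 * ‖x - v‖ ^ 2 := by positivity
      linarith
    have hyoung := sqrt_mul_le_young (x := ‖z' - v‖) (sub_pos.2 hL) hσ
      (show 0 < t / (t + 2) ^ 2 by positivity)
    have hμs : 0 ≤ μ / 2 * (t / (t + 2) ^ 2) * ‖z' - v‖ ^ 2 := by positivity
    have hslack : σ / (t / (t + 2) ^ 2) ≤ 9 * t * σ := by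
      rw [div_div_eq_mul_div, div_le_iff₀ (by positivity)]
      nlinarith [mul_le_mul_of_nonneg_left (show (t + 2) ^ 2 ≤ 9 * t ^ 2 by nlinarith) hσ]
    -- This is the spare quadratic term: `(t + 1)(t + 4) = (t + 2)² + t`.
    have hratio : A' / ((t + 2) / 2) ^ 2 = 1 + t / (t + 2) ^ 2 := by
      rw [hA']; field_simp; ring
    have hA0 : (n : ℝ) + 4 = t + 3 := by rw [ht]; ring
    rw [hA0] at ih
    have hstep := ih.step hZ hcl hL0 le_rfl (by positivity) (μ' := μ) (a := (t + 2) / 2) (A' := A') (τ := τ)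
      (u := u) (v := v) (w := w) (z' := z') (d := d) (fv := fv v)
      (e' := (1 + 9 * t) * σ) (by positivity) (by rw [hA']; ring)
      (by rw [hτ, hA']; field_simp; ring) (by ring) hu hv hw hz' hlow
      (by rw [hratio]; linarith [hm.2])
    refine hstep.mono ?_
    have : 0 ≤ σ * (9 / 2 * t ^ 2 * (A' - t * (t + 3) / 4) + A' * (7 / 2)) := by
      have : 0 ≤ A' - t * (t + 3) / 4 := by rw [hA']; nlinarith
      positivity
    rw [hA'] at this ⊢
    linarith

/-- Convergence of the fast gradient method with an inexact oracle. -/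
theorem fgm_gap_le {Z : Set E} (hZ : Convex ℝ Z) (hcl : IsClosed Z) {f fv : E → ℝ}
    {L μ σ : ℝ} (hμ : 0 ≤ μ) (hL : μ < L) (hσ : 0 ≤ σ) {oracle : E → Counted E}
    (h : HasModel Z f fv (fun x => (oracle x).val) L μ σ) {z₀ zs : E} (hz₀ : z₀ ∈ Z)
    (hzs : zs ∈ Z) (hmin : ∀ x ∈ Z, f zs ≤ f x) {T : ℕ} (hT : 1 ≤ T) :
    (fgm Z (1 / L) T oracle z₀).val ∈ Z ∧
    f (fgm Z (1 / L) T oracle z₀).val - f zs ≤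
      3 * (L - μ) / (T * (T + 3)) * ‖zs - z₀‖ ^ 2 + (9 / 2 * (T : ℝ) ^ 2 + 18) * σ := by
  obtain ⟨n, rfl⟩ : ∃ n, T = n + 1 := ⟨T - 1, by omega⟩
  have hest := fgmLoop_estimate hZ hcl hμ hL hσ h hz₀ hzs hmin n
  refine ⟨hest.1, ?_⟩
  have hg := hest.gap_le hzs
  change _ * (f (fgm Z (1 / L) (n + 1) oracle z₀).val - f zs) ≤ _ at hg
  have hn : (0 : ℝ) ≤ n := Nat.cast_nonneg n
  push_cast
  have hA : (0 : ℝ) < ((n : ℝ) + 1) * ((n : ℝ) + 4) / 4 := by positivity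
  have hA1 : (1 : ℝ) ≤ ((n : ℝ) + 1) * ((n : ℝ) + 4) / 4 := by nlinarith
  refine le_of_mul_le_mul_left (hg.trans ?_) hA
  have e1 : ((n : ℝ) + 1) * ((n : ℝ) + 4) / 4 *
      (3 * (L - μ) / (((n : ℝ) + 1) * ((n : ℝ) + 1 + 3)) * ‖zs - z₀‖ ^ 2
        + (9 / 2 * ((n : ℝ) + 1) ^ 2 + 18) * σ)
      = 3 / 4 * (L - μ) * ‖zs - z₀‖ ^ 2
        + ((n : ℝ) + 1) * ((n : ℝ) + 4) / 4 * ((9 / 2 * ((n : ℝ) + 1) ^ 2 + 18) * σ) := by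
    field_simp; ring
  rw [e1]
  nlinarith [mul_le_mul_of_nonneg_right hA1 hσ]

/-- Convergence of the restarted fast gradient method with an inexact oracle. -/
theorem restartFGM_gap_le {Z : Set E} (hZ : Convex ℝ Z) (hcl : IsClosed Z) {f fv : E → ℝ}
    {L μ σ : ℝ} (hμ : 0 < μ) (hL : μ < L) (hσ : 0 ≤ σ) {oracle : E → Counted E}
    (h : HasModel Z f fv (fun x => (oracle x).val) L μ σ) {z₀ zs : E} (hz₀ : z₀ ∈ Z)
    (hzs : IsStrongMin Z f μ zs) {T : ℕ} (hT : 1 ≤ T) {q e B : ℝ} (hq : 0 ≤ q)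
    (hqL : 3 * (L - μ) / (T * (T + 3)) ≤ q * (μ / 2))
    (he : q * e + (9 / 2 * (T : ℝ) ^ 2 + 18) * σ ≤ e) (he0 : 0 ≤ e)
    (hB : 3 * (L - μ) / (T * (T + 3)) * ‖zs - z₀‖ ^ 2 ≤ q * B) (S : ℕ) :
    (restartFGM Z (1 / L) T oracle z₀ S).val ∈ Z ∧
    (1 ≤ S → f (restartFGM Z (1 / L) T oracle z₀ S).val - f zs ≤ q ^ S * B + e) := by
  have hmin : ∀ x ∈ Z, f zs ≤ f x := fun x hx => by
    have := hzs.2 x hx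
    have h2 : 0 ≤ μ / 2 * ‖x - zs‖ ^ 2 := by positivity
    linarith
  -- The induction carries the distance to the minimizer, because initially only that distance is
  -- bounded, not the gap. The number `e` is a supersolution of the error recursion over epochs.
  suffices H : (restartFGM Z (1 / L) T oracle z₀ S).val ∈ Z ∧
      3 * (L - μ) / (T * (T + 3)) * ‖zs - (restartFGM Z (1 / L) T oracle z₀ S).val‖ ^ 2
        ≤ q * (q ^ S * B + e) ∧
      (1 ≤ S → f (restartFGM Z (1 / L) T oracle z₀ S).val - f zs ≤ q ^ S * B + e) from
    ⟨H.1, H.2.2⟩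
  induction S with
  | zero =>
    refine ⟨hz₀, ?_, by simp⟩
    simp only [restartFGM, Counted.ret, pow_zero, one_mul]
    linarith [mul_nonneg hq he0]
  | succ S ih =>
    obtain ⟨ihZ, ihD, _⟩ := ih
    set z := (restartFGM Z (1 / L) T oracle z₀ S).val with hz
    have hval : (restartFGM Z (1 / L) T oracle z₀ (S + 1)).val = (fgm Z (1 / L) T oracle z).val :=
      rfl
    rw [hval]
    obtain ⟨h1, h2⟩ := fgm_gap_le hZ hcl hμ.le hL hσ h ihZ hzs.1 hmin hT
    have h3 : f (fgm Z (1 / L) T oracle z).val - f zs ≤ q ^ (S + 1) * B + e := by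
      rw [pow_succ q S]
      linarith
    refine ⟨h1, ?_, fun _ => h3⟩
    have h4 := hzs.2 _ h1
    rw [norm_sub_rev] at h4
    have h5 := mul_le_mul_of_nonneg_right hqL
      (sq_nonneg ‖zs - (fgm Z (1 / L) T oracle z).val‖)
    have h6 : q * (μ / 2 * ‖zs - (fgm Z (1 / L) T oracle z).val‖ ^ 2)
        ≤ q * (q ^ (S + 1) * B + e) := mul_le_mul_of_nonneg_left (by linarith) hq
    linarith

end FGM

/-! ### First-order inequalities on a convex set from gradients within the set. -/

section Smooth

variable {E : Type*} [NormedAddCommGroup E] [InnerProductSpace ℝ E]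

theorem hasDerivWithinAt_segment {Z : Set E} (hZ : Convex ℝ Z) {f : E → ℝ} {g : E → E}
    (hf : ∀ x ∈ Z, HasFDerivWithinAt f (innerSL ℝ (g x)) Z x) {v u : E} (hv : v ∈ Z) (hu : u ∈ Z)
    {s : ℝ} (hs : s ∈ Icc (0 : ℝ) 1) :
    HasDerivWithinAt (fun s : ℝ => f (v + s • (u - v))) (inner ℝ (g (v + s • (u - v))) (u - v))
      (Icc 0 1) s := by
  have h1 : HasDerivWithinAt (fun s : ℝ => v + s • (u - v)) (u - v) (Icc 0 1) s := by
    have := ((hasDerivAt_id s).smul_const (u - v)).const_add v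
    simpa using this.hasDerivWithinAt
  have h2 : MapsTo (fun s : ℝ => v + s • (u - v)) (Icc 0 1) Z := fun r hr =>
    hZ.add_smul_sub_mem hv hu hr
  exact (hf _ (h2 hs)).comp_hasDerivWithinAt s h1 h2

theorem le_add_inner_add_of_lipschitz {Z : Set E} (hZ : Convex ℝ Z) {f : E → ℝ} {g : E → E}
    (hf : ∀ x ∈ Z, HasFDerivWithinAt f (innerSL ℝ (g x)) Z x) {K : ℝ}
    (hg : ∀ x ∈ Z, ∀ x' ∈ Z, ‖g x' - g x‖ ≤ K * ‖x' - x‖) {v u : E} (hv : v ∈ Z) (hu : u ∈ Z) :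
    f u ≤ f v + inner ℝ (g v) (u - v) + K / 2 * ‖u - v‖ ^ 2 := by
  set d := u - v with hd
  set p : ℝ → ℝ := fun s => f (v + s • d) - s * inner ℝ (g v) d - K / 2 * s ^ 2 * ‖d‖ ^ 2 with hp
  have hder : ∀ s ∈ Icc (0 : ℝ) 1, HasDerivWithinAt p
      (inner ℝ (g (v + s • d)) d - inner ℝ (g v) d - K * s * ‖d‖ ^ 2) (Icc 0 1) s := by
    intro s hs
    have h1 := hasDerivWithinAt_segment hZ hf hv hu hs
    have h2 : HasDerivWithinAt (fun s : ℝ => s * inner ℝ (g v) d) (inner ℝ (g v) d)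
        (Icc 0 1) s := by
      simpa using ((hasDerivAt_id s).mul_const (inner ℝ (g v) d)).hasDerivWithinAt
    have h3 : HasDerivWithinAt (fun s : ℝ => K / 2 * s ^ 2 * ‖d‖ ^ 2) (K * s * ‖d‖ ^ 2)
        (Icc 0 1) s := by
      have := (((hasDerivAt_pow 2 s).const_mul (K / 2)).mul_const (‖d‖ ^ 2)).hasDerivWithinAt
        (s := Icc (0 : ℝ) 1)
      exact this.congr_deriv (by push_cast; ring)
    exact (h1.sub h2).sub h3
  have hanti : AntitoneOn p (Icc 0 1) := by
    refine antitoneOn_of_hasDerivWithinAt_nonpos (convex_Icc 0 1)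
      (fun s hs => (hder s hs).continuousWithinAt)
      (fun s hs => (hder s (interior_subset hs)).mono interior_subset) fun s hs => ?_
    have hs' := interior_subset hs
    have h1 := hg v hv _ (hZ.add_smul_sub_mem hv hu hs')
    rw [← hd, add_sub_cancel_left, norm_smul, Real.norm_of_nonneg hs'.1] at h1
    have h2 := real_inner_le_norm (g (v + s • d) - g v) d
    rw [inner_sub_left] at h2
    have h3 := mul_le_mul_of_nonneg_right h1 (norm_nonneg d)
    nlinarith
  have := hanti (left_mem_Icc.2 zero_le_one) (right_mem_Icc.2 zero_le_one) zero_le_one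
  simp only [hp, hd, one_smul, zero_smul, add_zero, add_sub_cancel] at this
  linarith

theorem add_inner_sub_le_of_lipschitz {Z : Set E} (hZ : Convex ℝ Z) {f : E → ℝ} {g : E → E}
    (hf : ∀ x ∈ Z, HasFDerivWithinAt f (innerSL ℝ (g x)) Z x) {K : ℝ}
    (hg : ∀ x ∈ Z, ∀ x' ∈ Z, ‖g x' - g x‖ ≤ K * ‖x' - x‖) {v u : E} (hv : v ∈ Z) (hu : u ∈ Z) :
    f v + inner ℝ (g v) (u - v) - K / 2 * ‖u - v‖ ^ 2 ≤ f u := by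
  have := le_add_inner_add_of_lipschitz hZ (f := fun x => -f x) (g := fun x => -g x)
    (fun x hx => by
      have := (hf x hx).neg
      rwa [← map_neg] at this)
    (K := K) (fun x hx x' hx' => by
      have e : -g x' - -g x = -(g x' - g x) := by abel
      rw [e, norm_neg]
      exact hg x hx x' hx') hv hu
  rw [inner_neg_left] at this
  linarith

theorem ConcaveOn.le_add_inner {Z : Set E} {f : E → ℝ} {g : E → E} (hconc : ConcaveOn ℝ Z f)
    (hf : ∀ x ∈ Z, HasFDerivWithinAt f (innerSL ℝ (g x)) Z x) {v u : E} (hv : v ∈ Z) (hu : u ∈ Z) :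
    f u ≤ f v + inner ℝ (g v) (u - v) := by
  have h1 := hasDerivWithinAt_segment hconc.1 hf hv hu (left_mem_Icc.2 zero_le_one)
  have h2 := h1.mono Ioo_subset_Icc_self
  rw [hasDerivWithinAt_iff_tendsto_slope' (by simp), nhdsWithin_Ioo_eq_nhdsGT one_pos] at h2
  rw [← sub_le_iff_le_add']
  simp only [zero_smul, add_zero] at h2
  refine ge_of_tendsto h2 ?_
  filter_upwards [Ioo_mem_nhdsGT (show (0 : ℝ) < 1 by norm_num)] with s hs
  have h3 := hconc.2 hv hu (show 0 ≤ 1 - s by linarith [hs.2]) hs.1.le (by ring)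
  have e : (1 - s) • v + s • u = v + s • (u - v) := by module
  rw [e, smul_eq_mul, smul_eq_mul] at h3
  rw [slope_def_field]
  simp only [zero_smul, add_zero, sub_zero]
  rw [le_div_iff₀ hs.1]
  linarith

theorem hasFDerivWithinAt_gradientWithin [CompleteSpace E] {f : E → ℝ} {Z : Set E}
    (hf : DifferentiableOn ℝ f Z) {x : E} (hx : x ∈ Z) :
    HasFDerivWithinAt f (innerSL ℝ (gradientWithin f Z x)) Z x := by
  have h1 := (hf x hx).hasGradientWithinAt.hasFDerivWithinAt
  exact h1

end Smooth

theorem primal_sub_le {E G : Type*} {F : E → G → ℝ} {X : Set E} {Y : Set G}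
    {c : ProblemConstants} {x₀ x : E} (hx : x ∈ X) (hb : BddBelow (primal F Y '' X))
    (hgap : primalGap F X Y x₀ ≤ c.Δ) : primal F Y x₀ - c.Δ ≤ primal F Y x := by
  have := csInf_le hb (mem_image_of_mem _ hx)
  rw [primalGap] at hgap
  linarith

/-! ### The min-max problem, its proximal objective and the regularized dual function. -/

section Problem

variable {E G : Type*} [NormedAddCommGroup E] [InnerProductSpace ℝ E] [CompleteSpace E]
  [NormedAddCommGroup G] [InnerProductSpace ℝ G] [CompleteSpace G]
  {F : E → G → ℝ} {X : Set E} {Y : Set G} {c : ProblemConstants}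

namespace SmoothConcaveProblem

theorem le_x (hP : SmoothConcaveProblem F X Y c) {x x' : E} {y : G} (hx : x ∈ X) (hx' : x' ∈ X)
    (hy : y ∈ Y) :
    F x' y ≤ F x y + inner ℝ (gradX F X x y) (x' - x) + c.Lxx / 2 * ‖x' - x‖ ^ 2 :=
  le_add_inner_add_of_lipschitz hP.convex_X (f := fun x => F x y)
    (fun _ hz => hasFDerivWithinAt_gradientWithin (hP.diff_x y hy) hz)
    (fun z hz z' hz' => hP.lip_xx z hz z' hz' y hy) hx hx'

theorem ge_x (hP : SmoothConcaveProblem F X Y c) {x x' : E} {y : G} (hx : x ∈ X) (hx' : x' ∈ X)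
    (hy : y ∈ Y) :
    F x y + inner ℝ (gradX F X x y) (x' - x) - c.Lxx / 2 * ‖x' - x‖ ^ 2 ≤ F x' y :=
  add_inner_sub_le_of_lipschitz hP.convex_X (f := fun x => F x y)
    (fun _ hz => hasFDerivWithinAt_gradientWithin (hP.diff_x y hy) hz)
    (fun z hz z' hz' => hP.lip_xx z hz z' hz' y hy) hx hx'

theorem ge_y (hP : SmoothConcaveProblem F X Y c) {x : E} {y y' : G} (hx : x ∈ X) (hy : y ∈ Y)
    (hy' : y' ∈ Y) :
    F x y + inner ℝ (gradY F Y x y) (y' - y) - c.Lyy / 2 * ‖y' - y‖ ^ 2 ≤ F x y' :=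
  add_inner_sub_le_of_lipschitz hP.convex_Y (f := fun y => F x y)
    (fun _ hz => hasFDerivWithinAt_gradientWithin (hP.diff_y x hx) hz)
    (fun z hz z' hz' => hP.lip_yy x hx z hz z' hz') hy hy'

theorem le_y (hP : SmoothConcaveProblem F X Y c) {x : E} {y y' : G} (hx : x ∈ X) (hy : y ∈ Y)
    (hy' : y' ∈ Y) : F x y' ≤ F x y + inner ℝ (gradY F Y x y) (y' - y) :=
  (hP.concave x hx).le_add_inner
    (fun _ hz => hasFDerivWithinAt_gradientWithin (hP.diff_y x hx) hz) hy hy'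

/-- The mean value inequality for `y ↦ F x' y - F x y`, whose gradient has norm at most `Lxy ‖x' -
x‖`. It replaces any Lipschitz bound on `F` itself. -/
theorem cross_le (hP : SmoothConcaveProblem F X Y c) {x x' : E} {y y' : G} (hx : x ∈ X)
    (hx' : x' ∈ X) (hy : y ∈ Y) (hy' : y' ∈ Y) :
    (F x' y' - F x y') - (F x' y - F x y) ≤ c.Lxy * ‖x' - x‖ * ‖y' - y‖ := by
  have := hP.convex_Y.norm_image_sub_le_of_norm_hasFDerivWithin_le
    (f := fun y => F x' y - F x y)
    (f' := fun y => innerSL ℝ (gradY F Y x' y) - innerSL ℝ (gradY F Y x y))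
    (C := c.Lxy * ‖x' - x‖)
    (fun z hz => (hasFDerivWithinAt_gradientWithin (hP.diff_y x' hx') hz).sub
      (hasFDerivWithinAt_gradientWithin (hP.diff_y x hx) hz))
    (fun z hz => by
      rw [← map_sub, innerSL_apply_norm]
      exact hP.lip_yx x hx x' hx' z hz) hy hy'
  exact (le_abs_self _).trans this

theorem norm_sub_le (hP : SmoothConcaveProblem F X Y c) {y y' : G} (hy : y ∈ Y) (hy' : y' ∈ Y) :
    ‖y' - y‖ ≤ 2 * c.Ry := by
  obtain ⟨y₁, h⟩ := hP.ball_Y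
  have h1 := mem_closedBall_iff_norm.1 (h hy)
  have h2 := mem_closedBall_iff_norm.1 (h hy')
  have : y' - y = (y' - y₁) - (y - y₁) := by abel
  rw [this]
  linarith [_root_.norm_sub_le (y' - y₁) (y - y₁)]

theorem isCompact_Y [FiniteDimensional ℝ G] (hP : SmoothConcaveProblem F X Y c) :
    IsCompact Y := by
  obtain ⟨y₁, h⟩ := hP.ball_Y
  exact (isCompact_closedBall y₁ c.Ry).of_isClosed_subset hP.closed_Y h

theorem exists_eq_primal [FiniteDimensional ℝ G] (hP : SmoothConcaveProblem F X Y c) {x : E}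
    (hx : x ∈ X) : ∃ y ∈ Y, F x y = primal F Y x ∧ ∀ y' ∈ Y, F x y' ≤ F x y := by
  have hne : Y.Nonempty := hP.interior_Y.mono interior_subset
  obtain ⟨y, hy, hmax⟩ := hP.isCompact_Y.exists_isMaxOn hne (hP.diff_y x hx).continuousOn
  refine ⟨y, hy, le_antisymm ?_ ?_, fun y' hy' => hmax hy'⟩
  · refine le_csSup ⟨F x y, ?_⟩ (mem_image_of_mem (fun y => F x y) hy)
    rintro _ ⟨z, hz, rfl⟩
    exact hmax hz
  · refine csSup_le (hne.image _) ?_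
    rintro _ ⟨z, hz, rfl⟩
    exact hmax hz

end SmoothConcaveProblem

/-- The proximal objective `F(x, y) + L_xx ‖x - xp‖²`. -/
def proxObj (F : E → G → ℝ) (c : ProblemConstants) (xp : E) (y : G) (x : E) : ℝ :=
  F x y + c.Lxx * ‖x - xp‖ ^ 2

theorem norm_sub_sq_expand {H : Type*} [NormedAddCommGroup H] [InnerProductSpace ℝ H]
    (u v p : H) : ‖u - p‖ ^ 2 = ‖v - p‖ ^ 2 + 2 * inner ℝ (v - p) (u - v) + ‖u - v‖ ^ 2 := by
  have e : u - p = (v - p) + (u - v) := by abel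
  rw [e, norm_add_sq_real]

theorem proxObj_hasModel (hP : SmoothConcaveProblem F X Y c) (xp : E) {y : G} (hy : y ∈ Y) :
    HasModel X (proxObj F c xp y) (proxObj F c xp y)
      (fun x => gradX F X x y + (2 * c.Lxx) • (x - xp)) (3 * c.Lxx) c.Lxx 0 := by
  intro v hv u hu
  have h1 := hP.le_x hv hu hy
  have h2 := hP.ge_x hv hu hy
  simp only [proxObj]
  rw [norm_sub_sq_expand u v xp, inner_add_left, inner_smul_left, conj_trivial]
  constructor
  · linarith
  · simp only [mul_zero, Real.sqrt_zero, zero_mul, add_zero]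
    linarith

/-- The negative regularized dual function, as a function of `y`, when the inner variable is
chosen as `xs y`. -/
def negDual (F : E → G → ℝ) (c : ProblemConstants) (lam : ℝ) (xp : E) (ybar : G) (xs : G → E)
    (y : G) : ℝ :=
  -(proxObj F c xp y (xs y) - lam / 2 * ‖y - ybar‖ ^ 2)

/-- A quantitative envelope argument. The lower bound holds because `xt v` is feasible at `u`. For
the upper bound, moving the exact minimizer by `p` gains a cross term `Lxy p d` but costs `Lxx/2
p²`; Young's inequality leaves `Lxy²/(2 Lxx) d²`, which is the excess of `LyyPlus` over `Lyy`. By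
quadratic growth the inner error displaces the point by `r` with `Lxx r² ≤ 2σ`, which produces the
linear term of the model. -/
theorem negDual_hasModel (hP : SmoothConcaveProblem F X Y c) (hc : c.Pos) {lam σ : ℝ}
    (hσ : 0 ≤ σ) (xp : E) (ybar : G) {xs xt : G → E}
    (hxs : ∀ y ∈ Y, IsStrongMin X (proxObj F c xp y) c.Lxx (xs y))
    (hxt : ∀ y ∈ Y, xt y ∈ X)
    (hgap : ∀ y ∈ Y, proxObj F c xp y (xt y) - proxObj F c xp y (xs y) ≤ σ) :
    HasModel Y (negDual F c lam xp ybar xs) (negDual F c lam xp ybar xt)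
      (fun y => -(gradY F Y (xt y) y - lam • (y - ybar))) (c.LyyPlus + lam) lam σ := by
  obtain ⟨hLxx, hLyy, hLxy, hRy, hΔ⟩ := hc
  intro v hv u hu
  simp only [negDual]
  rw [norm_sub_sq_expand u v ybar, inner_neg_left, inner_sub_left, inner_smul_left, conj_trivial]
  constructor
  · have h1 := (hxs u hu).2 (xt v) (hxt v hv)
    have h2 := hP.le_y (hxt v hv) hv hu
    have h3 : 0 ≤ c.Lxx / 2 * ‖xt v - xs u‖ ^ 2 := by positivity
    have h4 : proxObj F c xp u (xt v) - proxObj F c xp v (xt v) = F (xt v) u - F (xt v) v := by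
      simp only [proxObj]; ring
    linarith
  · have h1 := hP.ge_y (hxs u hu).1 hv hu
    have h2 := (hxs v hv).2 (xs u) (hxs u hu).1
    have h3 := (hxs v hv).2 (xt v) (hxt v hv)
    have h4 := hgap v hv
    have h5 : proxObj F c xp u (xs u) - proxObj F c xp v (xs u) = F (xs u) u - F (xs u) v := by
      simp only [proxObj]; ring
    set p := ‖xs u - xs v‖ with hp
    set r := ‖xt v - xs v‖ with hr
    set d := ‖u - v‖ with hd
    have hd0 : 0 ≤ d := norm_nonneg _
    have hr0 : 0 ≤ r := norm_nonneg _
    have h6 := hP.lip_yx (xt v) (hxt v hv) (xs u) (hxs u hu).1 v hv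
    have h7 : ‖xs u - xt v‖ ≤ p + r := by
      have e : xs u - xt v = (xs u - xs v) - (xt v - xs v) := by abel
      rw [e]; exact _root_.norm_sub_le _ _
    have h8 := abs_le.1 (abs_real_inner_le_norm (gradY F Y (xs u) v - gradY F Y (xt v) v) (u - v))
    rw [inner_sub_left] at h8
    have h9 : ‖gradY F Y (xs u) v - gradY F Y (xt v) v‖ * d ≤ c.Lxy * p * d + c.Lxy * r * d := by
      have := mul_le_mul_of_nonneg_right
        (h6.trans (mul_le_mul_of_nonneg_left h7 hLxy.le)) hd0
      linarith
    have h10 : c.Lxy * p * d ≤ c.Lxx / 2 * p ^ 2 + c.Lxy ^ 2 / c.Lxx / 2 * d ^ 2 := by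
      have : 0 ≤ (c.Lxx * p - c.Lxy * d) ^ 2 / (2 * c.Lxx) := by positivity
      have e : (c.Lxx * p - c.Lxy * d) ^ 2 / (2 * c.Lxx) =
          c.Lxx / 2 * p ^ 2 + c.Lxy ^ 2 / c.Lxx / 2 * d ^ 2 - c.Lxy * p * d := by
        field_simp; ring
      linarith
    have h11 : c.Lxy * r ≤ Real.sqrt (2 * (c.LyyPlus + lam - lam) * σ) := by
      apply Real.le_sqrt_of_sq_le
      have e1 : c.Lxx * r ^ 2 ≤ 2 * σ := by linarith
      have e2 : (c.Lxy * r) ^ 2 = c.Lxy ^ 2 / c.Lxx * (c.Lxx * r ^ 2) := by field_simp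
      have e3 : c.Lxy ^ 2 / c.Lxx ≤ c.LyyPlus + lam - lam := by
        rw [ProblemConstants.LyyPlus]; linarith
      rw [e2]
      calc c.Lxy ^ 2 / c.Lxx * (c.Lxx * r ^ 2) ≤ c.Lxy ^ 2 / c.Lxx * (2 * σ) := by gcongr
        _ ≤ (c.LyyPlus + lam - lam) * (2 * σ) := by gcongr
        _ = _ := by ring
    have h12 := mul_le_mul_of_nonneg_right h11 hd0
    have h13 : c.LyyPlus / 2 * d ^ 2 = c.Lyy / 2 * d ^ 2 + c.Lxy ^ 2 / c.Lxx / 2 * d ^ 2 := by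
      rw [ProblemConstants.LyyPlus]; ring
    have h14 : (c.LyyPlus + lam) / 2 * d ^ 2 = c.LyyPlus / 2 * d ^ 2 + lam / 2 * d ^ 2 := by ring
    linarith [h8.1]

end Problem

/-! ### One outer iteration and the potential argument. -/

section Iteration

variable {E G : Type*} [NormedAddCommGroup E] [InnerProductSpace ℝ E] [CompleteSpace E]
  [NormedAddCommGroup G] [InnerProductSpace ℝ G] [CompleteSpace G]
  {F : E → G → ℝ} {X : Set E} {Y : Set G} {c : ProblemConstants}

theorem solveRegDual_val_snd (p : FSPParams) (xp : E) (ybar y : G) :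
    (solveRegDual F X Y p xp ybar y).val.2 =
      gradY F Y (solveRegDual F X Y p xp ybar y).val.1 y - p.lamY • (y - ybar) := rfl

theorem solveRegDual_gap_le [FiniteDimensional ℝ E] (hP : SmoothConcaveProblem F X Y c)
    (hc : c.Pos) {p : FSPParams} (hγ : p.γx = 1 / (2 * c.Lxx)) (hTo : p.To = 11) (hSo : 1 ≤ p.So)
    {xp : E} (hxp : xp ∈ X) (ybar : G) {y : G} (hy : y ∈ Y) {B : ℝ}
    (hB : ∀ x ∈ X, F xp y - F x y - c.Lxx * ‖x - xp‖ ^ 2 ≤ B) {xs : E}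
    (hxs : IsStrongMin X (proxObj F c xp y) c.Lxx xs) :
    (solveRegDual F X Y p xp ybar y).val.1 ∈ X ∧
    proxObj F c xp y (solveRegDual F X Y p xp ybar y).val.1 - proxObj F c xp y xs
      ≤ (1 / 8) ^ p.So * B := by
  have hLxx := hc.1
  set oracle : E → Counted E := fun x => (gradCall F X Y x y).bind fun g =>
    .ret (g.1 + (1 / p.γx) • (x - xp)) with horacle
  have hval : (solveRegDual F X Y p xp ybar y).val.1 =
      (restartFGM X (1 / (3 * c.Lxx)) 11 oracle xp p.So).val := by
    have e : 2 / 3 * p.γx = 1 / (3 * c.Lxx) := by rw [hγ]; field_simp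
    rw [← e, ← hTo]; rfl
  have hmodel : HasModel X (proxObj F c xp y) (proxObj F c xp y) (fun x => (oracle x).val)
      (3 * c.Lxx) c.Lxx 0 := by
    have e : (fun x => (oracle x).val) = fun x => gradX F X x y + (2 * c.Lxx) • (x - xp) := by
      have e1 : 1 / p.γx = 2 * c.Lxx := by rw [hγ]; field_simp
      simp only [horacle, Counted.bind, Counted.ret, gradCall, e1]
    rw [e]
    exact proxObj_hasModel hP xp hy
  have hB' : c.Lxx / 2 * ‖xs - xp‖ ^ 2 ≤ B := by
    have h1 := hB xs hxs.1
    have h2 := hxs.2 xp hxp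
    simp only [proxObj, sub_self, norm_zero] at h2
    rw [norm_sub_rev xp xs] at h2
    linarith
  -- For `T = 11` the contraction by `1/8` amounts to `6 Lxx / (11 · 14) ≤ Lxx / 16`. The inner
  -- oracle is exact, hence `e = 0`.
  have key := restartFGM_gap_le hP.convex_X hP.closed_X hLxx (by linarith) le_rfl hmodel hxp hxs
    (T := 11) (by norm_num) (q := 1 / 8) (e := 0) (B := B) (by norm_num)
    (by norm_num; linarith) (by norm_num) le_rfl
    (by push_cast; nlinarith [sq_nonneg ‖xs - xp‖]) p.So
  rw [hval]
  exact ⟨key.1, by simpa using key.2 hSo⟩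

/-- The choices of stepsizes and numbers of iterations that one outer iteration relies on. -/
structure StepParams (c : ProblemConstants) (p : FSPParams) (lam : ℝ) : Prop where
  γx_eq : p.γx = 1 / (2 * c.Lxx)
  γy_eq : p.γy = 1 / (c.LyyPlus + lam)
  lamY_eq : p.lamY = lam
  lam_pos : 0 < lam
  To_eq : p.To = 11
  one_le_So : 1 ≤ p.So
  one_le_Sy : 1 ≤ p.Sy
  one_le_Ty : 1 ≤ p.Ty
  cond_le : 40 * (c.LyyPlus + lam) ≤ lam * (p.Ty : ℝ) ^ 2

theorem LyyPlus_pos (hc : c.Pos) : 0 < c.LyyPlus := by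
  obtain ⟨hLxx, hLyy, hLxy, -, -⟩ := hc
  rw [ProblemConstants.LyyPlus]; positivity

theorem Lyy_lt_LyyPlus (hc : c.Pos) : c.Lyy < c.LyyPlus := by
  obtain ⟨hLxx, hLyy, hLxy, -, -⟩ := hc
  rw [ProblemConstants.LyyPlus]
  have : 0 < c.Lxy ^ 2 / c.Lxx := by positivity
  linarith

theorem StepParams.forty_le {p : FSPParams} {lam : ℝ} (h : StepParams c p lam) (hc : c.Pos) :
    40 ≤ (p.Ty : ℝ) ^ 2 := by
  have h1 := h.cond_le
  have h2 := LyyPlus_pos hc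
  have h3 : lam * 40 ≤ lam * (p.Ty : ℝ) ^ 2 := by linarith
  exact le_of_mul_le_mul_left h3 h.lam_pos

/-- One outer iteration: approximate stationarity of the result and decrease of the regularized
primal function. Here `σ` bounds the inaccuracy of the inner solver and `W` bounds the squared
inaccuracy of the result in the dual variable. -/
theorem fspStep_spec [FiniteDimensional ℝ E] [FiniteDimensional ℝ G]
    (hP : SmoothConcaveProblem F X Y c)
    (hc : c.Pos) {p : FSPParams} {lam : ℝ} (hp : StepParams c p lam) {xp : E} (hxp : xp ∈ X)
    {ybar : G} (hybar : ybar ∈ Y) {B : ℝ}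
    (hB : ∀ y ∈ Y, ∀ x ∈ X, F xp y - F x y - c.Lxx * ‖x - xp‖ ^ 2 ≤ B)
    {σ W : ℝ} (hσ : σ = (1 / 8) ^ p.So * B)
    (hW : W = 4 * (c.LyyPlus + lam) *
      ((1 / 4) ^ p.Sy * (2 * c.ΘPlus) + 7 * (p.Ty : ℝ) ^ 2 * σ + 2 * σ)) :
    (fspStep F X Y p ybar xp).val.1 ∈ X ∧ (fspStep F X Y p ybar xp).val.2 ∈ Y ∧
    stationarity X (fspStep F X Y p ybar xp).val.1
      (gradX F X (fspStep F X Y p ybar xp).val.1 (fspStep F X Y p ybar xp).val.2) c.Lxx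
      ≤ Real.sqrt (6 * c.Lxx * σ) + 2 * c.Lxx * ‖(fspStep F X Y p ybar xp).val.1 - xp‖ ∧
    stationarity Y (fspStep F X Y p ybar xp).val.2
      (-gradY F Y (fspStep F X Y p ybar xp).val.1 (fspStep F X Y p ybar xp).val.2) c.Lyy
      ≤ Real.sqrt W + 2 * lam * c.Ry ∧
    ∀ b : ℝ, (∀ y ∈ Y, F xp y - lam / 2 * ‖y - ybar‖ ^ 2 ≤ b) → ∀ y ∈ Y,
      F (fspStep F X Y p ybar xp).val.1 y - lam / 2 * ‖y - ybar‖ ^ 2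
        + c.Lxx * ‖(fspStep F X Y p ybar xp).val.1 - xp‖ ^ 2 ≤ b + σ + W / (2 * lam) := by
  have hLp := LyyPlus_pos hc
  have hLlt := Lyy_lt_LyyPlus hc
  have hT40 := hp.forty_le hc
  obtain ⟨hγx, hγy, hlamY, hlam, hTo, hSo, hSy, hTy, hcond⟩ := hp
  obtain ⟨hLxx, hLyy, hLxy, hRy, hΔ⟩ := id hc
  have hYne : Y.Nonempty := ⟨ybar, hybar⟩
  have hB0 : 0 ≤ B := by simpa using hB ybar hybar xp hxp
  have hσ0 : 0 ≤ σ := by rw [hσ]; positivity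
  -- exact inner minimizers
  have hex : ∀ y : G, ∃ x, y ∈ Y → IsStrongMin X (proxObj F c xp y) c.Lxx x := by
    intro y
    by_cases hy : y ∈ Y
    · obtain ⟨x, hx⟩ := (proxObj_hasModel hP xp hy).exists_isStrongMin hP.convex_X hP.closed_X
        ⟨xp, hxp⟩ hLxx
      exact ⟨x, fun _ => hx⟩
    · exact ⟨xp, fun h => absurd h hy⟩
  choose xs hxs using hex
  set xt : G → E := fun y => (solveRegDual F X Y p xp ybar y).val.1 with hxt
  have hsol : ∀ y ∈ Y, xt y ∈ X ∧ proxObj F c xp y (xt y) - proxObj F c xp y (xs y) ≤ σ := by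
    intro y hy
    rw [hσ]
    exact solveRegDual_gap_le hP hc hγx hTo hSo hxp ybar hy (hB y hy) (hxs y hy)
  set f := negDual F c lam xp ybar xs with hf
  set fv := negDual F c lam xp ybar xt with hfv
  set L := c.LyyPlus + lam with hL
  have hL0 : 0 < L := by positivity
  -- The exact model serves only to produce the dual minimizer `ys` and its quadratic growth; the
  -- algorithm itself sees `hmodel`.
  have hexact : HasModel Y f f (fun y => -(gradY F Y (xs y) y - lam • (y - ybar))) L lam 0 :=
    negDual_hasModel hP hc le_rfl xp ybar hxs (fun y hy => (hxs y hy).1)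
      (fun y _ => by simp)
  have hmodel : HasModel Y f fv (fun y => -(gradY F Y (xt y) y - lam • (y - ybar))) L lam σ :=
    negDual_hasModel hP hc hσ0 xp ybar hxs (fun y hy => (hsol y hy).1)
      (fun y hy => (hsol y hy).2)
  obtain ⟨ys, hys⟩ := hexact.exists_isStrongMin hP.convex_Y hP.closed_Y hYne hlam
  -- the outer fast gradient method
  set oracle : G → Counted G := fun y' => (solveRegDual F X Y p xp ybar y').bind fun r =>
    .ret (-r.2) with horacle
  have horv : (fun y => (oracle y).val) =
      fun y => -(gradY F Y (xt y) y - lam • (y - ybar)) := by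
    funext y
    simp only [horacle, Counted.bind, Counted.ret, solveRegDual_val_snd, hlamY, hxt]
  rw [← horv] at hmodel
  set y := (fspStep F X Y p ybar xp).val.2 with hy_def
  have hyval : y = (restartFGM Y (1 / L) p.Ty oracle ybar p.Sy).val := by
    rw [← hγy]; rfl
  have hxval : (fspStep F X Y p ybar xp).val.1 = xt y := rfl
  rw [hxval]
  have hT0 : (0 : ℝ) < p.Ty := by exact_mod_cast hTy
  have hDiam := hP.norm_sub_le hybar hys.1
  have hrate : 3 * (L - lam) / ((p.Ty : ℝ) * (p.Ty + 3)) ≤ 3 * (L - lam) / (p.Ty : ℝ) ^ 2 := by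
    apply div_le_div_of_nonneg_left
    · rw [hL]; linarith
    · positivity
    · nlinarith
  have hLl : L - lam = c.LyyPlus := by rw [hL]; ring
  -- The contraction by `1/4` needs `24 LyyPlus ≤ lam Ty²`. The error level `7 Ty² σ` works once `18
  -- ≤ 3/4 Ty²`, and the initial level `2 ΘPlus` once `24 ≤ Ty²`, because `‖ys - ybar‖ ≤ 2 Ry`.
  have key := restartFGM_gap_le hP.convex_Y hP.closed_Y hlam (by rw [hL]; linarith) hσ0 hmodel
    hybar hys hTy (q := 1 / 4) (e := 7 * (p.Ty : ℝ) ^ 2 * σ) (B := 2 * c.ΘPlus) (by norm_num)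
    (by refine hrate.trans ?_
        rw [hLl, div_le_iff₀ (by positivity)]
        linarith)
    (by nlinarith) (by positivity)
    (by refine (mul_le_mul_of_nonneg_right hrate (sq_nonneg _)).trans ?_
        rw [hLl, div_mul_eq_mul_div, div_le_iff₀ (by positivity), ProblemConstants.ΘPlus]
        have h1 : ‖ys - ybar‖ ^ 2 ≤ 4 * c.Ry ^ 2 := by nlinarith [norm_nonneg (ys - ybar)]
        have h2 : 0 ≤ c.LyyPlus * c.Ry ^ 2 := by positivity
        nlinarith [mul_le_mul_of_nonneg_left h1 hLp.le, mul_le_mul_of_nonneg_left hT40 h2]) p.Sy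
  rw [← hyval] at key
  obtain ⟨hyY, hgap⟩ := key
  have hgap := hgap hSy
  set ρ := (1 / 4) ^ p.Sy * (2 * c.ΘPlus) + 7 * (p.Ty : ℝ) ^ 2 * σ with hρ
  obtain ⟨hxX, hxgap⟩ := hsol y hyY
  set x := xt y with hx
  set gt := gradY F Y x y - lam • (y - ybar) with hgt
  -- inaccuracy in the dual variable
  have hmin : ∀ z ∈ Y, f ys ≤ f z := fun z hz => by
    have := hys.2 z hz
    have h2 : 0 ≤ lam / 2 * ‖z - ys‖ ^ 2 := by positivity
    linarith
  have hfvle : fv y ≤ f y := by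
    have h1 := (hxs y hyY).2 x hxX
    have h2 : 0 ≤ c.Lxx / 2 * ‖x - xs y‖ ^ 2 := by positivity
    simp only [hfv, hf, negDual, ← hx]
    linarith
  have hρσ : 0 ≤ ρ + 2 * σ := by
    have : 0 ≤ c.ΘPlus := by rw [ProblemConstants.ΘPlus]; positivity
    positivity
  have hW0 : 0 ≤ W := by rw [hW]; positivity
  -- The upper model at `y`, with its linear error absorbed by Young's inequality, has curvature
  -- `2L` or less and error `2σ`; comparison with the gap `ρ` gives `W = 2 · 2L · (ρ + 2σ)`.
  have hSY : stationarity Y y (-gt) (2 * L) ≤ Real.sqrt W := by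
    refine stationarity_le hYne (by positivity) (Real.sqrt_nonneg _) fun z hz => ?_
    rw [Real.sq_sqrt hW0, hW, inner_neg_left]
    have h1 := (hmodel y hyY z hz).2
    have h2 := sqrt_mul_le_young (x := ‖z - y‖) (L := L - lam) (s := 1) (by rw [hLl]; exact hLp)
      hσ0 one_pos
    rw [horv] at h1
    simp only [← hx, ← hgt, inner_neg_left] at h1
    have h3 := hmin z hz
    have h4 : 0 ≤ lam / 2 * ‖z - y‖ ^ 2 := by positivity
    have h5 : inner ℝ gt (z - y) - L * ‖z - y‖ ^ 2 ≤ ρ + 2 * σ := by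
      simp only [div_one, mul_one] at h2
      linarith
    have h6 := mul_le_mul_of_nonneg_left h5 (show (0 : ℝ) ≤ 4 * L by positivity)
    linarith
  have hSmono : ∀ ℓ : ℝ, 0 < ℓ → ℓ ≤ 2 * L → stationarity Y y (-gt) ℓ ≤ Real.sqrt W :=
    fun ℓ h0 h1 => (stationarity_mono hP.convex_Y hyY h0 h1).trans hSY
  refine ⟨hxX, hyY, ?_, ?_, ?_⟩
  · have h1 : stationarity X x (gradX F X x y + (2 * c.Lxx) • (x - xp)) (3 * c.Lxx)
        ≤ Real.sqrt (6 * c.Lxx * σ) := by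
      refine stationarity_le ⟨xp, hxp⟩ (by positivity) (Real.sqrt_nonneg _) fun z hz => ?_
      rw [Real.sq_sqrt (by positivity)]
      have h2 := (proxObj_hasModel hP xp hyY x hxX z hz).2
      simp only [mul_zero, Real.sqrt_zero, zero_mul, add_zero] at h2
      have h3 := (hxs y hyY).2 z hz
      have h4 : 0 ≤ c.Lxx / 2 * ‖z - xs y‖ ^ 2 := by positivity
      have h5 : -(inner ℝ (gradX F X x y + (2 * c.Lxx) • (x - xp)) (z - x))
          - 3 * c.Lxx / 2 * ‖z - x‖ ^ 2 ≤ σ := by linarith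
      have h6 := mul_le_mul_of_nonneg_left h5 (show (0 : ℝ) ≤ 2 * (3 * c.Lxx) by positivity)
      linarith
    have h2 := stationarity_add_le hP.convex_X (z := x)
      (ζ := gradX F X x y + (2 * c.Lxx) • (x - xp)) (η := -((2 * c.Lxx) • (x - xp))) hxX
      (show 0 < 3 * c.Lxx by positivity)
    rw [add_neg_cancel_right, norm_neg, norm_smul, Real.norm_of_nonneg (by positivity)] at h2
    have h3 := stationarity_mono hP.convex_X (ζ := gradX F X x y) hxX hLxx
      (show c.Lxx ≤ 3 * c.Lxx by linarith)
    linarith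
  · have h1 := stationarity_add_le hP.convex_Y (z := y) (ζ := -gt) (η := -(lam • (y - ybar))) hyY
      hLyy
    have e : -gt + -(lam • (y - ybar)) = -gradY F Y x y := by rw [hgt]; abel
    rw [e, norm_neg, norm_smul, Real.norm_of_nonneg hlam.le] at h1
    have h2 := hSmono c.Lyy hLyy (by rw [hL]; linarith)
    have h3 := mul_le_mul_of_nonneg_left (hP.norm_sub_le hybar hyY) hlam.le
    linarith
  -- Stationarity with constant `lam` bounds the gap of the `lam`-strongly concave `F(x, ·) - lam/2
  -- ‖· - ybar‖²` at `y` by `W / (2 lam)`. The inner gap compares `x` with `xp` at this `y`. An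
  -- arbitrary upper bound `b` stands in for the regularized maximum at `xp`.
  · intro b hb z hz
    have h1 := le_stationarity_sq (Z := Y) (z := y) (ζ := -gt) hlam hz
    have h2 := hSmono lam hlam (by rw [hL]; linarith)
    have h3 : stationarity Y y (-gt) lam ^ 2 ≤ W := by
      have := pow_le_pow_left₀ (stationarity_nonneg _ _ _ _) h2 2
      rwa [Real.sq_sqrt hW0] at this
    have h4 : inner ℝ gt (z - y) - lam / 2 * ‖z - y‖ ^ 2 ≤ W / (2 * lam) := by
      rw [le_div_iff₀ (by positivity), mul_comm]
      rw [inner_neg_left] at h1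
      linarith
    have h5 := hP.le_y hxX hyY hz
    rw [hgt, inner_sub_left, inner_smul_left, conj_trivial] at h4
    have h6 := norm_sub_sq_expand z y ybar
    have h7 := (hxs y hyY).2 xp hxp
    have h8 : 0 ≤ c.Lxx / 2 * ‖xp - xs y‖ ^ 2 := by positivity
    have h9 := hb y hyY
    simp only [proxObj, sub_self, norm_zero] at h7 hxgap
    rw [h6]
    linarith

/-- The invariant of the outer loop: the regularized primal function decreases by the squared
lengths of the steps, up to an error `ε` per iteration. -/
theorem fspIter_spec [FiniteDimensional ℝ E] [FiniteDimensional ℝ G]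
    (hP : SmoothConcaveProblem F X Y c)
    (hc : c.Pos) {p : FSPParams} {lam : ℝ} (hp : StepParams c p lam) {x₀ : E} (hx₀ : x₀ ∈ X)
    {ybar : G} (hybar : ybar ∈ Y) (hbdd : BddBelow (primal F Y '' X))
    (hgap : primalGap F X Y x₀ ≤ c.Δ) {σ W D ε : ℝ} (hD : D = c.Δ + 2 * (lam * c.Ry ^ 2))
    (hσ : σ = (1 / 8) ^ p.So * (2 * D + (c.ΘPlus - c.Θ)))
    (hW : W = 4 * (c.LyyPlus + lam) *
      ((1 / 4) ^ p.Sy * (2 * c.ΘPlus) + 7 * (p.Ty : ℝ) ^ 2 * σ + 2 * σ))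
    (hε : σ + W / (2 * lam) ≤ ε) (hε0 : 0 ≤ ε) (hTε : p.Tx * ε ≤ D) :
    ∀ t ≤ p.Tx, ((fspIter F X Y p x₀ ybar t).val.1 ∈ X ∧
      (∀ y ∈ Y, F (fspIter F X Y p x₀ ybar t).val.1 y - lam / 2 * ‖y - ybar‖ ^ 2
        + c.Lxx * ∑ s ∈ Finset.range t, ‖(fspIter F X Y p x₀ ybar (s + 1)).val.1
            - (fspIter F X Y p x₀ ybar s).val.1‖ ^ 2 ≤ primal F Y x₀ + t * ε)) ∧
      ∀ s < t, (fspIter F X Y p x₀ ybar (s + 1)).val.1 ∈ X ∧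
        (fspIter F X Y p x₀ ybar (s + 1)).val.2 ∈ Y ∧
        stationarity X (fspIter F X Y p x₀ ybar (s + 1)).val.1
          (gradX F X (fspIter F X Y p x₀ ybar (s + 1)).val.1
            (fspIter F X Y p x₀ ybar (s + 1)).val.2) c.Lxx
          ≤ Real.sqrt (6 * c.Lxx * σ) + 2 * c.Lxx * ‖(fspIter F X Y p x₀ ybar (s + 1)).val.1
            - (fspIter F X Y p x₀ ybar s).val.1‖ ∧
        stationarity Y (fspIter F X Y p x₀ ybar (s + 1)).val.2
          (-gradY F Y (fspIter F X Y p x₀ ybar (s + 1)).val.1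
            (fspIter F X Y p x₀ ybar (s + 1)).val.2) c.Lyy
          ≤ Real.sqrt W + 2 * lam * c.Ry := by
  obtain ⟨hLxx, hLyy, hLxy, hRy, hΔ⟩ := id hc
  have hlam := hp.lam_pos
  intro t
  induction t with
  | zero =>
    intro _
    refine ⟨⟨hx₀, fun y hy => ?_⟩, by simp⟩
    obtain ⟨y', hy', he, hmax⟩ := hP.exists_eq_primal hx₀
    have h1 := hmax y hy
    have h2 : 0 ≤ lam / 2 * ‖y - ybar‖ ^ 2 := by positivity
    simp only [fspIter, Counted.ret, Finset.range_zero, Finset.sum_empty, mul_zero, add_zero,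
      Nat.cast_zero, zero_mul]
    linarith
  | succ t ih =>
    intro ht
    obtain ⟨⟨hxp, hpot⟩, hstat⟩ := ih (by omega)
    set xp := (fspIter F X Y p x₀ ybar t).val.1 with hxp_def
    have hsucc : (fspIter F X Y p x₀ ybar (t + 1)).val = (fspStep F X Y p ybar xp).val := rfl
    set sqSum := ∑ s ∈ Finset.range t, ‖(fspIter F X Y p x₀ ybar (s + 1)).val.1
            - (fspIter F X Y p x₀ ybar s).val.1‖ ^ 2 with hst
    have hst0 : 0 ≤ c.Lxx * sqSum := mul_nonneg hLxx.le (Finset.sum_nonneg fun _ _ => sq_nonneg _)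
    have htε : (t : ℝ) * ε ≤ D := by
      refine le_trans ?_ hTε
      have : (t : ℝ) ≤ p.Tx := by exact_mod_cast (by omega : t ≤ p.Tx)
      gcongr
    -- With `y'` a maximizer at `x`, the potential bounds `F xp y' - F x y'` by `2D`. Passing from
    -- `y'` to `y` costs `2 Ry Lxy ‖x - xp‖`, which Young's inequality splits into the proximal term
    -- and `ΘPlus - Θ`.
    have hB : ∀ y ∈ Y, ∀ x ∈ X, F xp y - F x y - c.Lxx * ‖x - xp‖ ^ 2
        ≤ 2 * D + (c.ΘPlus - c.Θ) := by
      intro y hy x hx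
      obtain ⟨y', hy', he, _⟩ := hP.exists_eq_primal hx
      have h1 := primal_sub_le hx hbdd hgap
      have h2 := hpot y' hy'
      have h3 := hP.cross_le hx hxp hy' hy
      have h4 := hP.norm_sub_le hybar hy'
      have h5 := hP.norm_sub_le hy' hy
      have h6 : lam / 2 * ‖y' - ybar‖ ^ 2 ≤ 2 * (lam * c.Ry ^ 2) := by
        have : ‖y' - ybar‖ ^ 2 ≤ (2 * c.Ry) ^ 2 := pow_le_pow_left₀ (norm_nonneg _) h4 2
        nlinarith
      rw [norm_sub_rev xp x] at h3
      have h7 : c.Lxy * ‖x - xp‖ * ‖y - y'‖ ≤ c.Lxy * ‖x - xp‖ * (2 * c.Ry) := by gcongr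
      have h8 : c.Lxy * ‖x - xp‖ * (2 * c.Ry) ≤ c.Lxx * ‖x - xp‖ ^ 2 + (c.ΘPlus - c.Θ) := by
        have h9 : 0 ≤ (c.Lxx * ‖x - xp‖ - c.Lxy * c.Ry) ^ 2 / c.Lxx := by positivity
        have e : c.ΘPlus - c.Θ = c.Lxy ^ 2 / c.Lxx * c.Ry ^ 2 := by
          rw [ProblemConstants.ΘPlus, ProblemConstants.Θ, ProblemConstants.LyyPlus]; ring
        have e2 : (c.Lxx * ‖x - xp‖ - c.Lxy * c.Ry) ^ 2 / c.Lxx = c.Lxx * ‖x - xp‖ ^ 2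
            + c.Lxy ^ 2 / c.Lxx * c.Ry ^ 2 - c.Lxy * ‖x - xp‖ * (2 * c.Ry) := by
          field_simp; ring
        rw [e]; linarith
      linarith
    obtain ⟨s1, s2, s3, s4, s5⟩ := fspStep_spec hP hc hp hxp hybar hB hσ hW
    rw [← hsucc] at s1 s2 s3 s4 s5
    refine ⟨⟨s1, fun y hy => ?_⟩, fun s hs => ?_⟩
    · have := s5 (primal F Y x₀ + t * ε - c.Lxx * sqSum)
        (fun y hy => by linarith [hpot y hy]) y hy
      rw [Finset.sum_range_succ, ← hst]
      push_cast
      linarith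
    · rcases Nat.lt_succ_iff_lt_or_eq.1 hs with h | h
      · exact hstat s h
      · subst h
        exact ⟨s1, s2, s3, s4⟩

end Iteration

/-! ### The prescribed parameters give sufficient accuracy. -/

section Parameters

theorem mul_pow_six_le_mul_sq {N Θ Θp T M δ : ℝ}
    (hT : 0 < T) (hδ0 : 0 < δ) (hM : 0 < M) (hδ : δ * (2 * T ^ 3) ≤ Θ)
    (hMδ : 144 * N * Θp ≤ M * δ ^ 2) : 576 * N * Θp * T ^ 6 ≤ M * Θ ^ 2 := by
  have a1 : 4 * T ^ 6 * δ ^ 2 ≤ Θ ^ 2 := by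
    have := pow_le_pow_left₀ (by positivity) hδ 2
    calc 4 * T ^ 6 * δ ^ 2 = (δ * (2 * T ^ 3)) ^ 2 := by ring
      _ ≤ _ := this
  calc 576 * N * Θp * T ^ 6 = 4 * T ^ 6 * (144 * N * Θp) := by ring
    _ ≤ 4 * T ^ 6 * (M * δ ^ 2) := by gcongr
    _ = M * (4 * T ^ 6 * δ ^ 2) := by ring
    _ ≤ M * Θ ^ 2 := by gcongr

theorem pow_six_le {N Θ Θp T M δ : ℝ} (hN : 2 * Θ ≤ N) (hΘ : 0 < Θ) (hΘp : Θ ≤ Θp)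
    (hT : 0 < T) (hδ0 : 0 < δ) (hM : 0 < M) (hδ : δ * (2 * T ^ 3) ≤ Θ)
    (hMδ : 144 * N * Θp ≤ M * δ ^ 2) : 1152 * T ^ 6 ≤ M := by
  have h := mul_pow_six_le_mul_sq hT hδ0 hM hδ hMδ
  have hN0 : 0 < N := by linarith
  have h2 : 1152 * T ^ 6 * Θ ^ 2 ≤ M * Θ ^ 2 := by
    refine le_trans ?_ h
    calc 1152 * T ^ 6 * Θ ^ 2 = 576 * (2 * Θ) * Θ * T ^ 6 := by ring
      _ ≤ 576 * N * Θp * T ^ 6 := by gcongr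
  exact le_of_mul_le_mul_right h2 (by positivity)

/-- Here `K = 2 ^ So`, and the inner solver contracts by `K⁻³`. Two factors `K` pay for `M`; this
inequality says that the third pays for the initial gap, at most `N + Θp`, and for the amplification
`T²`. It relies on `δ ≤ Θ / (2 T³)`, which makes `M` at least of order `T⁶`. -/
theorem initial_gap_mul_le {N Θ Θp e T M δ K : ℝ} (hΘ : 0 < Θ) (hΘp : Θ ≤ Θp)
    (hN : 2 * Θ ≤ N) (hNe : 6 * e ≤ N) (hT : 0 < T) (hT40 : 40 ≤ T ^ 2)
    (hTe : 40 * Θp ≤ T ^ 2 * e) (hδ0 : 0 < δ) (hM : 0 < M) (hδ : δ * (2 * T ^ 3) ≤ Θ)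
    (hMδ : 144 * N * Θp ≤ M * δ ^ 2) (hK : 0 < K) (hKM : M ≤ K ^ 2) :
    100 * (N + Θp) * T ^ 2 ≤ N * K := by
  have hN0 : 0 < N := by linarith
  have hΘp0 : 0 < Θp := by linarith
  have a2 := mul_pow_six_le_mul_sq hT hδ0 hM hδ hMδ
  have a4 := pow_six_le hN hΘ hΘp hT hδ0 hM hδ hMδ
  have a3 : 2304 * (N * Θp * T ^ 6) ≤ M * N ^ 2 := by
    have : M * (2 * Θ) ^ 2 ≤ M * N ^ 2 := by gcongr
    linarith
  have a5 : 240 * Θp ≤ N * T ^ 2 := by nlinarith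
  have a6 : 240 * (Θp ^ 2 * T ^ 4) ≤ N * Θp * T ^ 6 := by
    calc 240 * (Θp ^ 2 * T ^ 4) = (240 * Θp) * (Θp * T ^ 4) := by ring
      _ ≤ (N * T ^ 2) * (Θp * T ^ 4) := by gcongr
      _ = _ := by ring
  have a7 : 40 * (N ^ 2 * T ^ 4) ≤ N ^ 2 * T ^ 6 := by
    calc 40 * (N ^ 2 * T ^ 4) ≤ T ^ 2 * (N ^ 2 * T ^ 4) := by gcongr
      _ = _ := by ring
  have a8 : 1152 * (N ^ 2 * T ^ 6) ≤ M * N ^ 2 := by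
    calc 1152 * (N ^ 2 * T ^ 6) = (1152 * T ^ 6) * N ^ 2 := by ring
      _ ≤ _ := by gcongr
  have a9 : (N + Θp) ^ 2 * T ^ 4 ≤ 2 * (N ^ 2 * T ^ 4) + 2 * (Θp ^ 2 * T ^ 4) := by
    have : (N + Θp) ^ 2 ≤ 2 * N ^ 2 + 2 * Θp ^ 2 := by nlinarith [sq_nonneg (N - Θp)]
    calc (N + Θp) ^ 2 * T ^ 4 ≤ (2 * N ^ 2 + 2 * Θp ^ 2) * T ^ 4 := by gcongr
      _ = _ := by ring
  have a10 : N ^ 2 * M ≤ N ^ 2 * K ^ 2 := by gcongr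
  have hMN : 0 < M * N ^ 2 := by positivity
  refine (sq_le_sq₀ (by positivity) (by positivity)).1 ?_
  calc (100 * (N + Θp) * T ^ 2) ^ 2 = 10000 * ((N + Θp) ^ 2 * T ^ 4) := by ring
    _ ≤ (N * K) ^ 2 := by rw [mul_pow]; linarith

/-- All that is needed about the size of the inner inaccuracy `σ`, the contraction `R` of the dual
epochs, and the resulting bound for the dual inaccuracy. -/
theorem accuracy_bounds {Nx T e Θ Θp Δ δ R s lam : ℝ} (hNx : 0 < Nx)
    (hT : 0 < T) (hT40 : 40 ≤ T ^ 2) (he : 0 < e) (hTe : 40 * Θp ≤ T ^ 2 * e)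
    (hΘ : 0 < Θ) (hΘp : Θ < Θp) (hΔ : 0 < Δ) (hδ0 : 0 < δ) (hδe : δ ≤ 8 * e)
    (hδ : δ * (2 * T ^ 3) ≤ Θ) (hδN : δ ^ 2 * (Nx * T ^ 2) ≤ Δ * (Θp - Θ))
    (hR0 : 0 ≤ R) (hRT : R * T ^ 4 ≤ 1) (hRδ : R * T ^ 2 * Θp ^ 2 ≤ δ ^ 2)
    (hs0 : 0 ≤ s) (hs : 14400 * Θp * s ≤ δ ^ 2) (hlam : 0 < lam) :
    lam * T ^ 2 * (2 * R * Θp + 8 * s) / 10 ≤ lam * e ∧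
    Nx * (s + T ^ 2 * (2 * R * Θp + 8 * s) / 20) ≤ Δ := by
  have hΘp0 : 0 < Θp := hΘ.trans hΘp
  constructor
  · have h1 : T ^ 2 * (R * Θp) ≤ e / 40 := by
      have : (T ^ 2 * R) * (40 * Θp) ≤ (T ^ 2 * R) * (T ^ 2 * e) := by gcongr
      have : (R * T ^ 4) * e ≤ 1 * e := by gcongr
      nlinarith
    have h2 : T ^ 2 * s ≤ e / 10 := by
      have h3 : δ ^ 2 * (2 * T ^ 3) ≤ 8 * e * Θp := by
        calc δ ^ 2 * (2 * T ^ 3) = δ * (δ * (2 * T ^ 3)) := by ring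
          _ ≤ 8 * e * Θ := by gcongr
          _ ≤ 8 * e * Θp := by gcongr
      have hT1 : 1 ≤ T := by nlinarith
      have h4 : T ^ 2 ≤ T ^ 3 := by
        calc T ^ 2 = T ^ 2 * 1 := by ring
          _ ≤ T ^ 2 * T := by gcongr
          _ = T ^ 3 := by ring
      have h5 : 14400 * Θp * s * (2 * T ^ 2) ≤ 8 * e * Θp := by
        calc 14400 * Θp * s * (2 * T ^ 2) ≤ δ ^ 2 * (2 * T ^ 3) := by gcongr
          _ ≤ _ := h3
      have h6 : Θp * (28800 * (T ^ 2 * s)) ≤ Θp * (8 * e) := by linarith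
      have := le_of_mul_le_mul_left h6 hΘp0
      linarith
    have : T ^ 2 * (2 * R * Θp + 8 * s) / 10 ≤ e := by linarith
    calc lam * T ^ 2 * (2 * R * Θp + 8 * s) / 10 = lam * (T ^ 2 * (2 * R * Θp + 8 * s) / 10) := by
          ring
      _ ≤ lam * e := by gcongr
  · have hδN' : δ ^ 2 * (Nx * T ^ 2) ≤ Δ * Θp := hδN.trans (by gcongr; linarith)
    have h1 : Nx * (T ^ 2 * (R * Θp)) ≤ Δ / 40 := by
      have h2 : (R * T ^ 2 * Θp ^ 2) * (Nx * T ^ 2) ≤ Δ * Θp := by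
        refine le_trans ?_ hδN'
        gcongr
      have h3 : Θp * (T ^ 2 * (Nx * (T ^ 2 * (R * Θp)))) ≤ Θp * Δ := by linarith
      have h4 := le_of_mul_le_mul_left h3 hΘp0
      have h5 : 0 ≤ Nx * (T ^ 2 * (R * Θp)) := by positivity
      have h6 := mul_le_mul_of_nonneg_right hT40 h5
      linarith
    have h2 : Nx * (T ^ 2 * s) ≤ Δ / 14400 := by
      have h3 : (14400 * Θp * s) * (Nx * T ^ 2) ≤ Δ * Θp := by
        refine le_trans ?_ hδN'
        gcongr
      have h4 : Θp * (14400 * (Nx * (T ^ 2 * s))) ≤ Θp * Δ := by linarith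
      have := le_of_mul_le_mul_left h4 hΘp0
      linarith
    have h3 : Nx * s ≤ Nx * (T ^ 2 * s) := by
      have h4 : 0 ≤ Nx * s := by positivity
      nlinarith
    linarith

namespace ProblemConstants

variable {c : ProblemConstants} {εx εy : ℝ}

theorem le_two_pow_of_logb_le {m : ℝ} {n : ℕ} (hm : 0 < m) (h : Real.logb 2 m ≤ n) :
    m ≤ 2 ^ n := by
  rwa [Real.logb_le_iff_le_rpow one_lt_two hm, Real.rpow_natCast] at h

theorem lam_pos (hc : c.Pos) (hy : 0 < εy) : 0 < c.lam εy := div_pos hy hc.2.2.2.1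

theorem Θ_pos (hc : c.Pos) : 0 < c.Θ := by
  obtain ⟨hLxx, hLyy, hLxy, hRy, hΔ⟩ := hc
  rw [Θ]; positivity

theorem Θ_lt_ΘPlus (hc : c.Pos) : c.Θ < c.ΘPlus := by
  have h := Lyy_lt_LyyPlus hc
  have := hc.2.2.2.1
  rw [Θ, ΘPlus]
  gcongr

theorem lam_mul_sq (hc : c.Pos) : c.lam εy * c.Ry ^ 2 = εy * c.Ry := by
  have := hc.2.2.2.1
  rw [lam]; field_simp

theorem boundTx_pos (hc : c.Pos) (hx : 0 < εx) (hy : 0 < εy) : 0 < c.boundTx εx εy := by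
  obtain ⟨hLxx, hLyy, hLxy, hRy, hΔ⟩ := hc
  rw [boundTx]; positivity

theorem boundTy_pos (hc : c.Pos) (hy : 0 < εy) : 0 < c.boundTy εy := by
  have h1 := lam_pos hc hy
  have h2 := LyyPlus_pos hc
  rw [boundTy]; positivity

theorem δ_pos (hc : c.Pos) (hy : 0 < εy) {Tx Ty : ℕ} (hTx : 0 < Tx) (hTy : 0 < Ty) :
    0 < c.δ εy Tx Ty := by
  have h1 := Θ_pos hc
  have h2 := sub_pos.2 (Θ_lt_ΘPlus hc)
  obtain ⟨hLxx, hLyy, hLxy, hRy, hΔ⟩ := hc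
  rw [δ]
  have hTx' : (0 : ℝ) < Tx := by exact_mod_cast hTx
  have hTy' : (0 : ℝ) < Ty := by exact_mod_cast hTy
  refine lt_min (by positivity) (lt_min (by positivity) (by positivity))

theorem δ_spec (hc : c.Pos) {Tx Ty : ℕ} (hTx : 0 < Tx) (hTy : 0 < Ty) (hδ : 0 < c.δ εy Tx Ty) :
    c.δ εy Tx Ty ≤ 8 * (εy * c.Ry) ∧ c.δ εy Tx Ty * (2 * (Ty : ℝ) ^ 3) ≤ c.Θ ∧
    c.δ εy Tx Ty ^ 2 * (Tx * (Ty : ℝ) ^ 2) ≤ c.Δ * (c.ΘPlus - c.Θ) := by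
  have h2 := sub_pos.2 (Θ_lt_ΘPlus hc)
  have hΔ := hc.2.2.2.2
  have hTx' : (0 : ℝ) < Tx := by exact_mod_cast hTx
  have hTy' : (0 : ℝ) < Ty := by exact_mod_cast hTy
  refine ⟨?_, ?_, ?_⟩
  · exact (min_le_left _ _).trans (by linarith)
  · rw [← le_div_iff₀ (by positivity)]
    exact (min_le_right _ _).trans (min_le_left _ _)
  · have h3 : c.δ εy Tx Ty ≤ Real.sqrt (c.Δ * (c.ΘPlus - c.Θ) / ((Tx : ℝ) * (Ty : ℝ) ^ 2)) :=
      (min_le_right _ _).trans (min_le_right _ _)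
    have h4 := pow_le_pow_left₀ hδ.le h3 2
    rw [Real.sq_sqrt (by positivity), le_div_iff₀ (by positivity)] at h4
    exact h4

/-- The argument of the logarithm in the lower bound for the number of primal epochs. -/
def logArgSo (c : ProblemConstants) (εx εy : ℝ) (Tx Ty : ℕ) : ℝ :=
  72 * (3 * c.Δ + 2 * c.Θ + 6 * εy * c.Ry) *
    (c.Lxx / εx ^ 2 + 2 * c.ΘPlus / c.δ εy Tx Ty ^ 2 + 1 / (12 * c.δ εy Tx Ty))

theorem boundSo_eq (εx εy : ℝ) (Tx Ty : ℕ) :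
    c.boundSo εx εy Tx Ty = 1 / 2 * Real.logb 2 (c.logArgSo εx εy Tx Ty) := rfl

theorem logArgSo_pos (hc : c.Pos) (hx : 0 < εx) (hy : 0 < εy) {Tx Ty : ℕ}
    (hδ : 0 < c.δ εy Tx Ty) : 0 < c.logArgSo εx εy Tx Ty := by
  have h1 := Θ_pos hc
  have h2 := h1.trans (Θ_lt_ΘPlus hc)
  obtain ⟨hLxx, hLyy, hLxy, hRy, hΔ⟩ := hc
  rw [logArgSo]; positivity

namespace Prescribed

variable {p : FSPParams}

theorem Tx_pos (h : c.Prescribed εx εy p) (hc : c.Pos) (hx : 0 < εx) (hy : 0 < εy) :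
    0 < p.Tx := by
  exact_mod_cast (boundTx_pos hc hx hy).trans_le h.le_Tx

theorem Ty_pos (h : c.Prescribed εx εy p) (hc : c.Pos) (hy : 0 < εy) : 0 < p.Ty := by
  exact_mod_cast (boundTy_pos hc hy).trans_le h.le_Ty

theorem cond_le (h : c.Prescribed εx εy p) (hc : c.Pos) (hy : 0 < εy) :
    40 * (c.LyyPlus + c.lam εy) ≤ c.lam εy * (p.Ty : ℝ) ^ 2 := by
  have h1 := lam_pos hc hy
  have h2 := h.le_Ty
  rw [boundTy, Real.sqrt_le_iff, div_le_iff₀ h1] at h2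
  linarith [h2.2]

theorem forty_le (h : c.Prescribed εx εy p) (hc : c.Pos) (hy : 0 < εy) :
    40 ≤ (p.Ty : ℝ) ^ 2 := by
  have h1 := h.cond_le hc hy
  have h2 := LyyPlus_pos hc
  have h3 : c.lam εy * 40 ≤ c.lam εy * (p.Ty : ℝ) ^ 2 := by linarith
  exact le_of_mul_le_mul_left h3 (lam_pos hc hy)

theorem seven_le_Ty (h : c.Prescribed εx εy p) (hc : c.Pos) (hy : 0 < εy) : 7 ≤ p.Ty := by
  have h1 := h.forty_le hc hy
  have h2 : 40 ≤ p.Ty ^ 2 := by exact_mod_cast h1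
  nlinarith

theorem δ_pos (h : c.Prescribed εx εy p) (hc : c.Pos) (hx : 0 < εx) (hy : 0 < εy) :
    0 < c.δ εy p.Tx p.Ty :=
  ProblemConstants.δ_pos hc hy (h.Tx_pos hc hx hy) (h.Ty_pos hc hy)

theorem sq_max_le (h : c.Prescribed εx εy p) (hc : c.Pos) (hy : 0 < εy) :
    (max (p.Ty : ℝ) (c.ΘPlus / c.δ εy p.Tx p.Ty)) ^ 2 ≤ 2 ^ p.Sy := by
  have h1 := h.le_Sy
  have h2 : (0 : ℝ) < p.Ty := by exact_mod_cast h.Ty_pos hc hy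
  have hm : 0 < max (p.Ty : ℝ) (c.ΘPlus / c.δ εy p.Tx p.Ty) := lt_max_of_lt_left h2
  apply le_two_pow_of_logb_le (by positivity)
  rw [Real.logb_pow]
  exact_mod_cast h1

theorem logArgSo_le (h : c.Prescribed εx εy p) (hc : c.Pos) (hx : 0 < εx) (hy : 0 < εy) :
    c.logArgSo εx εy p.Tx p.Ty ≤ (2 ^ p.So) ^ 2 := by
  have h1 := h.le_So
  rw [boundSo_eq] at h1
  rw [← pow_mul]
  apply le_two_pow_of_logb_le (logArgSo_pos hc hx hy (h.δ_pos hc hx hy))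
  push_cast
  linarith

theorem mul_sq_le_logArgSo (h : c.Prescribed εx εy p) (hc : c.Pos) (hx : 0 < εx) (hy : 0 < εy) :
    144 * (3 * c.Δ + 2 * c.Θ + 6 * εy * c.Ry) * c.ΘPlus
        ≤ c.logArgSo εx εy p.Tx p.Ty * c.δ εy p.Tx p.Ty ^ 2 ∧
    72 * (3 * c.Δ + 2 * c.Θ + 6 * εy * c.Ry) * c.Lxx ≤ c.logArgSo εx εy p.Tx p.Ty * εx ^ 2 := by
  have hδ := h.δ_pos hc hx hy
  have h1 := Θ_pos hc
  have h2 := h1.trans (Θ_lt_ΘPlus hc)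
  obtain ⟨hLxx, hLyy, hLxy, hRy, hΔ⟩ := hc
  set δ := c.δ εy p.Tx p.Ty with hδ_def
  have hN : 0 < 3 * c.Δ + 2 * c.Θ + 6 * εy * c.Ry := by positivity
  rw [logArgSo, ← hδ_def]
  set N := 3 * c.Δ + 2 * c.Θ + 6 * εy * c.Ry
  constructor
  · have e : 72 * N * (c.Lxx / εx ^ 2 + 2 * c.ΘPlus / δ ^ 2 + 1 / (12 * δ)) * δ ^ 2 =
        144 * N * c.ΘPlus + 72 * N * (c.Lxx / εx ^ 2 + 1 / (12 * δ)) * δ ^ 2 := by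
      field_simp; ring
    rw [e]
    have : 0 ≤ 72 * N * (c.Lxx / εx ^ 2 + 1 / (12 * δ)) * δ ^ 2 := by positivity
    linarith
  · have e : 72 * N * (c.Lxx / εx ^ 2 + 2 * c.ΘPlus / δ ^ 2 + 1 / (12 * δ)) * εx ^ 2 =
        72 * N * c.Lxx + 72 * N * (2 * c.ΘPlus / δ ^ 2 + 1 / (12 * δ)) * εx ^ 2 := by
      field_simp; ring
    rw [e]
    have : 0 ≤ 72 * N * (2 * c.ΘPlus / δ ^ 2 + 1 / (12 * δ)) * εx ^ 2 := by positivity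
    linarith

/-- Since `Ty ≥ 7`, the argument of the logarithm is at least `1152 · 7⁶`, which exceeds `2 ^ 24`.
This and `eighteen_le_Sy` yield the factor `1.02` in the cost bound. -/
theorem thirteen_le_So (h : c.Prescribed εx εy p) (hc : c.Pos) (hx : 0 < εx) (hy : 0 < εy) :
    13 ≤ p.So := by
  have hδ := h.δ_pos hc hx hy
  have hTx := h.Tx_pos hc hx hy
  have hTy := h.Ty_pos hc hy
  have hTy' : (0 : ℝ) < p.Ty := by exact_mod_cast hTy
  have hΘ := Θ_pos hc
  have h1 := pow_six_le (N := 3 * c.Δ + 2 * c.Θ + 6 * εy * c.Ry)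
    (by obtain ⟨_, _, _, hRy, hΔ⟩ := hc
        have : 0 < εy * c.Ry := by positivity
        linarith) hΘ (Θ_lt_ΘPlus hc).le hTy' hδ
    (logArgSo_pos hc hx hy hδ) (δ_spec hc hTx hTy hδ).2.1 (h.mul_sq_le_logArgSo hc hx hy).1
  have h2 := h1.trans (h.logArgSo_le hc hx hy)
  have h3 : (7 : ℝ) ≤ p.Ty := by exact_mod_cast h.seven_le_Ty hc hy
  have h4 : (7 : ℝ) ^ 6 ≤ (p.Ty : ℝ) ^ 6 := by gcongr
  by_contra hlt
  have h5 : (2 : ℝ) ^ p.So ≤ 2 ^ 12 := pow_le_pow_right₀ one_le_two (by omega)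
  have h6 : ((2 : ℝ) ^ p.So) ^ 2 ≤ (2 ^ 12) ^ 2 := by gcongr
  norm_num at h4 h6
  linarith

theorem eighteen_le_Sy (h : c.Prescribed εx εy p) (hc : c.Pos) (hx : 0 < εx) (hy : 0 < εy) :
    18 ≤ p.Sy := by
  have hδ := h.δ_pos hc hx hy
  have h1 := (δ_spec hc (h.Tx_pos hc hx hy) (h.Ty_pos hc hy) hδ).2.1
  have h3 : (7 : ℝ) ≤ p.Ty := by exact_mod_cast h.seven_le_Ty hc hy
  have h4 : (7 : ℝ) ^ 3 ≤ (p.Ty : ℝ) ^ 3 := by gcongr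
  have h5 : 686 ≤ c.ΘPlus / c.δ εy p.Tx p.Ty := by
    rw [le_div_iff₀ hδ]
    have := Θ_lt_ΘPlus hc
    nlinarith
  have h6 : (686 : ℝ) ^ 2 ≤ 2 ^ p.Sy := by
    refine le_trans ?_ (h.sq_max_le hc hy)
    have := h5.trans (le_max_right (p.Ty : ℝ) _)
    gcongr
  by_contra hlt
  have h7 : (2 : ℝ) ^ p.Sy ≤ 2 ^ 17 := pow_le_pow_right₀ one_le_two (by omega)
  norm_num at h6 h7
  linarith

theorem stepParams (h : c.Prescribed εx εy p) (hc : c.Pos) (hx : 0 < εx) (hy : 0 < εy) :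
    StepParams c p (c.lam εy) where
  γx_eq := h.γx_eq
  γy_eq := h.γy_eq
  lamY_eq := h.lamY_eq
  lam_pos := lam_pos hc hy
  To_eq := h.To_eq
  one_le_So := by linarith [h.thirteen_le_So hc hx hy]
  one_le_Sy := by linarith [h.eighteen_le_Sy hc hx hy]
  one_le_Ty := h.Ty_pos hc hy
  cond_le := h.cond_le hc hy

/-- The prescribed parameters make the inner and the dual inaccuracy small enough. -/
theorem accuracy (h : c.Prescribed εx εy p) (hc : c.Pos) (hx : 0 < εx) (hy : 0 < εy) {σ W : ℝ}
    (hσ : σ = (1 / 8) ^ p.So * (2 * (c.Δ + 2 * (εy * c.Ry)) + (c.ΘPlus - c.Θ)))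
    (hW : W = 4 * (c.LyyPlus + c.lam εy) *
      ((1 / 4) ^ p.Sy * (2 * c.ΘPlus) + 7 * (p.Ty : ℝ) ^ 2 * σ + 2 * σ)) :
    0 ≤ σ ∧ 0 ≤ W ∧ 6 * c.Lxx * σ ≤ εx ^ 2 ∧ W ≤ (3 * εy) ^ 2 ∧
      p.Tx * (σ + W / (2 * c.lam εy)) ≤ c.Δ + 2 * (εy * c.Ry) := by
  have hδ0 := h.δ_pos hc hx hy
  have hTx : (0 : ℝ) < p.Tx := by exact_mod_cast h.Tx_pos hc hx hy
  have hTy : (0 : ℝ) < p.Ty := by exact_mod_cast h.Ty_pos hc hy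
  obtain ⟨hδ1, hδ2, hδ3⟩ := δ_spec hc (h.Tx_pos hc hx hy) (h.Ty_pos hc hy) hδ0
  have hM := logArgSo_pos hc hx hy hδ0
  obtain ⟨hM1, hM2⟩ := h.mul_sq_le_logArgSo hc hx hy
  have hKM := h.logArgSo_le hc hx hy
  have hΘ := Θ_pos hc
  have hΘp := Θ_lt_ΘPlus hc
  have hT40 := h.forty_le hc hy
  have hcond := h.cond_le hc hy
  have hlam := lam_pos hc hy
  have hlamR := lam_mul_sq (εy := εy) hc
  have hmax := h.sq_max_le hc hy
  have hLp := LyyPlus_pos hc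
  obtain ⟨hLxx, hLyy, hLxy, hRy, hΔ⟩ := hc
  set δ := c.δ εy p.Tx p.Ty
  set M := c.logArgSo εx εy p.Tx p.Ty
  set T : ℝ := (p.Ty : ℝ)
  set lam := c.lam εy
  set e := εy * c.Ry with he_def
  have he : 0 < e := by positivity
  have hle : lam * e = εy ^ 2 := by
    simp only [lam, e, ProblemConstants.lam]; field_simp
  have hNe : 3 * c.Δ + 2 * c.Θ + 6 * εy * c.Ry = 3 * c.Δ + 2 * c.Θ + 6 * e := by
    rw [he_def]; ring
  rw [hNe] at hM1 hM2
  set N := 3 * c.Δ + 2 * c.Θ + 6 * e with hN_def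
  have hN : 0 < N := by positivity
  have hTe : 40 * c.ΘPlus ≤ T ^ 2 * e := by
    rw [← hlamR, ProblemConstants.ΘPlus]
    have : c.Ry ^ 2 * (40 * (c.LyyPlus + lam)) ≤ c.Ry ^ 2 * (lam * T ^ 2) := by gcongr
    have h2 : 0 ≤ c.Ry ^ 2 * lam := by positivity
    linarith
  set K : ℝ := 2 ^ p.So with hK_def
  have hK : 0 < K := by positivity
  have hinit := initial_gap_mul_le (N := N) hΘ hΘp.le (by linarith) (by linarith) hTy hT40 hTe hδ0 hM
    hδ2 hM1 hK hKM
  have hK3 : ((1 : ℝ) / 8) ^ p.So = 1 / K ^ 3 := by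
    rw [hK_def, ← pow_mul, mul_comm, pow_mul, one_div_pow]; norm_num
  have hσ0 : 0 ≤ σ := by
    have : 0 ≤ c.ΘPlus - c.Θ := by linarith
    rw [hσ]; positivity
  -- the inner inaccuracy
  have hs : 100 * M * (T ^ 2 * σ) ≤ N := by
    have h1 : σ * K ^ 3 ≤ N + c.ΘPlus := by
      rw [hσ, hK3]
      field_simp
      linarith
    have h2 : K * (100 * M * (T ^ 2 * σ)) ≤ K * N := by
      calc K * (100 * M * (T ^ 2 * σ)) ≤ K * (100 * K ^ 2 * (T ^ 2 * σ)) := by gcongr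
        _ = 100 * (σ * K ^ 3) * T ^ 2 := by ring
        _ ≤ 100 * (N + c.ΘPlus) * T ^ 2 := by gcongr
        _ ≤ _ := by linarith
    exact le_of_mul_le_mul_left h2 hK
  set s := T ^ 2 * σ with hs_def
  have hs0 : 0 ≤ s := by positivity
  have hσs : 40 * σ ≤ s := by rw [hs_def]; gcongr
  have hs1 : 14400 * c.ΘPlus * s ≤ δ ^ 2 := by
    have h1 : N * (14400 * c.ΘPlus * s) ≤ N * δ ^ 2 := by
      calc N * (14400 * c.ΘPlus * s) = 100 * s * (144 * N * c.ΘPlus) := by ring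
        _ ≤ 100 * s * (M * δ ^ 2) := by gcongr
        _ = (100 * M * s) * δ ^ 2 := by ring
        _ ≤ N * δ ^ 2 := by gcongr
    exact le_of_mul_le_mul_left h1 hN
  have hs2 : 7200 * c.Lxx * s ≤ εx ^ 2 := by
    have h1 : N * (7200 * c.Lxx * s) ≤ N * εx ^ 2 := by
      calc N * (7200 * c.Lxx * s) = 100 * s * (72 * N * c.Lxx) := by ring
        _ ≤ 100 * s * (M * εx ^ 2) := by gcongr
        _ = (100 * M * s) * εx ^ 2 := by ring
        _ ≤ N * εx ^ 2 := by gcongr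
    exact le_of_mul_le_mul_left h1 hN
  -- the contraction of the dual epochs
  set R : ℝ := (1 / 4) ^ p.Sy with hR_def
  have hR0 : 0 ≤ R := by positivity
  -- As `4 ^ Sy = 2 ^ Sy · 2 ^ Sy`, the contraction pays for two squares of the maximum. It is used
  -- for the pairs `(T, T)` and `(T, ΘPlus / δ)`.
  have hR : ∀ a b : ℝ, 0 ≤ a → 0 ≤ b → a ≤ max T (c.ΘPlus / δ) → b ≤ max T (c.ΘPlus / δ) →
      R * (a ^ 2 * b ^ 2) ≤ 1 := by
    intro a b ha hb h1 h2
    have h3 : a ^ 2 ≤ 2 ^ p.Sy := (pow_le_pow_left₀ ha h1 2).trans hmax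
    have h4 : b ^ 2 ≤ 2 ^ p.Sy := (pow_le_pow_left₀ hb h2 2).trans hmax
    have h5 : R * ((2 : ℝ) ^ p.Sy * 2 ^ p.Sy) = 1 := by
      rw [hR_def, ← mul_pow, ← mul_pow]; norm_num
    rw [← h5]
    gcongr
  have hR1 : R * T ^ 4 ≤ 1 := by
    have := hR T T hTy.le hTy.le (le_max_left _ _) (le_max_left _ _)
    calc R * T ^ 4 = R * (T ^ 2 * T ^ 2) := by ring
      _ ≤ 1 := this
  have hR2 : R * T ^ 2 * c.ΘPlus ^ 2 ≤ δ ^ 2 := by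
    have := hR T (c.ΘPlus / δ) hTy.le (by have := hΘ.trans hΘp; positivity)
      (le_max_left _ _) (le_max_right _ _)
    rw [div_pow, mul_div_assoc', mul_div_assoc', div_le_one (by positivity)] at this
    linarith
  obtain ⟨hA1, hA2⟩ := accuracy_bounds hTx hTy hT40 he hTe hΘ hΘp hΔ hδ0 hδ1 hδ2 hδ3 hR0 hR1 hR2
    hs0 hs1 hlam
  have hΘp0 : 0 < c.ΘPlus := hΘ.trans hΘp
  have hW0 : 0 ≤ W := by rw [hW]; positivity
  -- The condition `40 (LyyPlus + lam) ≤ lam T²` trades the smoothness constant in `W` for `lam T² /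
  -- 10`.
  have hWle : W ≤ lam * T ^ 2 * (2 * R * c.ΘPlus + 8 * s) / 10 := by
    rw [hW]
    have h1 : R * (2 * c.ΘPlus) + 7 * T ^ 2 * σ + 2 * σ ≤ 2 * R * c.ΘPlus + 8 * s := by
      have : 7 * T ^ 2 * σ = 7 * s := by rw [hs_def]; ring
      rw [this]; linarith
    calc _ ≤ 4 * (c.LyyPlus + lam) * (2 * R * c.ΘPlus + 8 * s) := by gcongr
      _ = (40 * (c.LyyPlus + lam)) * (2 * R * c.ΘPlus + 8 * s) / 10 := by ring
      _ ≤ _ := by gcongr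
  refine ⟨hσ0, hW0, ?_, ?_, ?_⟩
  · have h1 : c.Lxx * σ ≤ c.Lxx * s := mul_le_mul_of_nonneg_left (by linarith) hLxx.le
    have h2 : 0 ≤ c.Lxx * s := by positivity
    linarith
  · rw [hle] at hA1
    have h1 := sq_nonneg εy
    rw [mul_pow]
    linarith
  · have h1 : W / (2 * lam) ≤ T ^ 2 * (2 * R * c.ΘPlus + 8 * s) / 20 := by
      rw [div_le_iff₀ (by positivity)]
      linarith
    have h2 : σ + W / (2 * lam) ≤ s + T ^ 2 * (2 * R * c.ΘPlus + 8 * s) / 20 := by linarith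
    have h3 := mul_le_mul_of_nonneg_left h2 hTx.le
    linarith

end Prescribed

end ProblemConstants

end Parameters

/-! ### Counting gradient evaluations and projections. -/

section Cost

theorem Counted.bind_grads {α β : Type*} (m : Counted α) (f : α → Counted β) :
    (m.bind f).grads = m.grads + (f m.val).grads := rfl

theorem Counted.bind_projs {α β : Type*} (m : Counted α) (f : α → Counted β) :
    (m.bind f).projs = m.projs + (f m.val).projs := rfl

theorem Counted.ret_grads {α : Type*} (a : α) : (Counted.ret a).grads = 0 := rfl

theorem Counted.ret_projs {α : Type*} (a : α) : (Counted.ret a).projs = 0 := rfl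

variable {E : Type*} [NormedAddCommGroup E] [InnerProductSpace ℝ E]

theorem fgmLoop_cost (Z : Set E) (γ : ℝ) (oracle : E → Counted E) {k l : ℕ}
    (hk : ∀ x, (oracle x).grads = k) (hl : ∀ x, (oracle x).projs = l) (z₀ : E) (T : ℕ) :
    (fgmLoop Z γ oracle z₀ T).grads = T * k ∧
    (fgmLoop Z γ oracle z₀ T).projs = T * (2 + l) := by
  induction T with
  | zero => simp [fgmLoop, Counted.ret]
  | succ T ih =>
    simp only [fgmLoop, Counted.bind, fgmStep, proxCall, Counted.ret, hk, hl, ih.1, ih.2]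
    constructor <;> ring

theorem restartFGM_cost (Z : Set E) (γ : ℝ) (oracle : E → Counted E) {k l : ℕ}
    (hk : ∀ x, (oracle x).grads = k) (hl : ∀ x, (oracle x).projs = l) (T : ℕ) (z₀ : E) (S : ℕ) :
    (restartFGM Z γ T oracle z₀ S).grads = S * T * k ∧
    (restartFGM Z γ T oracle z₀ S).projs = S * T * (2 + l) := by
  induction S with
  | zero => simp [restartFGM, Counted.ret]
  | succ S ih =>
    simp only [restartFGM, Counted.bind, fgm, Counted.ret, ih.1, ih.2,
      (fgmLoop_cost Z γ oracle hk hl _ T).1, (fgmLoop_cost Z γ oracle hk hl _ T).2]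
    constructor <;> ring

end Cost

/-! ### Total cost and the guarantee for the output. -/

section Outer

variable {E G : Type*} [NormedAddCommGroup E] [InnerProductSpace ℝ E] [CompleteSpace E]
  [NormedAddCommGroup G] [InnerProductSpace ℝ G] [CompleteSpace G]

theorem solveRegDual_cost (F : E → G → ℝ) (X : Set E) (Y : Set G) (p : FSPParams) (xp : E)
    (ybar y : G) :
    (solveRegDual F X Y p xp ybar y).grads = p.To * p.So + 1 ∧
    (solveRegDual F X Y p xp ybar y).projs = 2 * (p.To * p.So) := by
  have h := restartFGM_cost X (2 / 3 * p.γx)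
    (fun x => (gradCall F X Y x y).bind fun g =>
      .ret (g.1 + (1 / p.γx) • (x - xp))) (k := 1) (l := 0) (fun _ => rfl) (fun _ => rfl)
    p.To xp p.So
  obtain ⟨h1, h2⟩ := h
  have hg : ∀ x, (gradCall F X Y x y).grads = 1 := fun _ => rfl
  have hp : ∀ x, (gradCall F X Y x y).projs = 0 := fun _ => rfl
  constructor
  · simp only [solveRegDual, Counted.bind_grads, Counted.ret_grads, h1, hg]; ring
  · simp only [solveRegDual, Counted.bind_projs, Counted.ret_projs, h2, hp]; ring

theorem fspIter_cost (F : E → G → ℝ) (X : Set E) (Y : Set G) (p : FSPParams) (x₀ : E)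
    (ybar : G) (t : ℕ) :
    (fspIter F X Y p x₀ ybar t).grads = t * (p.Sy * p.Ty + 1) * (p.To * p.So + 1) ∧
    (fspIter F X Y p x₀ ybar t).projs =
      t * (2 * (p.Sy * p.Ty + (p.Sy * p.Ty + 1) * (p.To * p.So))) := by
  induction t with
  | zero => simp [fspIter, Counted.ret]
  | succ t ih =>
    have h := restartFGM_cost Y p.γy
      (fun y' => (solveRegDual F X Y p (fspIter F X Y p x₀ ybar t).val.1 ybar y').bind
        fun r => .ret (-r.2)) (k := p.To * p.So + 1) (l := 2 * (p.To * p.So))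
      (fun y => (solveRegDual_cost F X Y p _ ybar y).1)
      (fun y => (solveRegDual_cost F X Y p _ ybar y).2) p.Ty ybar p.Sy
    obtain ⟨h1, h2⟩ := h
    constructor
    · simp only [fspIter, fspStep, Counted.bind_grads, Counted.ret_grads, h1, ih.1,
        (solveRegDual_cost F X Y p _ ybar _).1]
      ring
    · simp only [fspIter, fspStep, Counted.bind_projs, Counted.ret_projs, h2, ih.2,
        (solveRegDual_cost F X Y p _ ybar _).2]
      ring

theorem fspRun_cost (F : E → G → ℝ) (X : Set E) (Y : Set G) (p : FSPParams) (x₀ : E)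
    (ybar : G) :
    (fspRun F X Y p x₀ ybar).grads = p.Tx * (p.Sy * p.Ty + 1) * (p.To * p.So + 1) ∧
    (fspRun F X Y p x₀ ybar).projs ≤ 2 * (fspRun F X Y p x₀ ybar).grads := by
  obtain ⟨h1, h2⟩ := fspIter_cost F X Y p x₀ ybar p.Tx
  rw [fspRun]
  refine ⟨h1, ?_⟩
  rw [h1, h2]
  have : p.Sy * p.Ty + (p.Sy * p.Ty + 1) * (p.To * p.So)
      ≤ (p.Sy * p.Ty + 1) * (p.To * p.So + 1) := by nlinarith
  calc _ ≤ p.Tx * (2 * ((p.Sy * p.Ty + 1) * (p.To * p.So + 1))) := by gcongr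
    _ = _ := by ring

theorem fspRun_grads_le (F : E → G → ℝ) (X : Set E) (Y : Set G) {c : ProblemConstants}
    {εx εy : ℝ} {p : FSPParams} (h : c.Prescribed εx εy p) (hc : c.Pos) (hx : 0 < εx)
    (hy : 0 < εy) (x₀ : E) (ybar : G) :
    ((fspRun F X Y p x₀ ybar).grads : ℝ)
      ≤ 51 / 50 * ((p.To : ℝ) * p.So * p.Sy * p.Tx * p.Ty) := by
  rw [(fspRun_cost F X Y p x₀ ybar).1]
  have h1 : (13 : ℝ) ≤ p.So := by exact_mod_cast h.thirteen_le_So hc hx hy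
  have h2 : (18 : ℝ) ≤ p.Sy := by exact_mod_cast h.eighteen_le_Sy hc hx hy
  have h3 : (7 : ℝ) ≤ p.Ty := by exact_mod_cast h.seven_le_Ty hc hy
  rw [h.To_eq]
  push_cast
  have h4 : (126 : ℝ) ≤ p.Sy * p.Ty := by nlinarith
  have h5 : (143 : ℝ) ≤ 11 * p.So := by linarith
  -- This holds because `(1 + 1/126)(1 + 1/143) < 51/50`.
  have h6 : ((p.Sy : ℝ) * p.Ty + 1) * (11 * p.So + 1) ≤ 51 / 50 * ((p.Sy * p.Ty) * (11 * p.So)) := by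
    nlinarith [mul_nonneg (sub_nonneg.2 h4) (sub_nonneg.2 h5)]
  calc (p.Tx : ℝ) * (p.Sy * p.Ty + 1) * (11 * p.So + 1)
      = p.Tx * ((p.Sy * p.Ty + 1) * (11 * p.So + 1)) := by ring
    _ ≤ p.Tx * (51 / 50 * ((p.Sy * p.Ty) * (11 * p.So))) := by gcongr
    _ = _ := by ring

theorem exists_isOutputBy (F : E → G → ℝ) (X : Set E) (Y : Set G) {p : FSPParams} (hp : 0 < p.Tx)
    (x₀ : E) (ybar : G) (score : ℕ → ℝ) : ∃ q, IsOutputBy F X Y p x₀ ybar score q := by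
  obtain ⟨τ, hτ, hmin⟩ := (Finset.range p.Tx).exists_min_image score ⟨0, Finset.mem_range.2 hp⟩
  exact ⟨_, τ, Finset.mem_range.1 hτ, fun t ht => hmin t (Finset.mem_range.2 ht), rfl⟩

variable {F : E → G → ℝ} {X : Set E} {Y : Set G} {c : ProblemConstants} {εx εy : ℝ}
  {p : FSPParams} {x₀ : E} {ybar : G}

/-- Every iterate is feasible and almost stationary in the dual variable, its inaccuracy in the
primal variable is controlled by the length of the step, and the steps are square summable. -/
theorem fspIter_guarantee [FiniteDimensional ℝ E] [FiniteDimensional ℝ G]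
    (hP : SmoothConcaveProblem F X Y c) (hc : c.Pos) (h : c.Prescribed εx εy p) (hx : 0 < εx)
    (hy : 0 < εy) (hx₀ : x₀ ∈ X) (hybar : ybar ∈ Y) (hbdd : BddBelow (primal F Y '' X))
    (hgap : primalGap F X Y x₀ ≤ c.Δ) :
    (c.Lxx * ∑ s ∈ Finset.range p.Tx, ‖(fspIter F X Y p x₀ ybar (s + 1)).val.1
        - (fspIter F X Y p x₀ ybar s).val.1‖ ^ 2 ≤ 2 * (c.Δ + 2 * (εy * c.Ry))) ∧
    ∀ s < p.Tx, (fspIter F X Y p x₀ ybar (s + 1)).val.1 ∈ X ∧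
      (fspIter F X Y p x₀ ybar (s + 1)).val.2 ∈ Y ∧
      stationarity X (fspIter F X Y p x₀ ybar (s + 1)).val.1
        (gradX F X (fspIter F X Y p x₀ ybar (s + 1)).val.1
          (fspIter F X Y p x₀ ybar (s + 1)).val.2) c.Lxx
        ≤ εx + 2 * c.Lxx * ‖(fspIter F X Y p x₀ ybar (s + 1)).val.1
          - (fspIter F X Y p x₀ ybar s).val.1‖ ∧
      stationarity Y (fspIter F X Y p x₀ ybar (s + 1)).val.2
        (-gradY F Y (fspIter F X Y p x₀ ybar (s + 1)).val.1
          (fspIter F X Y p x₀ ybar (s + 1)).val.2) c.Lyy ≤ 5 * εy := by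
  obtain ⟨hσ0, hW0, hσx, hWy, hT⟩ := h.accuracy hc hx hy rfl rfl
  set σ := ((1 : ℝ) / 8) ^ p.So * (2 * (c.Δ + 2 * (εy * c.Ry)) + (c.ΘPlus - c.Θ)) with hσ
  set W := 4 * (c.LyyPlus + c.lam εy) *
      ((1 / 4) ^ p.Sy * (2 * c.ΘPlus) + 7 * (p.Ty : ℝ) ^ 2 * σ + 2 * σ) with hW
  have hlam := ProblemConstants.lam_pos hc hy
  have hlamR := ProblemConstants.lam_mul_sq (εy := εy) hc
  have hlamR1 : c.lam εy * c.Ry = εy := by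
    have := hc.2.2.2.1
    rw [ProblemConstants.lam]; field_simp
  obtain ⟨⟨hxT, hpot⟩, hstat⟩ := fspIter_spec hP hc (h.stepParams hc hx hy) hx₀ hybar hbdd hgap
    (D := c.Δ + 2 * (εy * c.Ry)) (by rw [hlamR]) hσ hW le_rfl (by positivity) hT p.Tx le_rfl
  refine ⟨?_, fun s hs => ?_⟩
  · obtain ⟨y', hy', he, _⟩ := hP.exists_eq_primal hxT
    have h1 := hpot y' hy'
    have h2 := primal_sub_le hxT hbdd hgap
    have h3 := hP.norm_sub_le hybar hy'
    have h4 : c.lam εy / 2 * ‖y' - ybar‖ ^ 2 ≤ 2 * (εy * c.Ry) := by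
      have h5 : ‖y' - ybar‖ ^ 2 ≤ (2 * c.Ry) ^ 2 := pow_le_pow_left₀ (norm_nonneg _) h3 2
      rw [← hlamR]
      nlinarith
    linarith
  · obtain ⟨s1, s2, s3, s4⟩ := hstat s hs
    have h1 : Real.sqrt (6 * c.Lxx * σ) ≤ εx := Real.sqrt_le_iff.2 ⟨hx.le, hσx⟩
    have h2 : Real.sqrt W ≤ 3 * εy := Real.sqrt_le_iff.2 ⟨by positivity, hWy⟩
    exact ⟨s1, s2, by linarith, by linarith⟩

theorem isFNE_of_min_step [FiniteDimensional ℝ E] [FiniteDimensional ℝ G]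
    (hP : SmoothConcaveProblem F X Y c) (hc : c.Pos) (h : c.Prescribed εx εy p) (hx : 0 < εx)
    (hy : 0 < εy) (hx₀ : x₀ ∈ X) (hybar : ybar ∈ Y) (hbdd : BddBelow (primal F Y '' X))
    (hgap : primalGap F X Y x₀ ≤ c.Δ) {τ : ℕ} (hτ : τ < p.Tx)
    (hmin : ∀ t < p.Tx, ‖(fspIter F X Y p x₀ ybar (τ + 1)).val.1
      - (fspIter F X Y p x₀ ybar τ).val.1‖ ≤ ‖(fspIter F X Y p x₀ ybar (t + 1)).val.1
      - (fspIter F X Y p x₀ ybar t).val.1‖) :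
    IsFNE F X Y c (2 * εx) (5 * εy) (fspIter F X Y p x₀ ybar (τ + 1)).val.1
      (fspIter F X Y p x₀ ybar (τ + 1)).val.2 := by
  obtain ⟨hsum, hstat⟩ := fspIter_guarantee hP hc h hx hy hx₀ hybar hbdd hgap
  obtain ⟨s1, s2, s3, s4⟩ := hstat τ hτ
  refine ⟨s1, s2, s3.trans ?_, s4⟩
  set m := ‖(fspIter F X Y p x₀ ybar (τ + 1)).val.1 - (fspIter F X Y p x₀ ybar τ).val.1‖
  have hm0 : 0 ≤ m := norm_nonneg _
  have h1 : (p.Tx : ℝ) * m ^ 2 ≤ ∑ s ∈ Finset.range p.Tx,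
      ‖(fspIter F X Y p x₀ ybar (s + 1)).val.1 - (fspIter F X Y p x₀ ybar s).val.1‖ ^ 2 := by
    have := Finset.card_nsmul_le_sum (Finset.range p.Tx)
      (fun s => ‖(fspIter F X Y p x₀ ybar (s + 1)).val.1
        - (fspIter F X Y p x₀ ybar s).val.1‖ ^ 2) (m ^ 2)
      (fun s hs => pow_le_pow_left₀ hm0 (hmin s (Finset.mem_range.1 hs)) 2)
    simpa using this
  have h2 := h.le_Tx
  have hTx : (0 : ℝ) < p.Tx := by exact_mod_cast h.Tx_pos hc hx hy
  rw [ProblemConstants.boundTx, div_le_iff₀ (by positivity)] at h2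
  have hLxx := hc.1
  -- The square sum is at most `2D / Lxx` and `Tx ≥ 10 Lxx D / εx²`, so the shortest step satisfies
  -- `5 (Lxx m)² ≤ εx²`, which gives `2 Lxx m ≤ εx`.
  have h3 := mul_le_mul_of_nonneg_left (hsum.trans' (mul_le_mul_of_nonneg_left h1 hLxx.le)) hLxx.le
  have h4 : (p.Tx : ℝ) * (5 * (c.Lxx * m) ^ 2) ≤ p.Tx * εx ^ 2 := by linarith
  have h5 := le_of_mul_le_mul_left h4 hTx
  have h6 : (2 * (c.Lxx * m)) ^ 2 ≤ εx ^ 2 := by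
    have := sq_nonneg (c.Lxx * m)
    linarith
  have h7 := (sq_le_sq₀ (by positivity) hx.le).1 h6
  linarith

theorem isFNE_of_isFSPOutput [FiniteDimensional ℝ E] [FiniteDimensional ℝ G]
    (hP : SmoothConcaveProblem F X Y c) (hc : c.Pos) (h : c.Prescribed εx εy p) (hx : 0 < εx)
    (hy : 0 < εy) (hx₀ : x₀ ∈ X) (hybar : ybar ∈ Y) (hbdd : BddBelow (primal F Y '' X))
    (hgap : primalGap F X Y x₀ ≤ c.Δ) {q : E × G} (hq : IsFSPOutput F X Y p x₀ ybar q) :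
    IsFNE F X Y c (2 * εx) (5 * εy) q.1 q.2 := by
  obtain ⟨τ, hτ, hmin, rfl⟩ := hq
  exact isFNE_of_min_step hP hc h hx hy hx₀ hybar hbdd hgap hτ hmin

/-- On the whole space the stationarity measure is the gradient norm, so the selected iterate is no
worse in `x` than the one with the shortest step. The dual bound holds for every iterate. -/
theorem isFNE_of_isFSPGradOutput [FiniteDimensional ℝ E] [FiniteDimensional ℝ G]
    (hP : SmoothConcaveProblem F X Y c) (hc : c.Pos) (h : c.Prescribed εx εy p) (hx : 0 < εx)
    (hy : 0 < εy) (hx₀ : x₀ ∈ X) (hybar : ybar ∈ Y) (hbdd : BddBelow (primal F Y '' X))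
    (hgap : primalGap F X Y x₀ ≤ c.Δ) (hX : X = univ) {q : E × G}
    (hq : IsFSPGradOutput F X Y p x₀ ybar q) : IsFNE F X Y c (2 * εx) (5 * εy) q.1 q.2 := by
  obtain ⟨τ, hτ, hmin, rfl⟩ := hq
  obtain ⟨s1, s2, -, s4⟩ :=
    (fspIter_guarantee hP hc h hx hy hx₀ hybar hbdd hgap).2 τ hτ
  refine ⟨s1, s2, ?_, s4⟩
  obtain ⟨_, ρ, hρ, hρmin, -⟩ := exists_isOutputBy F X Y (h.Tx_pos hc hx hy) x₀ ybar
    (fun t => ‖(fspIter F X Y p x₀ ybar (t + 1)).val.1 - (fspIter F X Y p x₀ ybar t).val.1‖)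
  have h1 := (isFNE_of_min_step hP hc h hx hy hx₀ hybar hbdd hgap hρ hρmin).2.2.1
  have h2 := hmin ρ hρ
  subst hX
  rw [stationarity_univ _ _ hc.1] at h1 ⊢
  exact h2.trans h1

end Outer

/-! ### Complexity with the least prescribed parameters. -/

namespace ProblemConstants

variable {c : ProblemConstants} {εx εy : ℝ}

theorem natCeil_le_mul_log {x : ℝ} {k : ℝ} {P : ℝ} (hP : 2 ≤ P) (hk : 0 ≤ k)
    (hx : x ≤ k * Real.logb 2 P) : (⌈x⌉₊ : ℝ) ≤ (k + 1) * Real.logb 2 P := by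
  have h1 : 1 ≤ Real.logb 2 P := by
    rw [Real.le_logb_iff_rpow_le one_lt_two (by linarith)]
    simpa using hP
  rcases le_or_gt x 0 with h | h
  · rw [Nat.ceil_eq_zero.2 h]
    push_cast
    positivity
  · linarith [Nat.ceil_lt_add_one h.le]

theorem logb_le_mul_logb {x P : ℝ} (hx : 0 < x) (n : ℕ) (h : x ≤ P ^ n) :
    Real.logb 2 x ≤ n * Real.logb 2 P := by
  rw [← Real.logb_pow]
  exact Real.logb_le_logb_of_le one_lt_two hx h

/-- If all the relevant quantities are bounded by powers of `P`, the inverse accuracy of the oracle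
is bounded by a power of `P`. -/
theorem ΘPlus_div_δ_le (hc : c.Pos) (hy : 0 < εy) {Tx Ty : ℕ} (hTx : 0 < Tx)
    (hTy : 0 < Ty) {P : ℝ} (hP : 2 ≤ P) (hTxP : (Tx : ℝ) ≤ P ^ 6) (hTyP : (Ty : ℝ) ≤ P ^ 5)
    (h1 : c.ΘPlus ≤ P ^ 2 * (εy * c.Ry)) (h2 : c.ΘPlus ≤ P ^ 2 * c.Θ)
    (h3 : c.ΘPlus ^ 2 ≤ P ^ 2 * (c.Δ * (c.ΘPlus - c.Θ))) :
    c.ΘPlus / c.δ εy Tx Ty ≤ P ^ 18 := by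
  have hδ := δ_pos hc hy hTx hTy
  have hΘ := Θ_pos hc
  have hΘp := Θ_lt_ΘPlus hc
  have hRy := hc.2.2.2.1
  have hΔ := hc.2.2.2.2
  have hTx' : (0 : ℝ) < Tx := by exact_mod_cast hTx
  have hTy' : (0 : ℝ) < Ty := by exact_mod_cast hTy
  have hP1 : 1 ≤ P := by linarith
  have hP0 : 0 < P := by linarith
  rw [div_le_iff₀ hδ, mul_comm, ← div_le_iff₀ (by positivity), δ]
  -- One bound for each entry of the minimum in `δ`. The exponent `18 = 2 + 1 + 15` comes from the
  -- second, `Θ / (2 Ty³)`; the others leave room.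
  refine le_min ?_ (le_min ?_ ?_)
  · rw [div_le_iff₀ (by positivity)]
    refine h1.trans ?_
    have h4 : P ^ 2 ≤ P ^ 18 := pow_le_pow_right₀ hP1 (by norm_num)
    have h5 : 0 < εy * c.Ry := by positivity
    have h6 : P ^ 2 * (εy * c.Ry) ≤ P ^ 18 * (εy * c.Ry) := by gcongr
    have h7 : 0 ≤ P ^ 18 * (εy * c.Ry) := by positivity
    linarith
  · rw [div_le_div_iff₀ (by positivity) (by positivity)]
    have h4 : (Ty : ℝ) ^ 3 ≤ (P ^ 5) ^ 3 := by gcongr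
    calc c.ΘPlus * (2 * (Ty : ℝ) ^ 3) ≤ (P ^ 2 * c.Θ) * (P * (P ^ 5) ^ 3) := by gcongr
      _ = c.Θ * P ^ 18 := by ring
  · apply Real.le_sqrt_of_sq_le
    rw [div_pow, div_le_div_iff₀ (by positivity) (by positivity)]
    have h4 : (Ty : ℝ) ^ 2 ≤ (P ^ 5) ^ 2 := by gcongr
    have h5 : 0 ≤ P ^ 2 * (c.Δ * (c.ΘPlus - c.Θ)) := (sq_nonneg _).trans h3
    have h6 : 0 ≤ c.Δ * (c.ΘPlus - c.Θ) := mul_nonneg hΔ.le (by linarith)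
    calc c.ΘPlus ^ 2 * ((Tx : ℝ) * (Ty : ℝ) ^ 2)
        ≤ (P ^ 2 * (c.Δ * (c.ΘPlus - c.Θ))) * (P ^ 6 * (P ^ 5) ^ 2) := by gcongr
      _ = c.Δ * (c.ΘPlus - c.Θ) * P ^ 18 := by ring
      _ ≤ c.Δ * (c.ΘPlus - c.Θ) * (P ^ 18) ^ 2 := by
        gcongr
        exact le_self_pow₀ (one_le_pow₀ hP1) two_ne_zero

theorem logArgSo_le_pow (hc : c.Pos) (hy : 0 < εy) {Tx Ty : ℕ} (hTx : 0 < Tx)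
    (hTy : 0 < Ty) {P : ℝ} (hP : 2 ≤ P)
    (hδP : c.ΘPlus / c.δ εy Tx Ty ≤ P ^ 18)
    (h4 : (3 * c.Δ + 2 * c.Θ + 6 * εy * c.Ry) * (c.Lxx / εx ^ 2) ≤ P ^ 6)
    (h5 : 3 * c.Δ + 2 * c.Θ + 6 * εy * c.Ry ≤ P ^ 5 * c.ΘPlus) :
    c.logArgSo εx εy Tx Ty ≤ P ^ 50 := by
  have hδ := δ_pos hc hy hTx hTy
  have hΘ := Θ_pos hc
  have hΘp := hΘ.trans (Θ_lt_ΘPlus hc)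
  have hP0 : 0 < P := by linarith
  have hP1 : 1 ≤ P := by linarith
  rw [logArgSo]
  set N := 3 * c.Δ + 2 * c.Θ + 6 * εy * c.Ry
  set δ := c.δ εy Tx Ty
  set r := c.ΘPlus / δ with hr
  have hr0 : 0 < r := by positivity
  -- In terms of `r = ΘPlus / δ` and `N / ΘPlus` each summand is bounded by a power of `P`. The
  -- largest is `144 P⁴¹`, and `72 + 144 + 6 ≤ 2⁹ ≤ P⁹` absorbs the coefficients.
  have e : 72 * N * (c.Lxx / εx ^ 2 + 2 * c.ΘPlus / δ ^ 2 + 1 / (12 * δ)) =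
      72 * (N * (c.Lxx / εx ^ 2)) + 144 * (N / c.ΘPlus) * r ^ 2 + 6 * (N / c.ΘPlus) * r := by
    rw [hr]; field_simp; ring
  rw [e]
  have h6 : N / c.ΘPlus ≤ P ^ 5 := by rwa [div_le_iff₀ hΘp]
  have h7 : 144 * (N / c.ΘPlus) * r ^ 2 ≤ 144 * P ^ 5 * (P ^ 18) ^ 2 := by gcongr
  have h8 : 6 * (N / c.ΘPlus) * r ≤ 6 * P ^ 5 * P ^ 18 := by gcongr
  have h9 : P ^ 6 ≤ P ^ 41 := pow_le_pow_right₀ hP1 (by norm_num)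
  have h10 : P ^ 23 ≤ P ^ 41 := pow_le_pow_right₀ hP1 (by norm_num)
  have h11 : (2 : ℝ) ^ 9 ≤ P ^ 9 := by gcongr
  have h12 : 0 < P ^ 41 := by positivity
  have h13 : P ^ 50 = P ^ 9 * P ^ 41 := by ring
  have h14 : (2 : ℝ) ^ 9 * P ^ 41 ≤ P ^ 9 * P ^ 41 := by gcongr
  have h15 : 144 * P ^ 5 * (P ^ 18) ^ 2 = 144 * P ^ 41 := by ring
  have h16 : 6 * P ^ 5 * P ^ 18 = 6 * P ^ 23 := by ring
  rw [h13]
  norm_num at h14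
  linarith

/-- The cost with the least prescribed parameters is bounded by `Tx Ty log² P` if all the relevant
quantities are bounded by powers of `P`. -/
theorem least_cost_le (hc : c.Pos) (hx : 0 < εx) (hy : 0 < εy) {P : ℝ} (hP : 2 ≤ P)
    (hTxP : ((c.leastParams εx εy).Tx : ℝ) ≤ P ^ 6) (hTyP : ((c.leastParams εx εy).Ty : ℝ) ≤ P ^ 5)
    (h1 : c.ΘPlus ≤ P ^ 2 * (εy * c.Ry)) (h2 : c.ΘPlus ≤ P ^ 2 * c.Θ)
    (h3 : c.ΘPlus ^ 2 ≤ P ^ 2 * (c.Δ * (c.ΘPlus - c.Θ)))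
    (h4 : (3 * c.Δ + 2 * c.Θ + 6 * εy * c.Ry) * (c.Lxx / εx ^ 2) ≤ P ^ 6)
    (h5 : 3 * c.Δ + 2 * c.Θ + 6 * εy * c.Ry ≤ P ^ 5 * c.ΘPlus)
    {p : FSPParams} (hp : p = c.leastParams εx εy) :
    51 / 50 * ((p.To : ℝ) * p.So * p.Sy * p.Tx * p.Ty)
      ≤ 44000 * ((p.Tx : ℝ) * p.Ty) * Real.log P ^ 2 := by
  have hpre : c.Prescribed εx εy p := hp ▸ c.leastParams_prescribed εx εy
  rw [← hp] at hTxP hTyP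
  have hTx := hpre.Tx_pos hc hx hy
  have hTy := hpre.Ty_pos hc hy
  have hδP := ΘPlus_div_δ_le hc hy hTx hTy hP hTxP hTyP h1 h2 h3
  have hMP := logArgSo_le_pow hc hy hTx hTy hP hδP h4 h5
  have hδ := hpre.δ_pos hc hx hy
  have hM := logArgSo_pos (εx := εx) hc hx hy hδ
  have hP1 : 1 ≤ P := by linarith
  have hTy' : (0 : ℝ) < p.Ty := by exact_mod_cast hTy
  have hSo : (p.So : ℝ) ≤ 26 * Real.logb 2 P := by
    have e : p.So = ⌈c.boundSo εx εy p.Tx p.Ty⌉₊ := by rw [hp]; rfl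
    rw [e]
    refine (natCeil_le_mul_log hP (k := 25) (by norm_num) ?_).trans (by norm_num)
    rw [boundSo_eq]
    have := logb_le_mul_logb hM 50 hMP
    push_cast at this
    linarith
  have hSy : (p.Sy : ℝ) ≤ 37 * Real.logb 2 P := by
    have e : p.Sy = ⌈c.boundSy εy p.Tx p.Ty⌉₊ := by rw [hp]; rfl
    rw [e]
    refine (natCeil_le_mul_log hP (k := 36) (by norm_num) ?_).trans (by norm_num)
    rw [boundSy]
    have h6 : (p.Ty : ℝ) ≤ P ^ 18 := hTyP.trans (pow_le_pow_right₀ hP1 (by norm_num))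
    have := logb_le_mul_logb (lt_max_of_lt_left hTy') 18 (max_le h6 hδP)
    push_cast at this
    linarith
  have hlog : Real.logb 2 P ≤ 2 * Real.log P := by
    rw [Real.logb, div_le_iff₀ (Real.log_pos one_lt_two)]
    have h6 := Real.log_two_gt_d9
    have h7 : 0 ≤ Real.log P := Real.log_nonneg hP1
    nlinarith
  have hlog0 : 0 ≤ Real.logb 2 P := Real.logb_nonneg one_lt_two hP1
  have hl : Real.logb 2 P ^ 2 ≤ (2 * Real.log P) ^ 2 := pow_le_pow_left₀ hlog0 hlog 2
  have hTo : (p.To : ℝ) = 11 := by rw [hpre.To_eq]; norm_num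
  rw [hTo]
  have hS : (p.So : ℝ) * p.Sy ≤ (26 * Real.logb 2 P) * (37 * Real.logb 2 P) := by gcongr
  -- The constant is `51/50 · 11 · 26 · 37 · 4`, rounded up; the last factor comes from `logb 2 P ≤
  -- 2 log P`.
  have hS2 : 51 / 50 * 11 * ((p.So : ℝ) * p.Sy) ≤ 44000 * Real.log P ^ 2 := by
    have := sq_nonneg (Real.log P)
    linarith
  calc 51 / 50 * (11 * (p.So : ℝ) * p.Sy * p.Tx * p.Ty)
      = (51 / 50 * 11 * ((p.So : ℝ) * p.Sy)) * ((p.Tx : ℝ) * p.Ty) := by ring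
    _ ≤ (44000 * Real.log P ^ 2) * ((p.Tx : ℝ) * p.Ty) := by gcongr
    _ = _ := by ring

theorem factorX_cost_le (hc : c.Pos) (hx : 0 < εx) (hy : 0 < εy) (hX : 1 ≤ c.factorX εx)
    (hY : 1 ≤ c.factorY εy) (hε : εy * c.Ry ≤ c.Δ) {p : FSPParams}
    (hp : p = c.leastParams εx εy) :
    51 / 50 * ((p.To : ℝ) * p.So * p.Sy * p.Tx * p.Ty)
      ≤ 13640000 * (c.factorX εx * c.factorY εy) * Real.log (c.logArg εx εy) ^ 2 := by
  have hΘ := Θ_pos hc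
  have hΘlt := Θ_lt_ΘPlus hc
  have hΘp := hΘ.trans hΘlt
  have hsub := sub_pos.2 hΘlt
  have hlam := lam_pos hc hy
  have hLp := LyyPlus_pos hc
  obtain ⟨hLxx, hLyy, hLxy, hRy, hΔ⟩ := id hc
  have he : 0 < εy * c.Ry := by positivity
  set P := c.logArg εx εy with hP
  set A := c.factorX εx with hA
  set B := c.factorY εy with hB
  have hr1 : 0 < c.ΘPlus / c.Θ := by positivity
  have hr2 : 0 < c.ΘPlus / (c.ΘPlus - c.Θ) := by positivity
  have hr3 : 0 < c.ΘPlus / c.Δ := by positivity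
  have hr4 : 0 < c.Δ / c.ΘPlus := by positivity
  rw [logArg, ← hA, ← hB] at hP
  have hP2 : 2 ≤ P := by linarith
  have hP0 : 0 < P := by linarith
  have hP1 : 1 ≤ P := by linarith
  have hAP : A ≤ P := by linarith
  have hBP : B ≤ P := by linarith
  have hr1P : c.ΘPlus / c.Θ ≤ P := by linarith
  have hr2P : c.ΘPlus / (c.ΘPlus - c.Θ) ≤ P := by linarith
  have hr3P : c.ΘPlus / c.Δ ≤ P := by linarith
  have hr4P : c.Δ / c.ΘPlus ≤ P := by linarith
  rw [div_le_iff₀ (by positivity)] at hr1P hr2P hr3P hr4P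
  have hP4 : (2 : ℝ) ^ 4 ≤ P ^ 4 := by gcongr
  have hP5 : 16 * P ≤ P ^ 5 := by
    calc 16 * P = 2 ^ 4 * P := by norm_num
      _ ≤ P ^ 4 * P := by gcongr
      _ = P ^ 5 := by ring
  have hP6 : 32 * P ≤ P ^ 6 := by
    calc 32 * P = 2 * (16 * P) := by ring
      _ ≤ P * P ^ 5 := by gcongr
      _ = P ^ 6 := by ring
  have hAeq : c.Lxx * c.Δ = A * εx ^ 2 := by rw [hA, factorX]; field_simp
  have hBsq : B ^ 2 = c.LyyPlus * c.Ry / εy := by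
    rw [hB, factorY, Real.sq_sqrt (by positivity)]
  have hΘe : c.ΘPlus = B ^ 2 * (εy * c.Ry) := by rw [hBsq, ΘPlus]; field_simp
  have hTx : (p.Tx : ℝ) ≤ 31 * A := by
    have e : p.Tx = ⌈c.boundTx εx εy⌉₊ := by rw [hp]; rfl
    have h1 : c.boundTx εx εy ≤ 30 * A := by
      rw [boundTx, div_le_iff₀ (by positivity)]
      have := mul_le_mul_of_nonneg_left hε hLxx.le
      linarith
    rw [e]
    linarith [Nat.ceil_lt_add_one (boundTx_pos hc hx hy).le]
  have hTy : (p.Ty : ℝ) ≤ 10 * B := by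
    have e : p.Ty = ⌈c.boundTy εy⌉₊ := by rw [hp]; rfl
    -- Since `B ≥ 1`, the radicand `40 B² + 40` is at most `80 B² ≤ (9 B)²`; rounding up costs at
    -- most another `B`.
    have h1 : c.boundTy εy ≤ 9 * B := by
      rw [boundTy, Real.sqrt_le_iff]
      refine ⟨by positivity, ?_⟩
      rw [mul_pow, hBsq, lam]
      have h2 : 1 ≤ c.LyyPlus * c.Ry / εy := by rw [← hBsq]; exact one_le_pow₀ hY
      have h3 : 40 * (c.LyyPlus + εy / c.Ry) / (εy / c.Ry)
          = 40 * (c.LyyPlus * c.Ry / εy) + 40 := by field_simp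
      rw [h3]; linarith
    rw [e]
    linarith [Nat.ceil_lt_add_one (boundTy_pos hc hy).le]
  have hNle : 3 * c.Δ + 2 * c.Θ + 6 * εy * c.Ry ≤ 9 * c.Δ + 2 * c.ΘPlus := by linarith
  refine (least_cost_le hc hx hy hP2 (by rw [← hp]; linarith) (by rw [← hp]; linarith)
    ?_ ?_ ?_ ?_ ?_ hp).trans ?_
  · rw [hΘe]; gcongr
  · refine hr1P.trans ?_
    have : P ≤ P ^ 2 := le_self_pow₀ hP1 two_ne_zero
    gcongr
  · calc c.ΘPlus ^ 2 = c.ΘPlus * c.ΘPlus := by ring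
      _ ≤ (P * c.Δ) * (P * (c.ΘPlus - c.Θ)) := by gcongr
      _ = _ := by ring
  · have h1 : c.Lxx / εx ^ 2 = A / c.Δ := by rw [hA, factorX]; field_simp
    rw [h1]
    have h2 : (3 * c.Δ + 2 * c.Θ + 6 * εy * c.Ry) / c.Δ ≤ P ^ 5 := by
      rw [div_le_iff₀ hΔ]
      calc _ ≤ 9 * c.Δ + 2 * c.ΘPlus := hNle
        _ ≤ 9 * c.Δ + 2 * (P * c.Δ) := by gcongr
        _ = (9 + 2 * P) * c.Δ := by ring
        _ ≤ P ^ 5 * c.Δ := by gcongr; linarith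
    calc (3 * c.Δ + 2 * c.Θ + 6 * εy * c.Ry) * (A / c.Δ)
        = (3 * c.Δ + 2 * c.Θ + 6 * εy * c.Ry) / c.Δ * A := by ring
      _ ≤ P ^ 5 * P := by gcongr
      _ = P ^ 6 := by ring
  · calc _ ≤ 9 * c.Δ + 2 * c.ΘPlus := hNle
      _ ≤ 9 * (P * c.ΘPlus) + 2 * c.ΘPlus := by gcongr
      _ = (9 * P + 2) * c.ΘPlus := by ring
      _ ≤ P ^ 5 * c.ΘPlus := by gcongr; linarith
  · have : (p.Tx : ℝ) * p.Ty ≤ (31 * A) * (10 * B) := by gcongr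
    have h2 := sq_nonneg (Real.log P)
    calc 44000 * ((p.Tx : ℝ) * p.Ty) * Real.log P ^ 2
        ≤ 44000 * ((31 * A) * (10 * B)) * Real.log P ^ 2 := by gcongr
      _ = _ := by ring

/-- The factor in front of `εx⁻²` in the number of outer iterations. -/
def outerConst (c : ProblemConstants) : ℝ := 10 * (c.Lxx * (c.Δ + 2 * c.Ry)) + 1

/-- The factor in front of `εy^(-1/2)` in the number of iterations per dual epoch. -/
def dualConst (c : ProblemConstants) : ℝ := Real.sqrt (40 * (1 + c.LyyPlus * c.Ry)) + 1

/-- A constant such that all the relevant quantities are bounded by powers of this constant divided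
by `εx εy`. -/
def baseConst (c : ProblemConstants) : ℝ :=
  2 + c.outerConst + c.dualConst + c.LyyPlus * c.Ry + c.ΘPlus / c.Θ
    + c.ΘPlus ^ 2 / (c.Δ * (c.ΘPlus - c.Θ)) + (3 * c.Δ + 2 * c.Θ + 6 * c.Ry) * c.Lxx
    + (3 * c.Δ + 2 * c.Θ + 6 * c.Ry) / c.ΘPlus

/-- The constant in the complexity bound in terms of the accuracies. -/
def complexityConst (c : ProblemConstants) : ℝ :=
  44000 * (c.outerConst * c.dualConst) * (1 + Real.log c.baseConst) ^ 2

theorem accuracy_cost_le (hc : c.Pos) (hx : 0 < εx) (hy : 0 < εy) (hx1 : εx ≤ 1) (hy1 : εy ≤ 1)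
    {p : FSPParams} (hp : p = c.leastParams εx εy) :
    51 / 50 * ((p.To : ℝ) * p.So * p.Sy * p.Tx * p.Ty)
      ≤ c.complexityConst * (εx⁻¹ ^ 2 * Real.sqrt εy⁻¹)
        * (1 + Real.log εx⁻¹ + Real.log εy⁻¹) ^ 2 := by
  have hΘ := Θ_pos hc
  have hΘlt := Θ_lt_ΘPlus hc
  have hΘp := hΘ.trans hΘlt
  have hsub := sub_pos.2 hΘlt
  have hLp := LyyPlus_pos hc
  obtain ⟨hLxx, hLyy, hLxy, hRy, hΔ⟩ := id hc
  set a := εx⁻¹ with ha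
  set b := εy⁻¹ with hb
  have ha1 : 1 ≤ a := (one_le_inv₀ hx).2 hx1
  have hb1 : 1 ≤ b := (one_le_inv₀ hy).2 hy1
  have hsb1 : 1 ≤ Real.sqrt b := Real.one_le_sqrt.2 hb1
  have hbe : b * εy = 1 := inv_mul_cancel₀ hy.ne'
  have haa : 1 ≤ a ^ 2 := one_le_pow₀ ha1
  set K := c.baseConst with hK
  have k1 : 1 ≤ c.outerConst := by
    have : 0 < 10 * (c.Lxx * (c.Δ + 2 * c.Ry)) := by positivity
    rw [outerConst]; linarith
  have k2 : 1 ≤ c.dualConst := by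
    rw [dualConst]; linarith [Real.sqrt_nonneg (40 * (1 + c.LyyPlus * c.Ry))]
  have k3 : 0 < c.LyyPlus * c.Ry := by positivity
  have k4 : 0 < c.ΘPlus / c.Θ := by positivity
  have k5 : 0 < c.ΘPlus ^ 2 / (c.Δ * (c.ΘPlus - c.Θ)) := by positivity
  have k6 : 0 < (3 * c.Δ + 2 * c.Θ + 6 * c.Ry) * c.Lxx := by positivity
  have k7 : 0 < (3 * c.Δ + 2 * c.Θ + 6 * c.Ry) / c.ΘPlus := by positivity
  rw [baseConst] at hK
  have K1 : c.outerConst ≤ K := by linarith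
  have K2 : c.dualConst ≤ K := by linarith
  have K3 : c.LyyPlus * c.Ry ≤ K := by linarith
  have K4 : c.ΘPlus / c.Θ ≤ K := by linarith
  have K5 : c.ΘPlus ^ 2 / (c.Δ * (c.ΘPlus - c.Θ)) ≤ K := by linarith
  have K6 : (3 * c.Δ + 2 * c.Θ + 6 * c.Ry) * c.Lxx ≤ K := by linarith
  have K7 : (3 * c.Δ + 2 * c.Θ + 6 * c.Ry) / c.ΘPlus ≤ K := by linarith
  have hK2 : 2 ≤ K := by linarith
  clear_value K
  rw [div_le_iff₀ (by positivity)] at K4 K5 K7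
  -- A single base, with `a = 1/εx` and `b = 1/εy`, dominates all quantities polynomially, and its
  -- logarithm splits into `log K` and the logarithms of the inverse accuracies.
  set P := K * a * b with hP
  have hKP : K ≤ P := by
    calc K = K * 1 * 1 := by ring
      _ ≤ K * a * b := by gcongr
  have hP2 : 2 ≤ P := hK2.trans hKP
  have hP1 : 1 ≤ P := by linarith
  have hP0 : 0 < P := by linarith
  have hpow : ∀ n : ℕ, n ≠ 0 → P ≤ P ^ n := fun n hn => le_self_pow₀ hP1 hn
  have hKa : K * a ^ 2 ≤ P ^ 2 := by
    calc K * a ^ 2 = K * a ^ 2 * 1 * 1 := by ring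
      _ ≤ K * a ^ 2 * K * b ^ 2 := by
        have : 1 ≤ b ^ 2 := one_le_pow₀ hb1
        gcongr
        linarith
      _ = P ^ 2 := by rw [hP]; ring
  have hKb : K * b ≤ P := by
    calc K * b = K * 1 * b := by ring
      _ ≤ K * a * b := by gcongr
  have hP26 : P ^ 2 ≤ P ^ 6 := pow_le_pow_right₀ hP1 (by norm_num)
  have hTx : (p.Tx : ℝ) ≤ c.outerConst * a ^ 2 := by
    have e : p.Tx = ⌈c.boundTx εx εy⌉₊ := by rw [hp]; rfl
    have h1 : c.boundTx εx εy ≤ 10 * (c.Lxx * (c.Δ + 2 * c.Ry)) * a ^ 2 := by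
      rw [boundTx, ha, inv_pow, div_eq_mul_inv]
      have : εy * c.Ry ≤ 1 * c.Ry := by gcongr
      have : c.Lxx * (εy * c.Ry) ≤ c.Lxx * c.Ry := by gcongr; linarith
      exact mul_le_mul_of_nonneg_right (by linarith) (by positivity)
    rw [e, outerConst]
    linarith [Nat.ceil_lt_add_one (boundTx_pos hc hx hy).le]
  have hTy : (p.Ty : ℝ) ≤ c.dualConst * Real.sqrt b := by
    have e : p.Ty = ⌈c.boundTy εy⌉₊ := by rw [hp]; rfl
    have h1 : c.boundTy εy ≤ Real.sqrt (40 * (1 + c.LyyPlus * c.Ry)) * Real.sqrt b := by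
      rw [boundTy, ← Real.sqrt_mul (by positivity)]
      apply Real.sqrt_le_sqrt
      have h3 : 40 * (c.LyyPlus + c.lam εy) / c.lam εy
          = 40 * (c.LyyPlus * c.Ry * b) + 40 := by
        rw [lam, hb]; field_simp
      rw [h3]; linarith
    rw [e, dualConst]
    linarith [Nat.ceil_lt_add_one (boundTy_pos hc hy).le]
  have hsb : Real.sqrt b ≤ b := by
    rw [Real.sqrt_le_iff]; exact ⟨by linarith, le_self_pow₀ hb1 two_ne_zero⟩
  have heR : 6 * εy * c.Ry ≤ 6 * c.Ry := by
    have : εy * c.Ry ≤ 1 * c.Ry := by gcongr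
    linarith
  refine (least_cost_le hc hx hy hP2 ?_ ?_ ?_ ?_ ?_ ?_ ?_ hp).trans ?_
  · rw [← hp]
    calc (p.Tx : ℝ) ≤ c.outerConst * a ^ 2 := hTx
      _ ≤ K * a ^ 2 := by gcongr
      _ ≤ P ^ 6 := hKa.trans hP26
  · rw [← hp]
    calc (p.Ty : ℝ) ≤ c.dualConst * Real.sqrt b := hTy
      _ ≤ K * b := by gcongr
      _ ≤ P ^ 5 := hKb.trans (hpow 5 (by norm_num))
  · calc c.ΘPlus = (c.LyyPlus * c.Ry) * (b * εy) * c.Ry := by rw [hbe, ΘPlus]; ring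
      _ ≤ K * (b * εy) * c.Ry := by gcongr
      _ = K * b * (εy * c.Ry) := by ring
      _ ≤ P ^ 2 * (εy * c.Ry) := by
        gcongr
        exact hKb.trans (hpow 2 two_ne_zero)
  · refine K4.trans ?_
    gcongr
    exact hKP.trans (hpow 2 two_ne_zero)
  · refine K5.trans ?_
    gcongr
    exact hKP.trans (hpow 2 two_ne_zero)
  · calc (3 * c.Δ + 2 * c.Θ + 6 * εy * c.Ry) * (c.Lxx / εx ^ 2)
        ≤ (3 * c.Δ + 2 * c.Θ + 6 * c.Ry) * (c.Lxx / εx ^ 2) := by gcongr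
      _ = (3 * c.Δ + 2 * c.Θ + 6 * c.Ry) * c.Lxx * a ^ 2 := by rw [ha]; field_simp
      _ ≤ K * a ^ 2 := by gcongr
      _ ≤ P ^ 6 := hKa.trans hP26
  · calc 3 * c.Δ + 2 * c.Θ + 6 * εy * c.Ry ≤ 3 * c.Δ + 2 * c.Θ + 6 * c.Ry := by linarith
      _ ≤ K * c.ΘPlus := K7
      _ ≤ P ^ 5 * c.ΘPlus := by
        gcongr
        exact hKP.trans (hpow 5 (by norm_num))
  · have hlK : 0 ≤ Real.log K := Real.log_nonneg (by linarith)
    have hla : 0 ≤ Real.log a := Real.log_nonneg ha1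
    have hlb : 0 ≤ Real.log b := Real.log_nonneg hb1
    have hlP : Real.log P = Real.log K + Real.log a + Real.log b := by
      rw [hP, Real.log_mul (by positivity) (by positivity), Real.log_mul (by positivity)
        (by positivity)]
    have hlP0 : 0 ≤ Real.log P := Real.log_nonneg hP1
    have h1 : Real.log P ≤ (1 + Real.log K) * (1 + Real.log a + Real.log b) := by
      rw [hlP]
      nlinarith [mul_nonneg hlK hla, mul_nonneg hlK hlb]
    calc 44000 * ((p.Tx : ℝ) * p.Ty) * Real.log P ^ 2
        ≤ 44000 * ((c.outerConst * a ^ 2) * (c.dualConst * Real.sqrt b))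
          * ((1 + Real.log K) * (1 + Real.log a + Real.log b)) ^ 2 := by gcongr
      _ = _ := by rw [complexityConst, hK, baseConst]; ring

end ProblemConstants

end

theorem theorem4p1 :
    -- an absolute constant, and one that depends on the problem constants alone
    ∃ (C : ℝ) (C' : ProblemConstants → ℝ),
      ∀ (E : Type u) (G : Type v)
        [NormedAddCommGroup E] [InnerProductSpace ℝ E] [FiniteDimensional ℝ E] [CompleteSpace E]
        [NormedAddCommGroup G] [InnerProductSpace ℝ G] [FiniteDimensional ℝ G] [CompleteSpace G]
        (F : E → G → ℝ) (X : Set E) (Y : Set G) (c : ProblemConstants) (x₀ : E) (ybar : G)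
        (εx εy : ℝ),
        c.Pos → 0 < εx → 0 < εy →
        SmoothConcaveProblem F X Y c →
        x₀ ∈ X → ybar ∈ Y →
        BddBelow (primal F Y '' X) → primalGap F X Y x₀ ≤ c.Δ →
        -- guarantee and cost, for all prescribed parameters
        (∀ p : FSPParams, c.Prescribed εx εy p →
          (∃ q, IsFSPOutput F X Y p x₀ ybar q) ∧
          (∀ q, IsFSPOutput F X Y p x₀ ybar q → IsFNE F X Y c (2 * εx) (5 * εy) q.1 q.2) ∧
          (X = Set.univ → ∀ q, IsFSPGradOutput F X Y p x₀ ybar q →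
            IsFNE F X Y c (2 * εx) (5 * εy) q.1 q.2) ∧
          (fspRun F X Y p x₀ ybar).grads = p.Tx * (p.Sy * p.Ty + 1) * (p.To * p.So + 1) ∧
          ((fspRun F X Y p x₀ ybar).grads : ℝ)
            ≤ 51 / 50 * ((p.To : ℝ) * p.So * p.Sy * p.Tx * p.Ty) ∧
          (fspRun F X Y p x₀ ybar).projs ≤ 2 * (fspRun F X Y p x₀ ybar).grads) ∧
        -- complexity with the least prescribed parameters, through the complexity factors
        (1 ≤ c.factorX εx → 1 ≤ c.factorY εy → εy * c.Ry ≤ c.Δ →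
          ((fspRun F X Y (c.leastParams εx εy) x₀ ybar).grads : ℝ)
            ≤ C * (c.factorX εx * c.factorY εy) * Real.log (c.logArg εx εy) ^ 2) ∧
        -- complexity with the least prescribed parameters, through the accuracies
        (εx ≤ 1 → εy ≤ 1 →
          ((fspRun F X Y (c.leastParams εx εy) x₀ ybar).grads : ℝ)
            ≤ C' c * (εx⁻¹ ^ 2 * Real.sqrt εy⁻¹)
              * (1 + Real.log εx⁻¹ + Real.log εy⁻¹) ^ 2) := by
  -- The absolute constant is `44000 · 31 · 10`, from `Tx ≤ 31 factorX` and `Ty ≤ 10 factorY`.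
  refine ⟨13640000, ProblemConstants.complexityConst, ?_⟩
  intro E G _ _ _ _ _ _ _ _ F X Y c x₀ ybar εx εy hc hx hy hP hx₀ hybar hbdd hgap
  refine ⟨fun p hp => ⟨exists_isOutputBy F X Y (hp.Tx_pos hc hx hy) x₀ ybar _,
    fun q hq => isFNE_of_isFSPOutput hP hc hp hx hy hx₀ hybar hbdd hgap hq,
    fun hX q hq => isFNE_of_isFSPGradOutput hP hc hp hx hy hx₀ hybar hbdd hgap hX hq,
    (fspRun_cost F X Y p x₀ ybar).1, fspRun_grads_le F X Y hp hc hx hy x₀ ybar,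
    (fspRun_cost F X Y p x₀ ybar).2⟩, fun h1 h2 h3 => ?_, fun h1 h2 => ?_⟩
  · exact (fspRun_grads_le F X Y (c.leastParams_prescribed εx εy) hc hx hy x₀ ybar).trans
      (ProblemConstants.factorX_cost_le hc hx hy h1 h2 h3 rfl)
  · exact (fspRun_grads_le F X Y (c.leastParams_prescribed εx εy) hc hx hy x₀ ybar).trans
      (ProblemConstants.accuracy_cost_le hc hx hy h1 h2 rfl)
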